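/- Let $p>1$, let $s,q,V:\mathbb{R}^3\to(0,\infty)$ be radially symmetric $C^2$-functions and let $T=2\pi\sqrt{s(0)/q(0)}$. Assume (H1) $T\sqrt{q(x)/s(x)}<2\pi$ for all $x\in\mathbb{R}^3\setminus\{0\}$; (H2) $f(x)=\left|2\pi-T\sqrt{q(x)/s(x)}\right|^{\frac1{p-1}}$ tends to $0$ in the $C^2$-sense as $x\to0$, i.e. $f(x)\to 0$, $\nabla f(x)\to 0$ and $D^2f(x)\to0$ as $x\to 0$, $x\neq 0$; (H3) $\sup_{x\in\mathbb{R}^3}\left|2\pi-T\sqrt{q(x)/s(x)}\right|e^{\delta(p-1)|x|}<\infty$ for some $\delta>0$; (H4) $\sup_{x\in\mathbb{R}^3}q(x)/V(x)<\infty$. Call $U:\mathbb{R}^3\times\mathbb{R}\to\mathbb{R}^3$ a $T$-periodic breather with decay rate $\delta$ if $U\in C^2(\mathbb{R}^3\times\mathbb{R})$, $U$ solves $$s(x)\,\partial_t^2U+\nabla\times\nabla\times U+q(x)U+V(x)|U|^{p-1}U=0\quad\text{on }\mathbb{R}^3\times\mathbb{R},$$ $U(x,t+T)=U(x,t)$ for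 all $(x,t)$, $\sup_{\mathbb{R}^3\times\mathbb{R}}|U(x,t)|e^{\delta|x|}<\infty$, and $U$ is not constant in time (in particular $U\not\equiv0$). Then, with $\delta$ from (H3), there exists a $T$-periodic breather $U$ with decay rate $\delta$ such that $U(\cdot,t)$ is, for every $t$, the gradient of a radially symmetric function. For every radially symmetric $C^2$-function $a:\mathbb{R}^3\to\mathbb{R}$ the phase-shifted field $U_a(x,t)=U(x,t+a(x))$ is again a $T$-periodic breather with decay rate $\delta$ and, for every $t$, the gradient of a radially symmetric function; and these $U_a$ form a continuum, i.e. the set of all of them has at least the cardinality of $\mathbb{R}$. -/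

import Mathlib

open scoped Topology Cardinal

/-- Three-dimensional Euclidean space, with the Euclidean norm. -/
abbrev E3 : Type := EuclideanSpace ℝ (Fin 3)

/-- A function on `ℝ³` is radially symmetric if it depends on `|x|` only. -/
def IsRadial {α : Type*} (f : E3 → α) : Prop :=
  ∀ x y : E3, ‖x‖ = ‖y‖ → f x = f y

/-- `f → 0` in the `C²`-sense as `x → 0`: the function `f` is `C²` at all points `x ≠ 0`
near `0`, and `f`, its first and its second derivative tend to `0` as `x → 0`, `x ≠ 0`. -/
structure TendstoZeroC2 (f : E3 → ℝ) : Prop where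
  contDiffAt : ∀ᶠ x in 𝓝[≠] (0 : E3), ContDiffAt ℝ 2 f x
  tendsto : Filter.Tendsto f (𝓝[≠] 0) (𝓝 0)
  tendsto_fderiv : Filter.Tendsto (fderiv ℝ f) (𝓝[≠] 0) (𝓝 0)
  tendsto_fderiv_fderiv : Filter.Tendsto (fderiv ℝ (fderiv ℝ f)) (𝓝[≠] 0) (𝓝 0)

/-- The partial derivative `∂Fᵢ/∂xⱼ` at `x` of a vector field `F` on `ℝ³`. -/
noncomputable def partialD (F : E3 → E3) (i j : Fin 3) (x : E3) : ℝ :=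
  (fderiv ℝ F x (EuclideanSpace.single j 1)) i

/-- The curl `∇ × F` of a vector field on `ℝ³`. -/
noncomputable def curl (F : E3 → E3) (x : E3) : E3 :=
  !₂[partialD F 2 1 x - partialD F 1 2 x,
     partialD F 0 2 x - partialD F 2 0 x,
     partialD F 1 0 x - partialD F 0 1 x]

/-- `U` is a classical (`C²` in `(x, t)`) solution on `ℝ³ × ℝ` of
`s(x) ∂ₜ²U + ∇ × ∇ × U + q(x) U + V(x) |U|^(p-1) U = 0`. -/
structure IsClassicalSolution (s q V : E3 → ℝ) (p : ℝ) (U : E3 → ℝ → E3) : Prop where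
  contDiff : ContDiff ℝ 2 (fun z : E3 × ℝ => U z.1 z.2)
  equation : ∀ (x : E3) (t : ℝ),
    s x • deriv (deriv (fun t' => U x t')) t + curl (curl (fun x' => U x' t)) x
      + q x • U x t + (V x * ‖U x t‖ ^ (p - 1)) • U x t = 0

/-- `U` is a `T`-periodic breather with exponential localization rate `δ`: a classical solution,
`T`-periodic in time, with `sup |U(x,t)| e^(δ|x|) < ∞`, that is not constant in time
(in particular not the zero solution). -/
structure IsBreather (s q V : E3 → ℝ) (p T δ : ℝ) (U : E3 → ℝ → E3) : Prop where
  solution : IsClassicalSolution s q V p U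
  periodic : ∀ x : E3, Function.Periodic (U x) T
  localized : BddAbove (Set.range fun z : E3 × ℝ => ‖U z.1 z.2‖ * Real.exp (δ * ‖z.1‖))
  nonstationary : ∃ (x : E3) (t t' : ℝ), U x t ≠ U x t'

/-- At every time `t`, the field `U(·, t)` is the gradient of a radially symmetric function. -/
def IsRadialGradientField (U : E3 → ℝ → E3) : Prop :=
  ∀ t : ℝ, ∃ Φ : E3 → ℝ, IsRadial Φ ∧ ∀ x : E3, HasGradientAt Φ (U x t) x

/-- The phase-shifted field `U_a(x, t) = U(x, t + a(x))`. -/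
def phaseShift (U : E3 → ℝ → E3) (a : E3 → ℝ) : E3 → ℝ → E3 :=
  fun x t => U x (t + a x)

/-! Put α = p - 1. A field h(x,t) x/|x| with h radial in x, continuous and zero at the origin is a
gradient, so its curl vanishes and the equation decouples into an oscillator s h'' + q h + V|h|^α h
= 0 at each x. With κ = (q/V)^(1/α) and ω = √(q/s), the ansatz h = κ(x) z(ω(x)t) turns all of them
into z'' + z + |z|^α z = 0. This oscillator is hardening: the period of its orbits decreases
strictly from 2π to 0 as the amplitude grows. For h to have period T the orbit at x is chosen with
period Tω(x). For x ≠ 0, (H1) puts this number in (0, 2π), which determines an amplitude e^r(x). At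
the origin Tω = 2π, and the field is set to zero there.

The orbits are described by w with w²/2 = z²/2 + |z|^(α+2)/(α+2). An energy level becomes the circle
w = e^ρ sin φ, z' = e^ρ cos φ, and dt = (dz/dw) dφ, where dz/dw depends on u = |z|^α alone.
Differentiation in ρ acts as w d/dw, which keeps the integrands needed here continuous functions of
u, although |z|^α itself may fail to be differentiable at 0. This makes the orbit C² in (t, ρ)
(`contDiff_orbit`), with derivatives O(e^ρ) as ρ → -∞ (`exists_norm_fderiv_orbit_le`). It also makes
the defect, π minus the half period, comparable to its ρ-derivative and an upper bound, up to a
constant, for its second derivative and for e^(αρ) (`exists_periodDefect_bounds`).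

The crux is C² regularity at the origin. The function f of (H2) equals (2 · defect)^(1/α) at r(x),
so e^r ≲ f and f|Dr| ≲ |Df| near 0. The worst chain-rule term e^r|Dr|² is then ≲ |Df|²/f, which
tends to 0 by Landau's inequality for nonnegative functions with small Hessian
(`eventually_norm_fderiv_sq_le_punctured`, `tendsto_exp_mul_norm_fderiv`). Thus the profile and its
first two derivatives tend to 0 at the time axis. Integrating back gives orders o(|x|²), o(|x|),
o(1), which beat the singular derivatives of x/|x| (`contDiff_two_smul_of_tendsto_nhdsOffAxis`).

Localization follows from e^r ≲ f with (H3) and (H4). A radial phase shift keeps the field curl-free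
and solves the same pointwise ODE. Constant shifts already give a continuum. -/

section SecondDerivatives

/-! ### Chain and product rules for second derivatives -/

variable {E F G : Type*} [NormedAddCommGroup E] [NormedSpace ℝ E] [NormedAddCommGroup F]
  [NormedSpace ℝ F] [NormedAddCommGroup G] [NormedSpace ℝ G]

theorem ContDiffAt.eventually_differentiableAt {f : E → F} {x : E} (hf : ContDiffAt ℝ 2 f x) :
    ∀ᶠ y in 𝓝 x, DifferentiableAt ℝ f y :=
  (hf.eventually (by simp)).mono fun _ hy => hy.differentiableAt (by simp)

theorem ContDiffAt.differentiableAt_fderiv {f : E → F} {x : E} (hf : ContDiffAt ℝ 2 f x) :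
    DifferentiableAt ℝ (fderiv ℝ f) x :=
  (hf.fderiv_right (m := 1) (by norm_num)).differentiableAt (by simp)

theorem fderiv_fderiv_comp_apply {g : F → G} {f : E → F} {x : E} (hg : ContDiffAt ℝ 2 g (f x))
    (hf : ContDiffAt ℝ 2 f x) (v w : E) :
    fderiv ℝ (fderiv ℝ fun y => g (f y)) x v w =
      fderiv ℝ (fderiv ℝ g) (f x) (fderiv ℝ f x v) (fderiv ℝ f x w) +
        fderiv ℝ g (f x) (fderiv ℝ (fderiv ℝ f) x v w) := by
  have h1 : (fderiv ℝ fun y => g (f y)) =ᶠ[𝓝 x]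
      fun y => (fderiv ℝ g (f y)).comp (fderiv ℝ f y) := by
    filter_upwards [hf.eventually_differentiableAt,
      hf.continuousAt.eventually hg.eventually_differentiableAt] with y h1 h2
    exact fderiv_comp y h2 h1
  rw [h1.fderiv_eq]
  have h2 : HasFDerivAt (fun y => fderiv ℝ g (f y))
      ((fderiv ℝ (fderiv ℝ g) (f x)).comp (fderiv ℝ f x)) x :=
    hg.differentiableAt_fderiv.hasFDerivAt.comp x (hf.differentiableAt (by simp)).hasFDerivAt
  rw [(h2.clm_comp hf.differentiableAt_fderiv.hasFDerivAt).fderiv]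
  simp [add_comm]

theorem norm_fderiv_fderiv_comp_le {g : F → G} {f : E → F} {x : E} (hg : ContDiffAt ℝ 2 g (f x))
    (hf : ContDiffAt ℝ 2 f x) :
    ‖fderiv ℝ (fderiv ℝ fun y => g (f y)) x‖ ≤
      ‖fderiv ℝ (fderiv ℝ g) (f x)‖ * ‖fderiv ℝ f x‖ ^ 2 +
        ‖fderiv ℝ g (f x)‖ * ‖fderiv ℝ (fderiv ℝ f) x‖ := by
  refine ContinuousLinearMap.opNorm_le_bound₂ _ (by positivity) fun v w => ?_
  rw [fderiv_fderiv_comp_apply hg hf]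
  refine (norm_add_le _ _).trans ?_
  have h1 := (fderiv ℝ (fderiv ℝ g) (f x)).le_opNorm₂ (fderiv ℝ f x v) (fderiv ℝ f x w)
  have h2 := (fderiv ℝ g (f x)).le_opNorm (fderiv ℝ (fderiv ℝ f) x v w)
  have h3 := (fderiv ℝ (fderiv ℝ f) x).le_opNorm₂ v w
  have h4 := (fderiv ℝ f x).le_opNorm v
  have h5 := (fderiv ℝ f x).le_opNorm w
  calc _ ≤ ‖fderiv ℝ (fderiv ℝ g) (f x)‖ * (‖fderiv ℝ f x‖ * ‖v‖) * (‖fderiv ℝ f x‖ * ‖w‖) +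
        ‖fderiv ℝ g (f x)‖ * (‖fderiv ℝ (fderiv ℝ f) x‖ * ‖v‖ * ‖w‖) := by
        refine add_le_add (h1.trans ?_) (h2.trans ?_) <;> gcongr
    _ = _ := by ring

theorem norm_fderiv_comp_le {g : F → G} {f : E → F} {x : E} (hg : DifferentiableAt ℝ g (f x))
    (hf : DifferentiableAt ℝ f x) :
    ‖fderiv ℝ (fun y => g (f y)) x‖ ≤ ‖fderiv ℝ g (f x)‖ * ‖fderiv ℝ f x‖ := by
  rw [show (fun y => g (f y)) = g ∘ f from rfl, fderiv_comp x hg hf]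
  exact ContinuousLinearMap.opNorm_comp_le _ _

theorem norm_fderiv_smul_le {f : E → ℝ} {g : E → F} {x : E} (hf : DifferentiableAt ℝ f x)
    (hg : DifferentiableAt ℝ g x) :
    ‖fderiv ℝ (fun y => f y • g y) x‖ ≤ ‖f x‖ * ‖fderiv ℝ g x‖ + ‖fderiv ℝ f x‖ * ‖g x‖ := by
  rw [fderiv_fun_smul hf hg]
  refine (norm_add_le _ _).trans (add_le_add (norm_smul _ _).le ?_)
  rw [ContinuousLinearMap.norm_smulRight_apply]

theorem norm_fderiv_fderiv_smul_le {f : E → ℝ} {g : E → F} {x : E} (hf : ContDiffAt ℝ 2 f x)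
    (hg : ContDiffAt ℝ 2 g x) :
    ‖fderiv ℝ (fderiv ℝ fun y => f y • g y) x‖ ≤ ‖f x‖ * ‖fderiv ℝ (fderiv ℝ g) x‖ +
      2 * (‖fderiv ℝ f x‖ * ‖fderiv ℝ g x‖) + ‖fderiv ℝ (fderiv ℝ f) x‖ * ‖g x‖ := by
  have h1 : (fderiv ℝ fun y => f y • g y) =ᶠ[𝓝 x]
      fun y => f y • fderiv ℝ g y +
        (ContinuousLinearMap.smulRightL ℝ E F) (fderiv ℝ f y) (g y) := by
    filter_upwards [hf.eventually_differentiableAt, hg.eventually_differentiableAt] with y h1 h2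
    simp [fderiv_fun_smul h1 h2]
  rw [h1.fderiv_eq]
  have h2 := (hf.differentiableAt (by simp)).hasFDerivAt.fun_smul
    hg.differentiableAt_fderiv.hasFDerivAt
  have h3 := (ContinuousLinearMap.smulRightL ℝ E F).hasFDerivAt_of_bilinear
    hf.differentiableAt_fderiv.hasFDerivAt (hg.differentiableAt (by simp)).hasFDerivAt
  rw [(h2.fun_add h3).fderiv]
  refine ContinuousLinearMap.opNorm_le_bound₂ _ (by positivity) fun v w => ?_
  have k1 := (fderiv ℝ (fderiv ℝ g) x).le_opNorm₂ v w
  have k2 := (fderiv ℝ (fderiv ℝ f) x).le_opNorm₂ v w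
  have k3 := (fderiv ℝ f x).le_opNorm v
  have k4 := (fderiv ℝ f x).le_opNorm w
  have k5 := (fderiv ℝ g x).le_opNorm v
  have k6 := (fderiv ℝ g x).le_opNorm w
  -- Stated for an arbitrary `A` so that unification supplies the derivative and `rfl` evaluates it
  -- at `v`, `w`.
  have e : ∀ A : E →L[ℝ] E →L[ℝ] F, A = f x • fderiv ℝ (fderiv ℝ g) x +
      (fderiv ℝ f x).smulRight (fderiv ℝ g x) +
      (ContinuousLinearMap.precompR E (ContinuousLinearMap.smulRightL ℝ E F) (fderiv ℝ f x)
        (fderiv ℝ g x) + ContinuousLinearMap.precompL E (ContinuousLinearMap.smulRightL ℝ E F)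
        (fderiv ℝ (fderiv ℝ f) x) (g x)) → A v w = f x • fderiv ℝ (fderiv ℝ g) x v w +
          fderiv ℝ f x v • fderiv ℝ g x w +
        (fderiv ℝ f x w • fderiv ℝ g x v + fderiv ℝ (fderiv ℝ f) x v w • g x) := by
    rintro A rfl
    rfl
  rw [e _ rfl]
  calc _ ≤ ‖f x‖ * ‖fderiv ℝ (fderiv ℝ g) x v w‖ + ‖fderiv ℝ f x v‖ * ‖fderiv ℝ g x w‖ +
      (‖fderiv ℝ f x w‖ * ‖fderiv ℝ g x v‖ + ‖fderiv ℝ (fderiv ℝ f) x v w‖ * ‖g x‖) := by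
        refine (norm_add_le _ _).trans (add_le_add ((norm_add_le _ _).trans ?_)
          ((norm_add_le _ _).trans ?_)) <;> simp only [norm_smul] <;> rfl
    _ ≤ ‖f x‖ * (‖fderiv ℝ (fderiv ℝ g) x‖ * ‖v‖ * ‖w‖) +
        (‖fderiv ℝ f x‖ * ‖v‖) * (‖fderiv ℝ g x‖ * ‖w‖) +
      ((‖fderiv ℝ f x‖ * ‖w‖) * (‖fderiv ℝ g x‖ * ‖v‖) +
        (‖fderiv ℝ (fderiv ℝ f) x‖ * ‖v‖ * ‖w‖) * ‖g x‖) := by gcongr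
    _ = _ := by ring

/-- A left inverse of a `C^n` map with invertible derivative is `C^n`. -/
theorem ContDiffAt.of_leftInverse [CompleteSpace E] {f : E → F} {g : F → E} {x : E} {n : WithTop ℕ∞}
    (hn : n ≠ 0) {f' : E ≃L[ℝ] F} (hf : ContDiffAt ℝ n f x)
    (hf' : HasFDerivAt f (f' : E →L[ℝ] F) x) (hg : ∀ᶠ y in 𝓝 x, g (f y) = y) :
    ContDiffAt ℝ n g (f x) := by
  have hloc := hf.to_localInverse hf' hn
  refine hloc.congr_of_eventuallyEq ?_
  have hs := hf.hasStrictFDerivAt' hf' hn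
  have hx : hf.localInverse hf' hn (f x) = x := hf.localInverse_apply_image hf' hn
  -- A left inverse of `f` near `x` must agree near `f x` with the local inverse, since the latter
  -- is also a right inverse there.
  have h1 : ∀ᶠ y in 𝓝 (f x), f (hf.localInverse hf' hn y) = y := hs.eventually_right_inverse
  have h2 : ∀ᶠ y in 𝓝 (f x), g (f (hf.localInverse hf' hn y)) = hf.localInverse hf' hn y := by
    have hc : Filter.Tendsto (hf.localInverse hf' hn) (𝓝 (f x)) (𝓝 x) := by
      have := hloc.continuousAt
      rwa [ContinuousAt, hx] at this
    exact hc.eventually hg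
  filter_upwards [h1, h2] with y h1 h2
  rw [← h2, h1]

end SecondDerivatives

/-! ### Mean value and Landau inequalities near a puncture -/

section Punctured

variable {E G : Type*} [NormedAddCommGroup E] [NormedSpace ℝ E] [NormedAddCommGroup G]
  [NormedSpace ℝ G]

/-- The mean value inequality holds on the segment from `s • x` to `x`, which avoids the origin for
s > 0; then s → 0. -/
theorem norm_le_of_norm_fderiv_le_punctured {W : E → G} {r ε : ℝ}
    (hd : ∀ x, x ≠ 0 → ‖x‖ < r → DifferentiableAt ℝ W x)
    (hb : ∀ x, x ≠ 0 → ‖x‖ < r → ‖fderiv ℝ W x‖ ≤ ε) (h0 : Filter.Tendsto W (𝓝[≠] 0) (𝓝 0))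
    {x : E} (hx : x ≠ 0) (hxr : ‖x‖ < r) : ‖W x‖ ≤ ε * ‖x‖ := by
  have hε : 0 ≤ ε := (norm_nonneg _).trans (hb x hx hxr)
  have key : ∀ s : ℝ, 0 < s → s < 1 → ‖W x - W (s • x)‖ ≤ ε * ‖x‖ := by
    intro s hs0 hs1
    have hseg : ∀ y ∈ segment ℝ (s • x) x, y ≠ 0 ∧ ‖y‖ < r := by
      rintro y ⟨a, b, ha, hb, hab, rfl⟩
      have : a • s • x + b • x = (a * s + b) • x := by module
      have hpos : 0 < a * s + b := by
        rcases hb.eq_or_lt with rfl | hb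
        · have : a = 1 := by linarith
          subst this; linarith
        · positivity
      have hle : a * s + b ≤ 1 := by nlinarith
      rw [this]
      refine ⟨smul_ne_zero hpos.ne' hx, ?_⟩
      rw [norm_smul, Real.norm_of_nonneg hpos.le]
      nlinarith [norm_nonneg x]
    have := (convex_segment (𝕜 := ℝ) (s • x) x).norm_image_sub_le_of_norm_fderiv_le (𝕜 := ℝ)
      (fun y hy => hd y (hseg y hy).1 (hseg y hy).2)
      (fun y hy => hb y (hseg y hy).1 (hseg y hy).2)
      (left_mem_segment ℝ _ _) (right_mem_segment ℝ _ _)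
    refine this.trans (mul_le_mul_of_nonneg_left ?_ hε)
    have : x - s • x = (1 - s) • x := by module
    rw [this, norm_smul, Real.norm_of_nonneg (by linarith)]
    nlinarith [norm_nonneg x]
  have hlim : Filter.Tendsto (fun s : ℝ => W (s • x)) (𝓝[>] 0) (𝓝 0) := by
    refine h0.comp (tendsto_nhdsWithin_iff.2 ⟨?_, ?_⟩)
    · have : Filter.Tendsto (fun s : ℝ => s • x) (𝓝 0) (𝓝 ((0 : ℝ) • x)) :=
        (continuous_id.smul continuous_const).tendsto 0
      rw [zero_smul] at this
      exact this.mono_left nhdsWithin_le_nhds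
    · filter_upwards [self_mem_nhdsWithin] with s hs
      exact smul_ne_zero (ne_of_gt hs) hx
  have h2 : Filter.Tendsto (fun s : ℝ => ‖W x - W (s • x)‖) (𝓝[>] 0) (𝓝 ‖W x - 0‖) :=
    (tendsto_const_nhds.sub hlim).norm
  rw [sub_zero] at h2
  refine le_of_tendsto h2 ?_
  filter_upwards [Ioo_mem_nhdsGT (zero_lt_one' ℝ)] with s hs using key s hs.1 hs.2

/-- Landau's inequality near an isolated zero of a nonnegative function that is flat there:
`|Df|² = o(f)`. -/
theorem eventually_norm_fderiv_sq_le_punctured {f : E → ℝ} (hnn : ∀ x, 0 ≤ f x)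
    (hc : ∀ᶠ x in 𝓝[≠] (0 : E), ContDiffAt ℝ 2 f x)
    (h1 : Filter.Tendsto (fderiv ℝ f) (𝓝[≠] 0) (𝓝 0))
    (h2 : Filter.Tendsto (fun x => ‖fderiv ℝ (fderiv ℝ f) x‖) (𝓝[≠] 0) (𝓝 0))
    {ε : ℝ} (hε : 0 < ε) :
    ∀ᶠ x in 𝓝[≠] (0 : E), ‖fderiv ℝ f x‖ ^ 2 ≤ 4 * ε * f x := by
  have h2' : ∀ᶠ x in 𝓝[≠] (0 : E), ‖fderiv ℝ (fderiv ℝ f) x‖ < ε :=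
    h2.eventually (gt_mem_nhds hε)
  obtain ⟨r, hr, hball⟩ := Metric.eventually_nhds_iff.1 (eventually_nhdsWithin_iff.1 (hc.and h2'))
  have hball' : ∀ x : E, x ≠ 0 → ‖x‖ < r →
      ContDiffAt ℝ 2 f x ∧ ‖fderiv ℝ (fderiv ℝ f) x‖ < ε := fun x hx hxr =>
    hball (by simpa using hxr) hx
  rw [eventually_nhdsWithin_iff, Metric.eventually_nhds_iff]
  refine ⟨r / 2, by positivity, fun x hxr hx => ?_⟩
  replace hxr : ‖x‖ < r / 2 := by simpa using hxr
  have hx : x ≠ 0 := hx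
  have hxpos : 0 < ‖x‖ := norm_pos_iff.2 hx
  have hDf : ‖fderiv ℝ f x‖ ≤ ε * ‖x‖ := norm_le_of_norm_fderiv_le_punctured (r := r)
    (fun y hy hyr => (hball' y hy hyr).1.differentiableAt_fderiv)
    (fun y hy hyr => (hball' y hy hyr).2.le) h1 hx (by linarith)
  have hdir : ∀ v : E, |fderiv ℝ f x v| ≤ √(4 * ε * f x) * ‖v‖ := by
    intro v
    rcases eq_or_ne v 0 with rfl | hv
    · simp
    have hvpos : 0 < ‖v‖ := norm_pos_iff.2 hv
    set d := fderiv ℝ f x v with hd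
    -- This step length minimizes the quadratic -h d + ε h² ‖v‖² that bounds f(x - hv) - f(x).
    set h : ℝ := d / (2 * ε * ‖v‖ ^ 2) with hh
    have hd_le : |d| ≤ ε * ‖x‖ * ‖v‖ := by
      refine ((fderiv ℝ f x).le_opNorm v).trans ?_
      gcongr
    -- Because |Df(x)| ≤ ε|x|, the optimal step is at most |x|/2, so the ball used for Taylor's
    -- formula stays away from the puncture.
    have hhv : |h| * ‖v‖ ≤ ‖x‖ / 2 := by
      rw [hh, abs_div, abs_of_pos (by positivity : 0 < 2 * ε * ‖v‖ ^ 2), div_mul_eq_mul_div,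
        div_le_iff₀ (by positivity)]
      nlinarith
    have hb : ∀ y ∈ Metric.closedBall x (|h| * ‖v‖), y ≠ 0 ∧ ‖y‖ < r := by
      intro y hy
      rw [Metric.mem_closedBall, dist_eq_norm] at hy
      constructor
      · rintro rfl
        rw [zero_sub, norm_neg] at hy
        linarith
      · have : ‖y‖ ≤ ‖y - x‖ + ‖x‖ := by simpa using norm_add_le (y - x) x
        linarith
    have hconv : Convex ℝ (Metric.closedBall x (|h| * ‖v‖)) := convex_closedBall _ _
    have hxm : x ∈ Metric.closedBall x (|h| * ‖v‖) := Metric.mem_closedBall_self (by positivity)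
    have hym : x - h • v ∈ Metric.closedBall x (|h| * ‖v‖) := by
      simp [Metric.mem_closedBall, norm_smul]
    have hlip : ∀ y ∈ Metric.closedBall x (|h| * ‖v‖),
        ‖fderiv ℝ f y - fderiv ℝ f x‖ ≤ ε * (|h| * ‖v‖) := by
      intro y hy
      have := hconv.norm_image_sub_le_of_norm_fderiv_le (𝕜 := ℝ)
        (fun y hy => (hball' y (hb y hy).1 (hb y hy).2).1.differentiableAt_fderiv)
        (fun y hy => (hball' y (hb y hy).1 (hb y hy).2).2.le) hxm hy
      refine this.trans ?_
      gcongr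
      simpa [dist_eq_norm] using hy
    -- Taylor's formula with the remainder ε‖hv‖², not ε‖hv‖²/2; hence the constant 4 rather than 2.
    -- Together with f(x - hv) ≥ 0 it bounds d².
    have htay := hconv.norm_image_sub_le_of_norm_fderiv_le' (𝕜 := ℝ)
      (fun y hy => (hball' y (hb y hy).1 (hb y hy).2).1.differentiableAt (by simp)) hlip hxm hym
    have e1 : x - h • v - x = -(h • v) := by abel
    rw [e1, norm_neg, norm_smul, map_neg, map_smul, smul_eq_mul, ← hd, Real.norm_eq_abs,
      Real.norm_eq_abs] at htay
    have h3 := (abs_le.1 htay).2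
    have h4 := hnn (x - h • v)
    have h5 : ε * (|h| * ‖v‖) * (|h| * ‖v‖) = ε * h ^ 2 * ‖v‖ ^ 2 := by
      rw [← sq_abs h]; ring
    rw [h5] at h3
    have h6 : h * d - ε * h ^ 2 * ‖v‖ ^ 2 = d ^ 2 / (4 * ε * ‖v‖ ^ 2) := by
      rw [hh]; field_simp; ring
    have h7 : d ^ 2 / (4 * ε * ‖v‖ ^ 2) ≤ f x := by linarith
    rw [div_le_iff₀ (by positivity)] at h7
    rw [← Real.sqrt_sq hvpos.le, ← Real.sqrt_mul (by have := hnn x; positivity)]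
    exact Real.abs_le_sqrt (by linarith)
  have := (fderiv ℝ f x).opNorm_le_bound (by positivity) hdir
  have h0 : 0 ≤ 4 * ε * f x := by have := hnn x; positivity
  calc ‖fderiv ℝ f x‖ ^ 2 ≤ √(4 * ε * f x) ^ 2 := by gcongr
    _ = _ := Real.sq_sqrt h0

end Punctured

set_option maxSynthPendingDepth 3

/-! ### Gluing C² functions across the time axis -/

section Axis

/-- Approach to the point `(0, t)` of the time axis from off the axis. -/
def nhdsOffAxis (E : Type*) [NormedAddCommGroup E] (t : ℝ) : Filter (E × ℝ) :=
  𝓝[{z : E × ℝ | z.1 ≠ 0}] (0, t)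

theorem continuous_of_tendsto_nhdsOffAxis {E G : Type*} [NormedAddCommGroup E]
    [NormedAddCommGroup G] {W : E × ℝ → G} (hc : ∀ z, z.1 ≠ 0 → ContinuousAt W z)
    (hz : ∀ t, W (0, t) = 0) (h : ∀ t, Filter.Tendsto (fun z => ‖W z‖) (nhdsOffAxis E t) (𝓝 0)) :
    Continuous W := by
  rw [continuous_iff_continuousAt]
  rintro ⟨x, t⟩
  rcases eq_or_ne x 0 with rfl | hx
  · rw [ContinuousAt, hz, tendsto_zero_iff_norm_tendsto_zero, Metric.tendsto_nhds]
    intro ε hε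
    have h1 := (Metric.tendsto_nhds.1 (h t)) ε hε
    rw [nhdsOffAxis, eventually_nhdsWithin_iff] at h1
    filter_upwards [h1] with z hz'
    rcases eq_or_ne z.1 0 with h0 | h0
    · have : z = (0, z.2) := Prod.ext h0 rfl
      rw [this, hz]
      simpa using hε
    · exact hz' h0
  · exact hc _ hx

theorem eventually_nhdsOffAxis_iff {E : Type*} [NormedAddCommGroup E] {P : E × ℝ → Prop} {t : ℝ} :
    (∀ᶠ z in nhdsOffAxis E t, P z) ↔
    ∃ r > 0, ∀ (x : E) (τ : ℝ), x ≠ 0 → ‖x‖ < r → dist τ t < r → P (x, τ) := by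
  rw [nhdsOffAxis, eventually_nhdsWithin_iff, Metric.eventually_nhds_iff]
  refine exists_congr fun r => and_congr_right fun _ => ⟨fun h x τ hx hxr hτ => h ?_ hx, ?_⟩
  · rw [Prod.dist_eq, max_lt_iff, dist_zero_right]
    exact ⟨hxr, hτ⟩
  · rintro h ⟨x, τ⟩ hz hx
    rw [Prod.dist_eq, max_lt_iff, dist_zero_right] at hz
    exact h x τ hx hz.1 hz.2

variable {E G : Type*} [NormedAddCommGroup E] [NormedSpace ℝ E] [NormedAddCommGroup G]
  [NormedSpace ℝ G]

/-- The time is frozen, so that the punctured estimate applies in x alone and the constant is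
uniform for nearby times. -/
theorem norm_le_of_norm_fderiv_le_offAxis {W : E × ℝ → G}
    (hd : ∀ z, z.1 ≠ 0 → DifferentiableAt ℝ W z)
    (h0 : ∀ t, Filter.Tendsto (fun z => ‖W z‖) (nhdsOffAxis E t) (𝓝 0)) {r ε τ : ℝ}
    (hb : ∀ x : E, x ≠ 0 → ‖x‖ < r → ‖fderiv ℝ W (x, τ)‖ ≤ ε) {x : E} (hx : x ≠ 0)
    (hxr : ‖x‖ < r) : ‖W (x, τ)‖ ≤ ε * ‖x‖ := by
  have hcomp : ∀ y : E, y ≠ 0 → ‖y‖ < r →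
      HasFDerivAt (fun y => W (y, τ)) ((fderiv ℝ W (y, τ)).comp (ContinuousLinearMap.inl ℝ E ℝ)) y :=
    fun y hy _ => (hd (y, τ) hy).hasFDerivAt.comp y (hasFDerivAt_prodMk_left y τ)
  refine norm_le_of_norm_fderiv_le_punctured (r := r) (W := fun y => W (y, τ))
    (fun y hy hyr => (hcomp y hy hyr).differentiableAt) (fun y hy hyr => ?_) ?_ hx hxr
  · rw [(hcomp y hy hyr).fderiv]
    refine (ContinuousLinearMap.opNorm_comp_le _ _).trans ?_
    calc _ ≤ ‖fderiv ℝ W (y, τ)‖ * 1 := by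
          gcongr
          exact ContinuousLinearMap.norm_inl_le_one ℝ E ℝ
      _ ≤ ε := by
          rw [mul_one]
          exact hb y hy hyr
  · rw [tendsto_zero_iff_norm_tendsto_zero]
    refine (h0 τ).comp ?_
    rw [nhdsOffAxis]
    refine tendsto_nhdsWithin_iff.2 ⟨?_, ?_⟩
    · exact ((Continuous.prodMk_left τ).tendsto (0 : E)).mono_left nhdsWithin_le_nhds
    · filter_upwards [self_mem_nhdsWithin] with y hy using hy

theorem norm_le_of_tendsto_fderiv_nhdsOffAxis {W : E × ℝ → G}
    (hd : ∀ z, z.1 ≠ 0 → DifferentiableAt ℝ W z)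
    (h0 : ∀ t, Filter.Tendsto (fun z => ‖W z‖) (nhdsOffAxis E t) (𝓝 0))
    (h1 : ∀ t, Filter.Tendsto (fun z => ‖fderiv ℝ W z‖) (nhdsOffAxis E t) (𝓝 0)) (t : ℝ)
    {ε : ℝ} (hε : 0 < ε) : ∀ᶠ z in nhdsOffAxis E t, ‖W z‖ ≤ ε * ‖z.1‖ := by
  have h2 := (h1 t).eventually (gt_mem_nhds hε)
  rw [eventually_nhdsOffAxis_iff] at h2 ⊢
  obtain ⟨r, hr, hb⟩ := h2
  exact ⟨r, hr, fun x τ hx hxr hτ => norm_le_of_norm_fderiv_le_offAxis hd h0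
    (fun y hy hyr => (hb y τ hy hyr hτ).le) hx hxr⟩

/-- Two integrations from the axis: D²W → 0 gives DW = o(|x|), and this gives W = o(|x|²), locally
uniformly in time. -/
theorem norm_le_sq_of_tendsto_fderiv_nhdsOffAxis {W : E × ℝ → G}
    (hc : ∀ z, z.1 ≠ 0 → ContDiffAt ℝ 2 W z)
    (h0 : ∀ t, Filter.Tendsto (fun z => ‖W z‖) (nhdsOffAxis E t) (𝓝 0))
    (h1 : ∀ t, Filter.Tendsto (fun z => ‖fderiv ℝ W z‖) (nhdsOffAxis E t) (𝓝 0))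
    (h2 : ∀ t, Filter.Tendsto (fun z => ‖fderiv ℝ (fderiv ℝ W) z‖) (nhdsOffAxis E t) (𝓝 0))
    (t : ℝ) {ε : ℝ} (hε : 0 < ε) : ∀ᶠ z in nhdsOffAxis E t, ‖W z‖ ≤ ε * ‖z.1‖ ^ 2 := by
  have h3 := norm_le_of_tendsto_fderiv_nhdsOffAxis (fun z hz => (hc z hz).differentiableAt_fderiv)
    h1 h2 t (half_pos hε)
  rw [eventually_nhdsOffAxis_iff] at h3 ⊢
  obtain ⟨r, hr, hb⟩ := h3
  refine ⟨r, hr, fun x τ hx hxr hτ => ?_⟩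
  have hpos : 0 < ‖x‖ := norm_pos_iff.2 hx
  -- On the ball of radius 2‖x‖ the bound ε/2 · ‖y‖ is at most the constant ε‖x‖, and `x` itself
  -- lies strictly inside.
  have := norm_le_of_norm_fderiv_le_offAxis (r := min r (2 * ‖x‖)) (ε := ε * ‖x‖) (τ := τ)
    (fun z hz => (hc z hz).differentiableAt (by simp)) h0 (fun y hy hyr => ?_) hx
    (lt_min hxr (by linarith))
  · calc _ ≤ ε * ‖x‖ * ‖x‖ := this
      _ = _ := by ring
  · rw [lt_min_iff] at hyr
    refine (hb y τ hy hyr.1 hτ).trans ?_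
    change ε / 2 * ‖y‖ ≤ _
    nlinarith

/-- W = o(|x|) uniformly in nearby times, and |x| is at most the distance from (x, τ) to the axis
point (0, t). -/
theorem hasFDerivAt_zero_of_tendsto_nhdsOffAxis {W : E × ℝ → G}
    (hd : ∀ z, z.1 ≠ 0 → DifferentiableAt ℝ W z) (hz : ∀ t, W (0, t) = 0)
    (h0 : ∀ t, Filter.Tendsto (fun z => ‖W z‖) (nhdsOffAxis E t) (𝓝 0))
    (h1 : ∀ t, Filter.Tendsto (fun z => ‖fderiv ℝ W z‖) (nhdsOffAxis E t) (𝓝 0)) (t : ℝ) :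
    HasFDerivAt W (0 : E × ℝ →L[ℝ] G) (0, t) := by
  refine .of_isLittleO (Asymptotics.isLittleO_iff.2 fun ε hε => ?_)
  have h := norm_le_of_tendsto_fderiv_nhdsOffAxis hd h0 h1 t hε
  rw [nhdsOffAxis, eventually_nhdsWithin_iff] at h
  filter_upwards [h] with z hz'
  rw [hz, sub_zero, zero_apply, sub_zero]
  rcases eq_or_ne z.1 0 with h0 | h0
  · have : z = (0, z.2) := Prod.ext h0 rfl
    rw [this, hz, norm_zero]
    positivity
  · refine (hz' h0).trans ?_
    gcongr
    calc ‖z.1‖ = ‖(z - (0, t)).1‖ := by simp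
      _ ≤ _ := norm_fst_le _

/-- A function vanishing on the time axis, `C²` off the axis and whose derivatives up to order two
tend to zero at the axis, is `C²`. -/
theorem contDiff_two_of_tendsto_nhdsOffAxis {W : E × ℝ → G}
    (hc : ∀ z, z.1 ≠ 0 → ContDiffAt ℝ 2 W z) (hz : ∀ t, W (0, t) = 0)
    (h0 : ∀ t, Filter.Tendsto (fun z => ‖W z‖) (nhdsOffAxis E t) (𝓝 0))
    (h1 : ∀ t, Filter.Tendsto (fun z => ‖fderiv ℝ W z‖) (nhdsOffAxis E t) (𝓝 0))
    (h2 : ∀ t, Filter.Tendsto (fun z => ‖fderiv ℝ (fderiv ℝ W) z‖) (nhdsOffAxis E t) (𝓝 0)) :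
    ContDiff ℝ 2 W := by
  have hd : ∀ z, z.1 ≠ 0 → DifferentiableAt ℝ W z := fun z h => (hc z h).differentiableAt (by simp)
  have hd' : ∀ z, z.1 ≠ 0 → DifferentiableAt ℝ (fderiv ℝ W) z := fun z h =>
    (hc z h).differentiableAt_fderiv
  have ha := hasFDerivAt_zero_of_tendsto_nhdsOffAxis hd hz h0 h1
  have ha' := hasFDerivAt_zero_of_tendsto_nhdsOffAxis hd' (fun t => (ha t).fderiv) h1 h2
  have all : ∀ {P : E × ℝ → Prop}, (∀ z, z.1 ≠ 0 → P z) → (∀ t, P (0, t)) → ∀ z, P z := by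
    intro P hP hP0 z
    rcases eq_or_ne z.1 0 with h | h
    · rw [show z = (0, z.2) from Prod.ext h rfl]
      exact hP0 _
    · exact hP z h
  rw [show (2 : WithTop ℕ∞) = 1 + 1 by norm_num, contDiff_succ_iff_fderiv]
  refine ⟨all hd fun t => (ha t).differentiableAt, by simp, ?_⟩
  rw [contDiff_one_iff_fderiv]
  refine ⟨all hd' fun t => (ha' t).differentiableAt, ?_⟩
  refine continuous_of_tendsto_nhdsOffAxis (fun z hz => ?_) (fun t => (ha' t).fderiv) h2
  have := ((hc z hz).fderiv_right (m := 1) (by norm_num)).fderiv_right (m := 0) (by norm_num)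
  exact this.continuousAt

/-- A `C²` profile that is flat at the axis times a field that is homogeneous of degree
zero (in the sense of its derivative bounds) is `C²`. -/
theorem contDiff_two_smul_of_tendsto_nhdsOffAxis {y : E × ℝ → ℝ} {n : E → G} {C : ℝ}
    (hC : 0 ≤ C) (hnc : ∀ x, x ≠ 0 → ContDiffAt ℝ 2 n x) (hn0 : n 0 = 0) (hn : ∀ x, ‖n x‖ ≤ 1)
    (hn1 : ∀ x, x ≠ 0 → ‖fderiv ℝ n x‖ ≤ C / ‖x‖)
    (hn2 : ∀ x, x ≠ 0 → ‖fderiv ℝ (fderiv ℝ n) x‖ ≤ C / ‖x‖ ^ 2)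
    (hc : ∀ z, z.1 ≠ 0 → ContDiffAt ℝ 2 y z)
    (h0 : ∀ t, Filter.Tendsto (fun z => ‖y z‖) (nhdsOffAxis E t) (𝓝 0))
    (h1 : ∀ t, Filter.Tendsto (fun z => ‖fderiv ℝ y z‖) (nhdsOffAxis E t) (𝓝 0))
    (h2 : ∀ t, Filter.Tendsto (fun z => ‖fderiv ℝ (fderiv ℝ y) z‖) (nhdsOffAxis E t) (𝓝 0)) :
    ContDiff ℝ 2 fun z : E × ℝ => y z • n z.1 := by
  have hd : ∀ z, z.1 ≠ 0 → DifferentiableAt ℝ y z := fun z h => (hc z h).differentiableAt (by simp)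
  have hd' : ∀ z, z.1 ≠ 0 → DifferentiableAt ℝ (fderiv ℝ y) z := fun z h =>
    (hc z h).differentiableAt_fderiv
  -- With `small0` this gives Dy = o(|x|) and y = o(|x|²), exactly what absorbs the factors C/|x|
  -- and C/|x|² in the Leibniz formula.
  have small1 := norm_le_of_tendsto_fderiv_nhdsOffAxis hd' h1 h2
  have hoff : ∀ t, ∀ᶠ z in nhdsOffAxis E t, z.1 ≠ 0 := fun t => self_mem_nhdsWithin
  have small0 := norm_le_sq_of_tendsto_fderiv_nhdsOffAxis hc h0 h1 h2
  have hU : ∀ z : E × ℝ, z.1 ≠ 0 → ContDiffAt ℝ 2 (fun z : E × ℝ => n z.1) z :=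
    fun z hz => (hnc _ hz).comp z contDiffAt_fst
  have hU1 : ∀ z : E × ℝ, z.1 ≠ 0 →
      ‖fderiv ℝ (fun z : E × ℝ => n z.1) z‖ ≤ C / ‖z.1‖ := by
    intro z hz
    refine (norm_fderiv_comp_le ((hnc _ hz).differentiableAt (by simp))
      differentiableAt_fst).trans ?_
    rw [fderiv_fst]
    calc _ ≤ C / ‖z.1‖ * 1 := by
          gcongr
          · exact hn1 _ hz
          · exact ContinuousLinearMap.norm_fst_le ℝ E ℝ
      _ = _ := mul_one _
  have hU2 : ∀ z : E × ℝ, z.1 ≠ 0 →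
      ‖fderiv ℝ (fderiv ℝ (fun z : E × ℝ => n z.1)) z‖ ≤ C / ‖z.1‖ ^ 2 := by
    intro z hz
    refine (norm_fderiv_fderiv_comp_le (hnc _ hz) contDiffAt_fst).trans ?_
    have e : fderiv ℝ (Prod.fst : E × ℝ → E) = fun _ => ContinuousLinearMap.fst ℝ E ℝ :=
      funext fun _ => fderiv_fst
    have e' : fderiv ℝ (fderiv ℝ (Prod.fst : E × ℝ → E)) z = 0 := by
      rw [e]; exact fderiv_const_apply _
    rw [e', norm_zero, mul_zero, add_zero, fderiv_fst]
    calc _ ≤ C / ‖z.1‖ ^ 2 * 1 ^ 2 := by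
          gcongr
          · exact hn2 _ hz
          · exact ContinuousLinearMap.norm_fst_le ℝ E ℝ
      _ = _ := by ring
  have squeeze : ∀ {g : E × ℝ → ℝ} (K : ℝ) (t : ℝ), 0 ≤ K → (∀ z, 0 ≤ g z) →
      (∀ ε, 0 < ε → ∀ᶠ z in nhdsOffAxis E t, g z ≤ ε * K) →
      Filter.Tendsto g (nhdsOffAxis E t) (𝓝 0) := by
    intro g K t hK hg h
    rw [Metric.tendsto_nhds]
    intro ε hε
    filter_upwards [h (ε / (K + 1)) (by positivity)] with z hz
    rw [Real.dist_0_eq_abs, abs_of_nonneg (hg z)]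
    refine hz.trans_lt ?_
    rw [div_mul_eq_mul_div, div_lt_iff₀ (by positivity)]
    nlinarith
  refine contDiff_two_of_tendsto_nhdsOffAxis (fun z hz => (hc z hz).smul (hU z hz))
    (fun t => by simp [hn0]) (fun t => ?_) (fun t => ?_) (fun t => ?_)
  · refine squeeze_zero (fun _ => norm_nonneg _) (fun z => ?_) (h0 t)
    rw [norm_smul]
    exact mul_le_of_le_one_right (norm_nonneg _) (hn _)
  · have hx : ∀ᶠ z in nhdsOffAxis E t, ‖z.1‖ ≤ 1 :=
      eventually_nhdsOffAxis_iff.2 ⟨1, one_pos, fun x _ _ hx _ => hx.le⟩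
    refine squeeze (C + 1) t (by positivity) (fun _ => norm_nonneg _) fun ε hε => ?_
    filter_upwards [hoff t, small0 t hε, small1 t hε, hx] with z hz k0 k1 hx
    have hpos : 0 < ‖z.1‖ := norm_pos_iff.2 hz
    calc _ ≤ ‖y z‖ * ‖fderiv ℝ (fun z : E × ℝ => n z.1) z‖ +
        ‖fderiv ℝ y z‖ * ‖n z.1‖ :=
          norm_fderiv_smul_le (hd z hz) ((hU z hz).differentiableAt (by simp))
      _ ≤ (ε * ‖z.1‖ ^ 2) * (C / ‖z.1‖) + (ε * ‖z.1‖) * 1 := by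
          gcongr
          · exact hU1 z hz
          · exact hn _
      _ = ε * (C + 1) * ‖z.1‖ := by field_simp
      _ ≤ ε * (C + 1) * 1 := by gcongr
      _ = _ := mul_one _
  · refine squeeze (3 * C + 1) t (by positivity) (fun _ => norm_nonneg _) fun ε hε => ?_
    filter_upwards [hoff t, small0 t hε, small1 t hε, (h2 t).eventually (gt_mem_nhds hε)]
      with z hz k0 k1 k2
    have hpos : 0 < ‖z.1‖ := norm_pos_iff.2 hz
    refine (norm_fderiv_fderiv_smul_le (hc z hz) (hU z hz)).trans ?_
    calc _ ≤ (ε * ‖z.1‖ ^ 2) * (C / ‖z.1‖ ^ 2) + 2 * ((ε * ‖z.1‖) * (C / ‖z.1‖)) + ε * 1 := by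
          gcongr
          · exact hU2 z hz
          · exact hU1 z hz
          · exact hn _
      _ = _ := by field_simp; ring

end Axis

/-! ### Derivative bounds for x/|x| -/

section UnitRadial

variable {E : Type*} [NormedAddCommGroup E] [InnerProductSpace ℝ E]

/-- The radial unit vector field `x / |x|` (zero at the origin). -/
noncomputable def unitRadial (x : E) : E := ‖x‖⁻¹ • x

theorem norm_unitRadial_le (x : E) : ‖unitRadial x‖ ≤ 1 := by
  rw [unitRadial, norm_smul, norm_inv, norm_norm]
  exact inv_mul_le_one

theorem norm_unitRadial {x : E} (hx : x ≠ 0) : ‖unitRadial x‖ = 1 := by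
  rw [unitRadial, norm_smul, norm_inv, norm_norm, inv_mul_cancel₀ (norm_ne_zero_iff.2 hx)]

theorem unitRadial_smul {c : ℝ} (hc : 0 < c) (x : E) : unitRadial (c • x) = unitRadial x := by
  rw [unitRadial, unitRadial, norm_smul, Real.norm_of_nonneg hc.le, smul_smul, mul_inv,
    mul_right_comm, inv_mul_cancel₀ hc.ne', one_mul]

theorem contDiffAt_unitRadial {x : E} (hx : x ≠ 0) : ContDiffAt ℝ 2 (unitRadial (E := E)) x :=
  ((contDiffAt_norm ℝ hx).inv (norm_ne_zero_iff.2 hx)).smul contDiffAt_id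

theorem fderiv_unitRadial_smul {c : ℝ} (hc : 0 < c) (x : E) :
    fderiv ℝ unitRadial x = c • fderiv ℝ unitRadial (c • x) := by
  rw [← fderiv_comp_smul (f := unitRadial)]
  simp_rw [unitRadial_smul hc]

theorem fderiv_fderiv_unitRadial_smul {c : ℝ} (hc : 0 < c) (x : E) :
    fderiv ℝ (fderiv ℝ unitRadial) x = c ^ 2 • fderiv ℝ (fderiv ℝ unitRadial) (c • x) := by
  have h : fderiv ℝ (unitRadial (E := E)) = fun x => c • fderiv ℝ unitRadial (c • x) :=
    funext fun x => fderiv_unitRadial_smul hc x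
  conv_lhs => rw [h]
  have : (fun x : E => c • fderiv ℝ unitRadial (c • x)) =
    c • fun x : E => fderiv ℝ unitRadial (c • x) := rfl
  rw [this, fderiv_const_smul_field, Pi.smul_apply, fderiv_comp_smul, smul_smul, sq]

/-- The field is homogeneous of degree 0, so its derivatives scale like |x|⁻¹ and |x|⁻²; the
constants are their maxima on the compact unit sphere. -/
theorem exists_norm_fderiv_unitRadial_le [FiniteDimensional ℝ E] : ∃ C : ℝ, 0 ≤ C ∧ ∀ x : E, x ≠ 0 →
    ‖fderiv ℝ unitRadial x‖ ≤ C / ‖x‖ ∧ ‖fderiv ℝ (fderiv ℝ unitRadial) x‖ ≤ C / ‖x‖ ^ 2 := by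
  have hne : ∀ x ∈ Metric.sphere (0 : E) 1, x ≠ 0 := by
    rintro x hx rfl
    simp at hx
  have c1 : ContinuousOn (fderiv ℝ (unitRadial (E := E))) (Metric.sphere 0 1) := fun x hx =>
    ((contDiffAt_unitRadial (hne x hx)).fderiv_right (m := 1)
      (by norm_num)).continuousAt.continuousWithinAt
  have c2 : ContinuousOn (fderiv ℝ (fderiv ℝ (unitRadial (E := E)))) (Metric.sphere 0 1) :=
    fun x hx => (((contDiffAt_unitRadial (hne x hx)).fderiv_right (m := 1)
      (by norm_num)).fderiv_right (m := 0) (by norm_num)).continuousAt.continuousWithinAt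
  obtain ⟨C1, h1⟩ := (isCompact_sphere (0 : E) 1).exists_bound_of_continuousOn c1
  obtain ⟨C2, h2⟩ := (isCompact_sphere (0 : E) 1).exists_bound_of_continuousOn c2
  refine ⟨max 0 (max C1 C2), le_max_left _ _, fun x hx => ?_⟩
  have hpos : 0 < ‖x‖ := norm_pos_iff.2 hx
  have hs : ‖x‖⁻¹ • x ∈ Metric.sphere (0 : E) 1 := by
    rw [mem_sphere_zero_iff_norm]
    exact norm_unitRadial hx
  constructor
  · rw [fderiv_unitRadial_smul (inv_pos.2 hpos) x, norm_smul, norm_inv, norm_norm, div_eq_inv_mul]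
    gcongr
    exact (h1 _ hs).trans ((le_max_left _ _).trans (le_max_right _ _))
  · rw [fderiv_fderiv_unitRadial_smul (inv_pos.2 hpos) x, norm_smul, norm_pow, norm_inv, norm_norm,
      div_eq_inv_mul, inv_pow]
    gcongr
    exact (h2 _ hs).trans ((le_max_right _ _).trans (le_max_right _ _))

end UnitRadial

/-! ### The energy coordinate and the functions of u = |z|^α -/

section Profile

/-- The Euclidean-type coordinate `w` with `w² / 2 = z² / 2 + |z|^(α+2) / (α+2)`. -/
noncomputable def energyCoord (α z : ℝ) : ℝ := z * √(1 + 2 / (α + 2) * |z| ^ α)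

/-- The factor `dz/dw` as a function of `u = |z|^α`. -/
noncomputable def tslope (α u : ℝ) : ℝ := √(1 + 2 / (α + 2) * u) / (1 + u)

/-- The vector field `w du/dw` as a function of `u = |z|^α`. -/
noncomputable def eulerField (α u : ℝ) : ℝ := α * u * (1 + 2 / (α + 2) * u) / (1 + u)

/-- Logarithmic derivative of `tslope` along `eulerField`. -/
noncomputable def slopeRate (α u : ℝ) : ℝ :=
  -(α / 2 * ((2 - 2 / (α + 2)) * u + 2 / (α + 2) * u ^ 2) / (1 + u) ^ 2)

/-- The derivative of `slopeRate`. -/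
noncomputable def slopeRateDeriv (α u : ℝ) : ℝ :=
  -(α / 2 * ((2 - 2 / (α + 2)) + (3 * (2 / (α + 2)) - 2) * u) / (1 + u) ^ 3)

/-- First derivative of `tslope` along `eulerField`. -/
noncomputable def slopeFst (α u : ℝ) : ℝ := tslope α u * slopeRate α u

/-- Second derivative of `tslope` along `eulerField`. -/
noncomputable def slopeSnd (α u : ℝ) : ℝ :=
  tslope α u * (slopeRate α u ^ 2 + slopeRateDeriv α u * eulerField α u)

variable {α : ℝ}

theorem hasDerivAt_tslope (hα : 0 < α) {u : ℝ} (hu : 0 ≤ u) :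
    HasDerivAt (tslope α)
      (tslope α u * (2 / (α + 2) / (2 * (1 + 2 / (α + 2) * u)) - 1 / (1 + u))) u := by
  have h1 : 0 < 1 + 2 / (α + 2) * u := by positivity
  have h2 : HasDerivAt (fun u => 1 + 2 / (α + 2) * u) (2 / (α + 2)) u := by
    simpa using ((hasDerivAt_id u).const_mul (2 / (α + 2))).const_add 1
  have h3 : HasDerivAt (fun u : ℝ => 1 + u) 1 u := by simpa using (hasDerivAt_id u).const_add 1
  have h4 := (h2.sqrt h1.ne').div h3 (by positivity)
  refine h4.congr_deriv ?_
  rw [tslope]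
  have hs : √(1 + 2 / (α + 2) * u) ^ 2 = 1 + 2 / (α + 2) * u := Real.sq_sqrt h1.le
  have hsp : 0 < √(1 + 2 / (α + 2) * u) := Real.sqrt_pos.2 h1
  set S := √(1 + 2 / (α + 2) * u)
  rw [← hs]
  have : (1 + u) ≠ 0 := by positivity
  field_simp

theorem tslope_deriv_mul_eulerField (hα : 0 < α) {u : ℝ} (hu : 0 ≤ u) :
    tslope α u * (2 / (α + 2) / (2 * (1 + 2 / (α + 2) * u)) - 1 / (1 + u)) * eulerField α u =
      slopeFst α u := by
  rw [slopeFst, mul_assoc, slopeRate, eulerField]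
  congr 1
  have h1 : (1 + 2 / (α + 2) * u) ≠ 0 := by positivity
  have : (1 + u) ≠ 0 := by positivity
  generalize 2 / (α + 2) = b at *
  field_simp
  ring

theorem hasDerivAt_slopeRate {u : ℝ} (hu : 0 ≤ u) :
    HasDerivAt (slopeRate α) (slopeRateDeriv α u) u := by
  have h3 : HasDerivAt (fun u : ℝ => (1 + u) ^ 2) (2 * (1 + u)) u := by
    simpa using ((hasDerivAt_id u).const_add 1).fun_pow 2
  have h2 : ∀ b : ℝ, HasDerivAt (fun u => (2 - b) * u + b * u ^ 2) ((2 - b) + b * (2 * u)) u := by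
    intro b
    simpa using ((hasDerivAt_id u).const_mul (2 - b)).fun_add (((hasDerivAt_id u).pow 2).const_mul b)
  have h4 := (((h2 (2 / (α + 2))).const_mul (α / 2)).div h3 (by positivity)).neg
  refine h4.congr_deriv ?_
  rw [slopeRateDeriv]
  have : (1 + u) ≠ 0 := by positivity
  generalize 2 / (α + 2) = b
  field_simp
  ring

theorem hasDerivAt_slopeFst (hα : 0 < α) {u : ℝ} (hu : 0 ≤ u) :
    HasDerivAt (slopeFst α)
      (tslope α u * (2 / (α + 2) / (2 * (1 + 2 / (α + 2) * u)) - 1 / (1 + u)) * slopeRate α u +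
        tslope α u * slopeRateDeriv α u) u :=
  (hasDerivAt_tslope hα hu).mul (hasDerivAt_slopeRate hu)

theorem slopeFst_deriv_mul_eulerField (hα : 0 < α) {u : ℝ} (hu : 0 ≤ u) :
    (tslope α u * (2 / (α + 2) / (2 * (1 + 2 / (α + 2) * u)) - 1 / (1 + u)) * slopeRate α u +
        tslope α u * slopeRateDeriv α u) * eulerField α u = slopeSnd α u := by
  have := tslope_deriv_mul_eulerField hα hu
  rw [slopeFst] at this
  rw [slopeSnd]
  linear_combination slopeRate α u * this

theorem continuousOn_tslope (hα : 0 < α) : ContinuousOn (tslope α) (Set.Ici 0) := fun _ hu =>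
  (hasDerivAt_tslope hα hu).continuousAt.continuousWithinAt

theorem continuousOn_slopeFst (hα : 0 < α) : ContinuousOn (slopeFst α) (Set.Ici 0) := fun _ hu =>
  (hasDerivAt_slopeFst hα hu).continuousAt.continuousWithinAt

theorem continuousOn_slopeSnd (hα : 0 < α) : ContinuousOn (slopeSnd α) (Set.Ici 0) := by
  have h : ∀ u ∈ Set.Ici (0 : ℝ), (1 + u) ≠ 0 := fun u hu => by
    have : (0 : ℝ) ≤ u := hu
    positivity
  have h1 : ContinuousOn (eulerField α) (Set.Ici 0) := by
    unfold eulerField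
    exact ContinuousOn.div (by fun_prop) (by fun_prop) h
  have h2 : ContinuousOn (slopeRateDeriv α) (Set.Ici 0) := by
    unfold slopeRateDeriv
    exact (ContinuousOn.div (by fun_prop) (by fun_prop) fun u hu => pow_ne_zero _ (h u hu)).neg
  have h3 : ContinuousOn (slopeRate α) (Set.Ici 0) := fun _ hu =>
    (hasDerivAt_slopeRate hu).continuousAt.continuousWithinAt
  exact (continuousOn_tslope hα).mul ((h3.pow 2).add (h2.mul h1))

theorem tslope_pos (hα : 0 < α) {u : ℝ} (hu : 0 ≤ u) : 0 < tslope α u := by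
  unfold tslope; positivity

theorem tslope_zero : tslope α 0 = 1 := by simp [tslope]

/-- Uses 2/(α+2) ≤ 1. It yields both dz/dw ≤ 1 and the decay of dz/dw for large u, hence of the
period for large amplitude. -/
theorem tslope_sq_le (hα : 0 < α) {u : ℝ} (hu : 0 ≤ u) : tslope α u ^ 2 ≤ 1 / (1 + u) := by
  have hb : 2 / (α + 2) ≤ 1 := by rw [div_le_one (by positivity)]; linarith
  rw [tslope, div_pow, Real.sq_sqrt (by positivity), div_le_div_iff₀ (by positivity) (by positivity)]
  nlinarith [mul_le_mul_of_nonneg_right hb hu]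

theorem tslope_le_one (hα : 0 < α) {u : ℝ} (hu : 0 ≤ u) : tslope α u ≤ 1 := by
  have h := tslope_sq_le hα hu
  have : 1 / (1 + u) ≤ 1 := by rw [div_le_one (by positivity)]; linarith
  nlinarith [tslope_pos hα hu]

theorem half_le_tslope (hα : 0 < α) {u : ℝ} (hu : 0 ≤ u) (hu1 : u ≤ 1) : 1 / 2 ≤ tslope α u := by
  rw [tslope, div_le_div_iff₀ (by positivity) (by positivity)]
  have : 1 ≤ √(1 + 2 / (α + 2) * u) := Real.one_le_sqrt.2 (by simp; positivity)
  linarith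

/-- From √(1+2a) ≤ 1+a and 1+u ≤ 2. The constant is not sharp; only its positivity matters for
comparing the period defect with ∫u. -/
theorem mul_le_one_sub_tslope (hα : 0 < α) {u : ℝ} (hu : 0 ≤ u) (hu1 : u ≤ 1) :
    α / (8 * (α + 2)) * u ≤ 1 - tslope α u := by
  have h1 : √(1 + 2 / (α + 2) * u) ≤ 1 + 1 / (α + 2) * u := by
    rw [Real.sqrt_le_left (by positivity)]
    have : (1 + 1 / (α + 2) * u) ^ 2 = 1 + 2 / (α + 2) * u + (1 / (α + 2) * u) ^ 2 := by ring
    rw [this]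
    nlinarith [sq_nonneg (1 / (α + 2) * u)]
  have h2 : tslope α u ≤ (1 + 1 / (α + 2) * u) / (1 + u) := by
    unfold tslope; gcongr
  have h3 : 1 - (1 + 1 / (α + 2) * u) / (1 + u) = (α + 1) / (α + 2) * u / (1 + u) := by
    field_simp; ring
  have h4 : α / (8 * (α + 2)) * u ≤ (α + 1) / (α + 2) * u / (1 + u) := by
    rw [le_div_iff₀ (by positivity)]
    have : α / (8 * (α + 2)) = α / (α + 2) / 8 := by field_simp
    have h5 : α / (α + 2) ≤ (α + 1) / (α + 2) := by gcongr; linarith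
    rw [this]
    have h6 : 0 ≤ α / (α + 2) := by positivity
    nlinarith [mul_nonneg h6 hu, mul_le_mul_of_nonneg_right h5 hu,
      mul_le_mul_of_nonneg_left hu1 (mul_nonneg h6 hu)]
  linarith

theorem one_sub_tslope_pos (hα : 0 < α) {u : ℝ} (hu : 0 < u) : 0 < 1 - tslope α u := by
  have h := tslope_sq_le hα hu.le
  have : 1 / (1 + u) < 1 := by rw [div_lt_one (by positivity)]; linarith
  nlinarith [tslope_pos hα hu.le]

theorem one_sub_tslope_le (hα : 0 < α) {u : ℝ} (hu : 0 ≤ u) : 1 - tslope α u ≤ u := by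
  have h1 : 1 / (1 + u) ≤ tslope α u := by
    unfold tslope; gcongr
    exact Real.one_le_sqrt.2 (by simp; positivity)
  have h2 : 1 - u ≤ 1 / (1 + u) := by
    rw [le_div_iff₀ (by positivity)]
    nlinarith [sq_nonneg u]
  linarith

theorem slopeFst_neg (hα : 0 < α) {u : ℝ} (hu : 0 < u) : slopeFst α u < 0 := by
  have hb : 2 / (α + 2) < 2 := by rw [div_lt_iff₀ (by positivity)]; linarith
  have : 0 < 2 - 2 / (α + 2) := by linarith
  have h1 := tslope_pos hα hu.le
  have h2 : slopeRate α u < 0 := by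
    unfold slopeRate
    have : 0 < α / 2 * ((2 - 2 / (α + 2)) * u + 2 / (α + 2) * u ^ 2) / (1 + u) ^ 2 := by positivity
    linarith
  rw [slopeFst]
  nlinarith

/-- For u ≤ 1 one has `tslope` ≥ 1/2 and (1+u)² ≤ 4, so α/2 is divided by 8. -/
theorem mul_le_neg_slopeFst (hα : 0 < α) {u : ℝ} (hu : 0 ≤ u) (hu1 : u ≤ 1) :
    α / 16 * u ≤ -slopeFst α u := by
  have hb : 2 / (α + 2) ≤ 1 := by rw [div_le_iff₀ (by positivity)]; linarith
  have hb0 : 0 < 2 / (α + 2) := by positivity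
  have h1 := half_le_tslope hα hu hu1
  have h2 : α / 8 * u ≤ -slopeRate α u := by
    rw [slopeRate, neg_neg, le_div_iff₀ (by positivity)]
    generalize 2 / (α + 2) = b at *
    have h3 : α / 8 * u * (1 + u) ^ 2 ≤ α / 8 * u * 4 := by gcongr; nlinarith
    have h4 : α / 2 * u ≤ α / 2 * ((2 - b) * u + b * u ^ 2) := by
      gcongr; nlinarith [mul_nonneg hb0.le (sq_nonneg u)]
    nlinarith
  rw [slopeFst]
  have : 0 ≤ α / 8 * u := by positivity
  nlinarith

/-- Both functions contain an explicit factor u, and the cofactor is continuous, hence bounded on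
[0, 1]. -/
theorem exists_abs_tslope_le (hα : 0 < α) : ∃ C : ℝ, 0 < C ∧ ∀ u, 0 ≤ u → u ≤ 1 →
    |slopeFst α u| ≤ C * u ∧ |slopeSnd α u| ≤ C * u := by
  have key : ∀ {g g' : ℝ → ℝ}, ContinuousOn g' (Set.Ici 0) → (∀ u, 0 ≤ u → g u = u * g' u) →
      ∃ C, ∀ u, 0 ≤ u → u ≤ 1 → |g u| ≤ C * u := by
    intro g g' hc hg
    obtain ⟨C, hC⟩ := (isCompact_Icc (a := (0 : ℝ)) (b := 1)).exists_bound_of_continuousOn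
      (hc.mono Set.Icc_subset_Ici_self)
    refine ⟨C, fun u h0 h1 => ?_⟩
    rw [hg u h0, abs_mul, abs_of_nonneg h0, mul_comm]
    gcongr
    exact hC u ⟨h0, h1⟩
  have h : ∀ u ∈ Set.Ici (0 : ℝ), (1 + u) ≠ 0 := fun u hu => by
    have : (0 : ℝ) ≤ u := hu
    positivity
  have hr : ContinuousOn (fun u => -(α / 2 * ((2 - 2 / (α + 2)) + 2 / (α + 2) * u) / (1 + u) ^ 2))
      (Set.Ici 0) :=
    (ContinuousOn.div (by fun_prop) (by fun_prop) fun u hu => pow_ne_zero _ (h u hu)).neg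
  have ha : ContinuousOn (fun u => α * (1 + 2 / (α + 2) * u) / (1 + u)) (Set.Ici 0) :=
    ContinuousOn.div (by fun_prop) (by fun_prop) h
  have h2 : ContinuousOn (slopeRateDeriv α) (Set.Ici 0) := by
    unfold slopeRateDeriv
    exact (ContinuousOn.div (by fun_prop) (by fun_prop) fun u hu => pow_ne_zero _ (h u hu)).neg
  have h3 : ContinuousOn (slopeRate α) (Set.Ici 0) := fun _ hu =>
    (hasDerivAt_slopeRate hu).continuousAt.continuousWithinAt
  obtain ⟨C1, h1⟩ := key (g := slopeFst α) ((continuousOn_tslope hα).mul hr) fun u hu => by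
    simp only [slopeFst, slopeRate, Pi.mul_apply]; ring
  obtain ⟨C2, h2⟩ := key (g := slopeSnd α)
    ((continuousOn_tslope hα).mul ((h3.mul hr).add (h2.mul ha))) fun u hu => by
      simp only [slopeSnd, eulerField, Pi.mul_apply, Pi.add_apply]
      rw [sq]
      nth_rewrite 2 [slopeRate]
      ring
  refine ⟨max 1 (max C1 C2), by positivity, fun u h0 h1' => ⟨?_, ?_⟩⟩
  · refine (h1 u h0 h1').trans ?_
    gcongr
    exact (le_max_left _ _).trans (le_max_right _ _)
  · refine (h2 u h0 h1').trans ?_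
    gcongr
    exact (le_max_right _ _).trans (le_max_right _ _)

theorem hasDerivAt_abs_rpow_of_ne_zero (α : ℝ) {z : ℝ} (hz : z ≠ 0) :
    HasDerivAt (fun z : ℝ => |z| ^ α) (α * |z| ^ α / z) z := by
  have h := (hasDerivAt_abs hz).rpow_const (p := α) (Or.inl (abs_ne_zero.2 hz))
  refine h.congr_deriv ?_
  rw [Real.rpow_sub_one (abs_ne_zero.2 hz)]
  rcases lt_or_gt_of_ne hz with h | h
  · simp [h, abs_of_neg h]; field_simp
  · simp [h, abs_of_pos h]; field_simp

theorem continuous_abs_rpow (hα : 0 < α) : Continuous fun z : ℝ => |z| ^ α :=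
  continuous_abs.rpow_const fun _ => Or.inr hα.le

/-- The point z = 0 is separate because |z|^α need not be differentiable there; the difference
quotient is the square root itself, which tends to 1. -/
theorem hasDerivAt_energyCoord (hα : 0 < α) (z : ℝ) :
    HasDerivAt (energyCoord α) (tslope α (|z| ^ α))⁻¹ z := by
  rcases eq_or_ne z 0 with rfl | hz
  · rw [abs_zero, Real.zero_rpow hα.ne', tslope_zero, inv_one, hasDerivAt_iff_tendsto_slope]
    have hc : Continuous fun z : ℝ => √(1 + 2 / (α + 2) * |z| ^ α) :=
      (continuous_const.add (continuous_const.mul (continuous_abs_rpow hα))).sqrt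
    have h1 := (hc.tendsto 0).mono_left (nhdsWithin_le_nhds (s := {0}ᶜ))
    simp only [abs_zero, Real.zero_rpow hα.ne', mul_zero, add_zero, Real.sqrt_one] at h1
    refine h1.congr' ?_
    filter_upwards [self_mem_nhdsWithin] with z hz
    have hz : z ≠ 0 := hz
    rw [slope_def_field]
    simp only [energyCoord, zero_mul, sub_zero]
    field_simp
  · have hu : 0 ≤ |z| ^ α := by positivity
    have h1 := ((hasDerivAt_abs_rpow_of_ne_zero α hz).const_mul (2 / (α + 2))).const_add 1
    have h2 := (hasDerivAt_id z).mul (h1.sqrt (by positivity))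
    refine h2.congr_deriv ?_
    simp only [id]
    generalize |z| ^ α = u at *
    rw [tslope, inv_div]
    have hp : 0 < 1 + 2 / (α + 2) * u := by positivity
    have hs : √(1 + 2 / (α + 2) * u) ^ 2 = 1 + 2 / (α + 2) * u := Real.sq_sqrt hp.le
    have hsp : 0 < √(1 + 2 / (α + 2) * u) := Real.sqrt_pos.2 hp
    set S := √(1 + 2 / (α + 2) * u)
    field_simp
    rw [hs]
    field_simp
    ring

theorem strictMono_energyCoord (hα : 0 < α) : StrictMono (energyCoord α) :=
  strictMono_of_deriv_pos fun z => by
    rw [(hasDerivAt_energyCoord hα z).deriv]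
    exact inv_pos.2 (tslope_pos hα (by positivity))

theorem abs_le_abs_energyCoord (hα : 0 < α) (z : ℝ) : |z| ≤ |energyCoord α z| := by
  rw [energyCoord, abs_mul, abs_of_nonneg (Real.sqrt_nonneg _)]
  refine le_mul_of_one_le_right (abs_nonneg _) (Real.one_le_sqrt.2 ?_)
  simp only [le_add_iff_nonneg_right]
  positivity

theorem surjective_energyCoord (hα : 0 < α) : Function.Surjective (energyCoord α) := by
  have h1 : ∀ z, 1 ≤ √(1 + 2 / (α + 2) * |z| ^ α) := fun z => Real.one_le_sqrt.2 (by
    simp only [le_add_iff_nonneg_right]; positivity)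
  refine Continuous.surjective ?_ ?_ ?_
  · exact continuous_iff_continuousAt.2 fun z => (hasDerivAt_energyCoord hα z).continuousAt
  · refine Filter.tendsto_atTop_mono' _ ?_ Filter.tendsto_id
    filter_upwards [Filter.eventually_ge_atTop 0] with z hz
    exact le_mul_of_one_le_right hz (h1 z)
  · refine Filter.tendsto_atBot_mono' _ ?_ Filter.tendsto_id
    filter_upwards [Filter.eventually_le_atBot 0] with z hz
    simp only [energyCoord, id]
    nlinarith [h1 z]

/-- The inverse of `energyCoord`. -/
noncomputable def energyInv (α : ℝ) : ℝ → ℝ := Function.invFun (energyCoord α)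

theorem energyCoord_energyInv (hα : 0 < α) (w : ℝ) : energyCoord α (energyInv α w) = w :=
  Function.rightInverse_invFun (surjective_energyCoord hα) w

theorem energyInv_energyCoord (hα : 0 < α) (z : ℝ) : energyInv α (energyCoord α z) = z :=
  Function.leftInverse_invFun (strictMono_energyCoord hα).injective z

theorem continuous_energyInv (hα : 0 < α) : Continuous (energyInv α) := by
  have h : energyInv α = ((strictMono_energyCoord hα).orderIsoOfSurjective _
      (surjective_energyCoord hα)).symm := by
    funext w
    rw [eq_comm, OrderIso.symm_apply_eq]
    exact (energyCoord_energyInv hα w).symm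
  rw [h]
  exact OrderIso.continuous _

theorem energyInv_zero (hα : 0 < α) : energyInv α 0 = 0 := by
  conv_lhs => rw [show (0 : ℝ) = energyCoord α 0 by simp [energyCoord]]
  exact energyInv_energyCoord hα 0

theorem abs_energyInv_le (hα : 0 < α) (w : ℝ) : |energyInv α w| ≤ |w| := by
  have := abs_le_abs_energyCoord hα (energyInv α w)
  rwa [energyCoord_energyInv hα] at this

/-- `u = |z|^α` as a function of `w`. -/
noncomputable def energyPow (α w : ℝ) : ℝ := |energyInv α w| ^ α

theorem energyPow_nonneg (w : ℝ) : 0 ≤ energyPow α w := by unfold energyPow; positivity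

theorem energyPow_zero (hα : 0 < α) : energyPow α 0 = 0 := by
  rw [energyPow, energyInv_zero hα, abs_zero, Real.zero_rpow hα.ne']

theorem energyInv_ne_zero (hα : 0 < α) {w : ℝ} (hw : w ≠ 0) : energyInv α w ≠ 0 := by
  intro h
  apply hw
  rw [← energyCoord_energyInv hα w, h, energyCoord, zero_mul]

theorem energyPow_pos (hα : 0 < α) {w : ℝ} (hw : w ≠ 0) : 0 < energyPow α w :=
  Real.rpow_pos_of_pos (abs_pos.2 (energyInv_ne_zero hα hw)) _

theorem continuous_energyPow (hα : 0 < α) : Continuous (energyPow α) :=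
  (continuous_abs_rpow hα).comp (continuous_energyInv hα)

theorem energyPow_le (hα : 0 < α) (w : ℝ) : energyPow α w ≤ |w| ^ α :=
  Real.rpow_le_rpow (abs_nonneg _) (abs_energyInv_le hα w) hα.le

/-- For |w| ≤ 1 also u ≤ 1, so the square root in w = z√(1 + 2u/(α+2)) is at most 2 and |w| ≤ 2|z|.
-/
theorem rpow_abs_le_energyPow (hα : 0 < α) {w : ℝ} (hw : |w| ≤ 1) :
    |w| ^ α ≤ 2 ^ α * energyPow α w := by
  have hb : 2 / (α + 2) ≤ 1 := by rw [div_le_iff₀ (by positivity)]; linarith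
  have h1 : energyPow α w ≤ 1 := (energyPow_le hα w).trans
    (Real.rpow_le_one (abs_nonneg _) hw hα.le)
  rw [energyPow, ← Real.mul_rpow (by positivity) (abs_nonneg _)]
  refine Real.rpow_le_rpow (abs_nonneg _) ?_ hα.le
  conv_lhs => rw [← energyCoord_energyInv hα w]
  rw [energyCoord, abs_mul, abs_of_nonneg (Real.sqrt_nonneg _), mul_comm]
  gcongr
  rw [Real.sqrt_le_left (by positivity)]
  change 1 + 2 / (α + 2) * energyPow α w ≤ _
  nlinarith [energyPow_nonneg (α := α) w]

theorem hasDerivAt_energyInv (hα : 0 < α) (w : ℝ) :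
    HasDerivAt (energyInv α) (tslope α (energyPow α w)) w := by
  have h := HasDerivAt.of_local_left_inverse (continuous_energyInv hα).continuousAt
    (hasDerivAt_energyCoord hα (energyInv α w))
    (inv_ne_zero (tslope_pos hα (energyPow_nonneg w)).ne')
    (Filter.Eventually.of_forall (energyCoord_energyInv hα))
  rwa [inv_inv] at h

theorem eq_energyInv_mul (hα : 0 < α) (w : ℝ) :
    w = energyInv α w * √(1 + 2 / (α + 2) * energyPow α w) :=
  (energyCoord_energyInv hα w).symm

/-- From du/dw = (αu/z)(dz/dw), with z eliminated through w = z√(1 + 2u/(α+2)). -/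
theorem hasDerivAt_energyPow (hα : 0 < α) {w : ℝ} (hw : w ≠ 0) :
    HasDerivAt (energyPow α) (eulerField α (energyPow α w) / w) w := by
  have h := (hasDerivAt_abs_rpow_of_ne_zero α (energyInv_ne_zero hα hw)).comp w
    (hasDerivAt_energyInv hα w)
  refine h.congr_deriv ?_
  have hz := energyInv_ne_zero hα hw
  have hu := energyPow_nonneg (α := α) w
  have e := eq_energyInv_mul hα w
  have hs : √(1 + 2 / (α + 2) * energyPow α w) ^ 2 = 1 + 2 / (α + 2) * energyPow α w :=
    Real.sq_sqrt (by positivity)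
  change α * energyPow α w / _ * _ = _
  rw [tslope, eulerField, div_mul_div_comm, div_div,
    div_eq_div_iff (by positivity) (by positivity)]
  linear_combination α * energyPow α w * (1 + energyPow α w) *
    (√(1 + 2 / (α + 2) * energyPow α w) * e + energyInv α w * hs)

/-- `w / (dz/dw) = z + |z|^α z`. -/
theorem div_tslope_energyPow (hα : 0 < α) (w : ℝ) :
    w / tslope α (energyPow α w) = energyInv α w * (1 + energyPow α w) := by
  have hu := energyPow_nonneg (α := α) w
  have hp : 0 < √(1 + 2 / (α + 2) * energyPow α w) := by positivity
  rw [div_eq_iff (tslope_pos hα hu).ne', tslope]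
  conv_lhs => rw [eq_energyInv_mul hα w]
  field_simp

end Profile

/-! ### Integrals along orbits and their dependence on the energy -/

section PhaseIntegral

theorem hasStrictFDerivAt_of_partials {f fx fy : ℝ → ℝ → ℝ}
    (hx : ∀ a b, HasDerivAt (fun a => f a b) (fx a b) a)
    (hy : ∀ a b, HasDerivAt (fun b => f a b) (fy a b) b)
    (cx : Continuous fun z : ℝ × ℝ => fx z.1 z.2) (cy : Continuous fun z : ℝ × ℝ => fy z.1 z.2)
    (z : ℝ × ℝ) : HasStrictFDerivAt (fun z : ℝ × ℝ => f z.1 z.2)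
      (fx z.1 z.2 • ContinuousLinearMap.fst ℝ ℝ ℝ + fy z.1 z.2 • ContinuousLinearMap.snd ℝ ℝ ℝ)
      z := by
  have h := hasStrictFDerivAt_uncurry_coprod (𝕜 := ℝ) (u := z) (f := f)
    (f₁ := fun a b => ContinuousLinearMap.toSpanSingleton ℝ (fx a b))
    (f₂ := fun a b => ContinuousLinearMap.toSpanSingleton ℝ (fy a b))
    (Filter.Eventually.of_forall fun v => (hx v.1 v.2).hasFDerivAt)
    (Filter.Eventually.of_forall fun v => (hy v.1 v.2).hasFDerivAt)
    ((ContinuousLinearMap.toSpanSingletonCLE (𝕜 := ℝ) (E := ℝ)).continuous.comp cx).continuousAt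
    ((ContinuousLinearMap.toSpanSingletonCLE (𝕜 := ℝ) (E := ℝ)).continuous.comp cy).continuousAt
  refine h.congr_fderiv ?_
  ext <;> simp [Function.HasUncurry.uncurry]

variable {α : ℝ}

/-- The quantity `|z|^α` along the orbit of energy `e^(2ρ)/2`, at the angle `θ`. -/
noncomputable def phaseVar (α θ ρ : ℝ) : ℝ := energyPow α (Real.exp ρ * Real.sin θ)

theorem phaseVar_nonneg (θ ρ : ℝ) : 0 ≤ phaseVar α θ ρ := energyPow_nonneg _

theorem continuous_phaseVar (hα : 0 < α) : Continuous fun z : ℝ × ℝ => phaseVar α z.1 z.2 :=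
  (continuous_energyPow hα).comp (by fun_prop)

theorem abs_exp_mul_sin_le (ρ θ : ℝ) : |Real.exp ρ * Real.sin θ| ≤ Real.exp ρ := by
  rw [abs_mul, Real.abs_exp]
  exact mul_le_of_le_one_right (Real.exp_pos _).le (Real.abs_sin_le_one _)

theorem phaseVar_le (hα : 0 < α) (θ ρ : ℝ) : phaseVar α θ ρ ≤ Real.exp ρ ^ α :=
  (energyPow_le hα _).trans
    (Real.rpow_le_rpow (abs_nonneg _) (abs_exp_mul_sin_le ρ θ) hα.le)

theorem phaseVar_le_one (hα : 0 < α) (θ : ℝ) {ρ : ℝ} (hρ : ρ ≤ 0) : phaseVar α θ ρ ≤ 1 :=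
  (phaseVar_le hα θ ρ).trans
    (Real.rpow_le_one (Real.exp_pos _).le (Real.exp_le_one_iff.2 hρ) hα.le)

theorem energyInv_neg (hα : 0 < α) (w : ℝ) : energyInv α (-w) = -energyInv α w := by
  apply (strictMono_energyCoord hα).injective
  rw [energyCoord_energyInv hα, energyCoord, abs_neg, neg_mul]
  congr 1
  exact (energyCoord_energyInv hα w).symm

theorem energyPow_neg (hα : 0 < α) (w : ℝ) : energyPow α (-w) = energyPow α w := by
  rw [energyPow, energyInv_neg hα, abs_neg, energyPow]

theorem phaseVar_add_pi (hα : 0 < α) (θ ρ : ℝ) : phaseVar α (θ + Real.pi) ρ = phaseVar α θ ρ := by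
  rw [phaseVar, Real.sin_add_pi, mul_neg, energyPow_neg hα, phaseVar]

theorem phaseVar_pos (hα : 0 < α) {θ : ℝ} (h0 : 0 < θ) (hπ : θ < Real.pi) (ρ : ℝ) :
    0 < phaseVar α θ ρ :=
  energyPow_pos hα (mul_pos (Real.exp_pos _) (Real.sin_pos_of_pos_of_lt_pi h0 hπ)).ne'

/-- Since w = e^ρ sin θ, the ρ-derivative is w d/dw. Where sin θ = 0 the variable is identically 0,
a zero of `eulerField`, so the possible singularity of |z|^α at z = 0 never enters. -/
theorem hasDerivAt_phaseVar (hα : 0 < α) (θ ρ : ℝ) :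
    HasDerivAt (fun ρ => phaseVar α θ ρ) (eulerField α (phaseVar α θ ρ)) ρ := by
  by_cases hs : Real.sin θ = 0
  · have : (fun ρ => phaseVar α θ ρ) = fun _ => 0 := by
      funext ρ
      rw [phaseVar, hs, mul_zero, energyPow_zero hα]
    rw [this]
    refine (hasDerivAt_const ρ (0 : ℝ)).congr_deriv ?_
    rw [congrFun this ρ, eulerField]
    simp
  · have hw : Real.exp ρ * Real.sin θ ≠ 0 := mul_ne_zero (Real.exp_ne_zero _) hs
    have h := (hasDerivAt_energyPow hα hw).comp ρ ((Real.hasDerivAt_exp ρ).mul_const (Real.sin θ))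
    refine h.congr_deriv ?_
    rw [div_mul_cancel₀ _ hw]
    rfl

/-- `G` is the derivative of `F` along the vector field `eulerField`. -/
def IsEulerDeriv (α : ℝ) (F G : ℝ → ℝ) : Prop :=
  ∀ u, 0 ≤ u → ∃ d, HasDerivAt F d u ∧ d * eulerField α u = G u

theorem isEulerDeriv_tslope (hα : 0 < α) : IsEulerDeriv α (tslope α) (slopeFst α) := fun _ hu =>
  ⟨_, hasDerivAt_tslope hα hu, tslope_deriv_mul_eulerField hα hu⟩

theorem isEulerDeriv_slopeFst (hα : 0 < α) : IsEulerDeriv α (slopeFst α) (slopeSnd α) :=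
  fun _ hu => ⟨_, hasDerivAt_slopeFst hα hu, slopeFst_deriv_mul_eulerField hα hu⟩

theorem IsEulerDeriv.hasDerivAt (hα : 0 < α) {F G : ℝ → ℝ} (h : IsEulerDeriv α F G) (θ ρ : ℝ) :
    HasDerivAt (fun ρ => F (phaseVar α θ ρ)) (G (phaseVar α θ ρ)) ρ := by
  obtain ⟨d, hd, he⟩ := h (phaseVar α θ ρ) (phaseVar_nonneg θ ρ)
  rw [← he]
  exact hd.comp ρ (hasDerivAt_phaseVar hα θ ρ)

theorem IsEulerDeriv.continuousOn {F G : ℝ → ℝ} (h : IsEulerDeriv α F G) :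
    ContinuousOn F (Set.Ici 0) := fun u hu => by
  obtain ⟨d, hd, _⟩ := h u hu
  exact hd.continuousAt.continuousWithinAt

theorem continuous_comp_phaseVar (hα : 0 < α) {F : ℝ → ℝ} (hF : ContinuousOn F (Set.Ici 0)) :
    Continuous fun z : ℝ × ℝ => F (phaseVar α z.1 z.2) :=
  hF.comp_continuous (continuous_phaseVar hα) fun z => phaseVar_nonneg z.1 z.2

/-- The integral of `F` along an orbit, from the angle `0` to the angle `φ`. -/
noncomputable def phaseInt (α : ℝ) (F : ℝ → ℝ) (φ ρ : ℝ) : ℝ :=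
  ∫ θ in (0 : ℝ)..φ, F (phaseVar α θ ρ)

theorem continuous_comp_phaseVar_left (hα : 0 < α) {F : ℝ → ℝ} (hF : ContinuousOn F (Set.Ici 0))
    (ρ : ℝ) : Continuous fun θ => F (phaseVar α θ ρ) :=
  (continuous_comp_phaseVar hα hF).comp (Continuous.prodMk_left ρ)

theorem continuous_phaseInt (hα : 0 < α) {F : ℝ → ℝ} (hF : ContinuousOn F (Set.Ici 0)) :
    Continuous fun z : ℝ × ℝ => phaseInt α F z.1 z.2 := by
  refine intervalIntegral.continuous_parametric_intervalIntegral_of_continuous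
    (f := fun (z : ℝ × ℝ) θ => F (phaseVar α θ z.2)) ?_ continuous_fst
  exact (continuous_comp_phaseVar hα hF).comp
    (continuous_snd.prodMk (continuous_snd.comp continuous_fst))

theorem hasDerivAt_phaseInt_left (hα : 0 < α) {F : ℝ → ℝ} (hF : ContinuousOn F (Set.Ici 0))
    (φ ρ : ℝ) : HasDerivAt (fun φ => phaseInt α F φ ρ) (F (phaseVar α φ ρ)) φ := by
  have hc := continuous_comp_phaseVar_left hα hF ρ
  exact intervalIntegral.integral_hasDerivAt_right (hc.intervalIntegrable _ _)
    hc.aestronglyMeasurable.stronglyMeasurableAtFilter hc.continuousAt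

/-- Differentiation under the integral; the domination is the maximum of |G| over a compact
rectangle of angles and ρ-values. -/
theorem hasDerivAt_phaseInt_right (hα : 0 < α) {F G : ℝ → ℝ} (h : IsEulerDeriv α F G)
    (hG : ContinuousOn G (Set.Ici 0)) (φ ρ : ℝ) :
    HasDerivAt (fun ρ => phaseInt α F φ ρ) (phaseInt α G φ ρ) ρ := by
  have hcF := continuous_comp_phaseVar_left hα h.continuousOn
  have hcG := continuous_comp_phaseVar_left hα hG
  obtain ⟨C, hC⟩ := ((isCompact_uIcc (a := (0 : ℝ)) (b := φ)).prod
    (isCompact_closedBall ρ 1)).exists_bound_of_continuousOn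
      (continuous_comp_phaseVar hα hG).continuousOn
  refine (intervalIntegral.hasDerivAt_integral_of_dominated_loc_of_deriv_le
    (F := fun ρ θ => F (phaseVar α θ ρ)) (F' := fun ρ θ => G (phaseVar α θ ρ))
    (bound := fun _ => C) (Metric.closedBall_mem_nhds ρ one_pos)
    (Filter.Eventually.of_forall fun ρ => (hcF ρ).aestronglyMeasurable)
    ((hcF ρ).intervalIntegrable _ _) (hcG ρ).aestronglyMeasurable
    (Filter.Eventually.of_forall fun θ hθ ρ' hρ' => hC (θ, ρ') ⟨Set.uIoc_subset_uIcc hθ, hρ'⟩)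
    intervalIntegrable_const
    (Filter.Eventually.of_forall fun θ _ ρ' _ => h.hasDerivAt hα θ ρ')).2

theorem hasStrictFDerivAt_phaseInt (hα : 0 < α) {F G : ℝ → ℝ} (h : IsEulerDeriv α F G)
    (hG : ContinuousOn G (Set.Ici 0)) (z : ℝ × ℝ) :
    HasStrictFDerivAt (fun z : ℝ × ℝ => phaseInt α F z.1 z.2)
      (F (phaseVar α z.1 z.2) • ContinuousLinearMap.fst ℝ ℝ ℝ +
        phaseInt α G z.1 z.2 • ContinuousLinearMap.snd ℝ ℝ ℝ) z :=
  hasStrictFDerivAt_of_partials (f := phaseInt α F) (fx := fun φ ρ => F (phaseVar α φ ρ))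
    (hasDerivAt_phaseInt_left hα h.continuousOn) (hasDerivAt_phaseInt_right hα h hG)
    (continuous_comp_phaseVar hα h.continuousOn) (continuous_phaseInt hα hG) z

theorem contDiff_phaseInt (hα : 0 < α) {F G : ℝ → ℝ} (h : IsEulerDeriv α F G)
    (hG : ContinuousOn G (Set.Ici 0)) :
    ContDiff ℝ 1 fun z : ℝ × ℝ => phaseInt α F z.1 z.2 := by
  rw [contDiff_one_iff_hasFDerivAt]
  refine ⟨_, ?_, fun z => (hasStrictFDerivAt_phaseInt hα h hG z).hasFDerivAt⟩
  exact ((continuous_comp_phaseVar hα h.continuousOn).smul continuous_const).add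
    ((continuous_phaseInt hα hG).smul continuous_const)

theorem abs_phaseInt_le {F : ℝ → ℝ} {C : ℝ} (φ ρ : ℝ) (h : ∀ θ, |F (phaseVar α θ ρ)| ≤ C) :
    |phaseInt α F φ ρ| ≤ C * |φ| := by
  have := intervalIntegral.norm_integral_le_of_norm_le_const (a := 0) (b := φ)
    (f := fun θ => F (phaseVar α θ ρ)) (C := C) fun θ _ => h θ
  simpa [phaseInt] using this

/-- Replacing θ by θ + π flips the sign of w, and u is even in w. So each half turn takes the same
time. -/
theorem phaseInt_add_pi (hα : 0 < α) {F : ℝ → ℝ} (hF : ContinuousOn F (Set.Ici 0)) (φ ρ : ℝ) :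
    phaseInt α F (φ + Real.pi) ρ = phaseInt α F φ ρ + phaseInt α F Real.pi ρ := by
  have hc := continuous_comp_phaseVar_left hα hF ρ
  have hp : Function.Periodic (fun θ => F (phaseVar α θ ρ)) Real.pi := fun θ => by
    simp only [phaseVar_add_pi hα]
  have h := hp.intervalIntegral_add_eq φ 0
  rw [zero_add] at h
  rw [phaseInt, phaseInt, phaseInt, ← h,
    intervalIntegral.integral_add_adjacent_intervals (hc.intervalIntegrable _ _)
      (hc.intervalIntegrable _ _)]

end PhaseIntegral

/-! ### The phase as the inverse of elapsed time -/

section Phase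

variable {α : ℝ}

theorem mul_le_phaseInt_tslope (hα : 0 < α) {c ρ : ℝ} (hc : ∀ θ, c ≤ tslope α (phaseVar α θ ρ)) :
    Monotone fun φ => phaseInt α (tslope α) φ ρ - c * φ := by
  have h : ∀ φ, HasDerivAt (fun φ => phaseInt α (tslope α) φ ρ - c * φ)
      (tslope α (phaseVar α φ ρ) - c) φ := fun φ => by
    simpa using (hasDerivAt_phaseInt_left hα (continuousOn_tslope hα) φ ρ).fun_sub
      ((hasDerivAt_id φ).const_mul c)
  refine monotone_of_deriv_nonneg (fun φ => (h φ).differentiableAt) fun φ => ?_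
  rw [(h φ).deriv, sub_nonneg]
  exact hc φ

theorem phaseInt_zero (F : ℝ → ℝ) (ρ : ℝ) : phaseInt α F 0 ρ = 0 := by simp [phaseInt]

theorem mul_abs_le_abs_phaseInt_tslope (hα : 0 < α) {c ρ : ℝ}
    (hc : ∀ θ, c ≤ tslope α (phaseVar α θ ρ)) (φ : ℝ) :
    c * |φ| ≤ |phaseInt α (tslope α) φ ρ| := by
  have hm := mul_le_phaseInt_tslope hα hc
  rcases le_total 0 φ with h | h
  · have := hm h
    simp only [phaseInt_zero, mul_zero, sub_zero] at this
    rw [abs_of_nonneg h]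
    exact le_trans (by linarith) (le_abs_self _)
  · have := hm h
    simp only [phaseInt_zero, mul_zero, sub_zero] at this
    rw [abs_of_nonpos h]
    exact le_trans (by linarith) (neg_le_abs _)

/-- On a fixed orbit u ≤ e^(αρ), so the angular speed is bounded above; hence the elapsed time grows
at least linearly in the angle and takes every real value. -/
theorem exists_pos_le_tslope (hα : 0 < α) (ρ : ℝ) :
    ∃ c > 0, ∀ θ, c ≤ tslope α (phaseVar α θ ρ) := by
  refine ⟨1 / (1 + Real.exp ρ ^ α), by positivity, fun θ => ?_⟩
  have hu := phaseVar_nonneg (α := α) θ ρ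
  have h := phaseVar_le hα θ ρ
  calc _ ≤ 1 / (1 + phaseVar α θ ρ) := by gcongr
    _ ≤ _ := by
      unfold tslope; gcongr
      exact Real.one_le_sqrt.2 (by simp only [le_add_iff_nonneg_right]; positivity)

theorem strictMono_phaseInt_tslope (hα : 0 < α) (ρ : ℝ) :
    StrictMono fun φ => phaseInt α (tslope α) φ ρ :=
  strictMono_of_deriv_pos fun φ => by
    rw [(hasDerivAt_phaseInt_left hα (continuousOn_tslope hα) φ ρ).deriv]
    exact tslope_pos hα (phaseVar_nonneg φ ρ)

theorem surjective_phaseInt_tslope (hα : 0 < α) (ρ : ℝ) :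
    Function.Surjective fun φ => phaseInt α (tslope α) φ ρ := by
  obtain ⟨c, hc0, hc⟩ := exists_pos_le_tslope hα ρ
  have hm := mul_le_phaseInt_tslope hα hc
  refine Continuous.surjective ?_ ?_ ?_
  · exact continuous_iff_continuousAt.2 fun φ =>
      (hasDerivAt_phaseInt_left hα (continuousOn_tslope hα) φ ρ).continuousAt
  · refine Filter.tendsto_atTop_mono' _ ?_ (Filter.tendsto_id.const_mul_atTop hc0)
    filter_upwards [Filter.eventually_ge_atTop 0] with φ hφ
    have := hm hφ
    simp only [phaseInt_zero, mul_zero, sub_zero] at this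
    simp only [id]; linarith
  · refine Filter.tendsto_atBot_mono' _ ?_ (Filter.tendsto_id.const_mul_atBot hc0)
    filter_upwards [Filter.eventually_le_atBot 0] with φ hφ
    have := hm hφ
    simp only [phaseInt_zero, mul_zero, sub_zero] at this
    simp only [id]; linarith

/-- The angle at time `t` on the orbit of energy `e^(2ρ)/2`. -/
noncomputable def phase (α t ρ : ℝ) : ℝ := Function.invFun (fun φ => phaseInt α (tslope α) φ ρ) t

theorem phaseInt_phase (hα : 0 < α) (t ρ : ℝ) : phaseInt α (tslope α) (phase α t ρ) ρ = t :=
  Function.rightInverse_invFun (surjective_phaseInt_tslope hα ρ) t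

theorem phase_phaseInt (hα : 0 < α) (φ ρ : ℝ) : phase α (phaseInt α (tslope α) φ ρ) ρ = φ :=
  Function.leftInverse_invFun (strictMono_phaseInt_tslope hα ρ).injective φ

theorem phase_zero (hα : 0 < α) (ρ : ℝ) : phase α 0 ρ = 0 := by
  have := phase_phaseInt hα 0 ρ
  rwa [phaseInt_zero] at this

theorem phase_add_period (hα : 0 < α) (t ρ : ℝ) :
    phase α (t + 2 * phaseInt α (tslope α) Real.pi ρ) ρ = phase α t ρ + 2 * Real.pi := by
  rw [← phase_phaseInt hα (phase α t ρ + 2 * Real.pi) ρ, two_mul Real.pi, ← add_assoc,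
    phaseInt_add_pi hα (continuousOn_tslope hα), phaseInt_add_pi hα (continuousOn_tslope hα),
    phaseInt_phase hα]
  congr 1
  ring

theorem contDiff_phase (hα : 0 < α) : ContDiff ℝ 1 fun z : ℝ × ℝ => phase α z.1 z.2 := by
  rw [contDiff_iff_contDiffAt]
  rintro ⟨t, ρ⟩
  set φ := phase α t ρ with hφ
  set f : ℝ × ℝ → ℝ × ℝ := fun z => (phaseInt α (tslope α) z.1 z.2, z.2) with hf
  set g : ℝ × ℝ → ℝ × ℝ := fun z => (phase α z.1 z.2, z.2) with hg
  have hfc : ContDiff ℝ 1 f :=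
    (contDiff_phaseInt hα (isEulerDeriv_tslope hα) (continuousOn_slopeFst hα)).prodMk contDiff_snd
  set m := tslope α (phaseVar α φ ρ) with hm
  have hm0 : m ≠ 0 := (tslope_pos hα (phaseVar_nonneg φ ρ)).ne'
  set j := phaseInt α (slopeFst α) φ ρ with hj
  -- The derivative of (φ, ρ) ↦ (time, ρ) is triangular with diagonal entries m > 0 and 1; `B` is
  -- its explicit inverse.
  set A : ℝ × ℝ →L[ℝ] ℝ × ℝ := (m • ContinuousLinearMap.fst ℝ ℝ ℝ +
    j • ContinuousLinearMap.snd ℝ ℝ ℝ).prod (ContinuousLinearMap.snd ℝ ℝ ℝ) with hA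
  set B : ℝ × ℝ →L[ℝ] ℝ × ℝ := (m⁻¹ • (ContinuousLinearMap.fst ℝ ℝ ℝ -
    j • ContinuousLinearMap.snd ℝ ℝ ℝ)).prod (ContinuousLinearMap.snd ℝ ℝ ℝ) with hB
  have hAB : Function.LeftInverse B A := fun z => by
    ext <;> simp [hA, hB]
    field_simp
  have hBA : Function.RightInverse B A := fun z => by
    ext <;> simp [hA, hB]
    field_simp; ring
  have hfd : HasFDerivAt f ((ContinuousLinearEquiv.equivOfInverse A B hAB hBA :
      (ℝ × ℝ) ≃L[ℝ] ℝ × ℝ) : ℝ × ℝ →L[ℝ] ℝ × ℝ) (φ, ρ) :=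
    ((hasStrictFDerivAt_phaseInt hα (isEulerDeriv_tslope hα) (continuousOn_slopeFst hα)
      (φ, ρ)).hasFDerivAt).prodMk hasFDerivAt_snd
  have h := ContDiffAt.of_leftInverse (n := 1) (by simp) hfc.contDiffAt hfd (g := g)
    (Filter.Eventually.of_forall fun z => by simp [hf, hg, phase_phaseInt hα])
  have e : f (φ, ρ) = (t, ρ) := by simp [hf, hφ, phaseInt_phase hα]
  rw [e] at h
  exact h.fst

/-- Implicit differentiation of the identity time(phase(t, ρ), ρ) = t. -/
theorem hasFDerivAt_phase (hα : 0 < α) (z : ℝ × ℝ) :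
    HasFDerivAt (fun z : ℝ × ℝ => phase α z.1 z.2)
      ((tslope α (phaseVar α (phase α z.1 z.2) z.2))⁻¹ • (ContinuousLinearMap.fst ℝ ℝ ℝ -
        phaseInt α (slopeFst α) (phase α z.1 z.2) z.2 • ContinuousLinearMap.snd ℝ ℝ ℝ)) z := by
  have hd := ((contDiff_phase hα).differentiable (by simp) z).hasFDerivAt
  have h1 : HasFDerivAt (fun z : ℝ × ℝ => ((phase α z.1 z.2, z.2) : ℝ × ℝ)) _ z :=
    hd.prodMk hasFDerivAt_snd
  have h2 := HasFDerivAt.comp z (hasStrictFDerivAt_phaseInt hα (isEulerDeriv_tslope hα)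
    (continuousOn_slopeFst hα) (phase α z.1 z.2, z.2)).hasFDerivAt h1
  have e : ((fun z : ℝ × ℝ => phaseInt α (tslope α) z.1 z.2) ∘
      fun z : ℝ × ℝ => (phase α z.1 z.2, z.2)) = Prod.fst :=
    funext fun z => phaseInt_phase hα z.1 z.2
  rw [e] at h2
  have h3 := h2.unique hasFDerivAt_fst
  have hm0 := (tslope_pos hα (phaseVar_nonneg (α := α) (phase α z.1 z.2) z.2)).ne'
  refine hd.congr_fderiv ?_
  rw [eq_inv_smul_iff₀ hm0, ← h3]
  ext <;> simp

end Phase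

/-! ### The oscillator orbit as a C² function of time and log-amplitude -/

section Orbit

variable {α : ℝ}

/-- `w dz/dw`. -/
noncomputable def energyInvEuler (α w : ℝ) : ℝ := tslope α (energyPow α w) * w

theorem continuous_comp_energyPow (hα : 0 < α) {F : ℝ → ℝ} (hF : ContinuousOn F (Set.Ici 0)) :
    Continuous fun w => F (energyPow α w) :=
  hF.comp_continuous (continuous_energyPow hα) fun w => energyPow_nonneg w

theorem slopeFst_zero : slopeFst α 0 = 0 := by simp [slopeFst, slopeRate]

/-- The factor w removes the possible singularity of dz/dw at w = 0: the derivative is again a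
continuous function of u. -/
theorem hasDerivAt_energyInvEuler (hα : 0 < α) (w : ℝ) :
    HasDerivAt (energyInvEuler α) (tslope α (energyPow α w) + slopeFst α (energyPow α w)) w := by
  rcases eq_or_ne w 0 with rfl | hw
  · rw [energyPow_zero hα, tslope_zero, slopeFst_zero, add_zero, hasDerivAt_iff_tendsto_slope]
    have h1 := ((continuous_comp_energyPow hα (continuousOn_tslope hα)).tendsto 0).mono_left
      (nhdsWithin_le_nhds (s := {0}ᶜ))
    rw [energyPow_zero hα, tslope_zero] at h1
    refine h1.congr' ?_
    filter_upwards [self_mem_nhdsWithin] with z hz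
    have hz : z ≠ 0 := hz
    rw [slope_def_field]
    simp only [energyInvEuler, mul_zero, sub_zero]
    field_simp
  · have h1 := (hasDerivAt_tslope hα (energyPow_nonneg (α := α) w)).comp w
      (hasDerivAt_energyPow hα hw)
    refine (h1.mul (hasDerivAt_id w)).congr_deriv ?_
    rw [← tslope_deriv_mul_eulerField hα (energyPow_nonneg w)]
    simp only [id, Function.comp]
    field_simp
    ring

theorem contDiff_energyInvEuler (hα : 0 < α) : ContDiff ℝ 1 (energyInvEuler α) := by
  rw [contDiff_one_iff_deriv]
  refine ⟨fun w => (hasDerivAt_energyInvEuler hα w).differentiableAt, ?_⟩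
  have : deriv (energyInvEuler α) =
      fun w => tslope α (energyPow α w) + slopeFst α (energyPow α w) :=
    funext fun w => (hasDerivAt_energyInvEuler hα w).deriv
  rw [this]
  exact (continuous_comp_energyPow hα (continuousOn_tslope hα)).add
    (continuous_comp_energyPow hα (continuousOn_slopeFst hα))

/-- The solution of `z'' + z + |z|^α z = 0` with `z = 0` and `z' = e^ρ` at time `0`, as a function
of `(t, ρ)`. -/
noncomputable def orbit (α : ℝ) (z : ℝ × ℝ) : ℝ :=
  energyInv α (Real.exp z.2 * Real.sin (phase α z.1 z.2))

/-- The velocity along `orbit`. -/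
noncomputable def orbitVelocity (α : ℝ) (z : ℝ × ℝ) : ℝ :=
  Real.exp z.2 * Real.cos (phase α z.1 z.2)

/-- The derivative of `orbit` with respect to `ρ`. -/
noncomputable def orbitVariation (α : ℝ) (z : ℝ × ℝ) : ℝ :=
  energyInvEuler α (Real.exp z.2 * Real.sin (phase α z.1 z.2)) -
    orbitVelocity α z * phaseInt α (slopeFst α) (phase α z.1 z.2) z.2

/-- The factor dz/dw from `energyInv` cancels its inverse in the derivative of the phase. What
remains involves only C¹ functions, which is why the orbit is C² although it is composed of maps
shown here to be only C¹. -/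
theorem hasFDerivAt_orbit (hα : 0 < α) (z : ℝ × ℝ) :
    HasFDerivAt (orbit α) (orbitVelocity α z • ContinuousLinearMap.fst ℝ ℝ ℝ +
      orbitVariation α z • ContinuousLinearMap.snd ℝ ℝ ℝ) z := by
  have h1 := (hasFDerivAt_phase hα z).sin
  have h2 := ((Real.hasDerivAt_exp z.2).hasFDerivAt.comp z
    (hasFDerivAt_snd (𝕜 := ℝ) (E := ℝ) (F := ℝ) (p := z))).mul h1
  have h3 := (hasDerivAt_energyInv hα
    (Real.exp z.2 * Real.sin (phase α z.1 z.2))).hasFDerivAt.comp z h2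
  refine h3.congr_fderiv ?_
  have hm0 := (tslope_pos hα (phaseVar_nonneg (α := α) (phase α z.1 z.2) z.2)).ne'
  unfold orbitVariation orbitVelocity energyInvEuler
  rw [phaseVar] at *
  ext
  · simp
    field_simp
  · simp
    field_simp
    ring

theorem contDiff_exp_snd : ContDiff ℝ 1 fun z : ℝ × ℝ => Real.exp z.2 := contDiff_snd.exp

theorem contDiff_orbitVelocity (hα : 0 < α) : ContDiff ℝ 1 (orbitVelocity α) :=
  contDiff_exp_snd.mul (contDiff_phase hα).cos

theorem contDiff_phaseInt_phase (hα : 0 < α) : ContDiff ℝ 1 fun z : ℝ × ℝ =>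
    phaseInt α (slopeFst α) (phase α z.1 z.2) z.2 :=
  (contDiff_phaseInt hα (isEulerDeriv_slopeFst hα) (continuousOn_slopeSnd hα)).comp
    ((contDiff_phase hα).prodMk contDiff_snd)

theorem contDiff_orbitVariation (hα : 0 < α) : ContDiff ℝ 1 (orbitVariation α) :=
  ((contDiff_energyInvEuler hα).comp (contDiff_exp_snd.mul (contDiff_phase hα).sin)).sub
    ((contDiff_orbitVelocity hα).mul (contDiff_phaseInt_phase hα))

theorem contDiff_orbit (hα : 0 < α) : ContDiff ℝ 2 (orbit α) := by
  rw [show (2 : WithTop ℕ∞) = ((1 : ℕ) : WithTop ℕ∞) + 1 by norm_num, contDiff_succ_iff_hasFDerivAt]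
  exact ⟨_, ((contDiff_orbitVelocity hα).smul contDiff_const).add
    ((contDiff_orbitVariation hα).smul contDiff_const), hasFDerivAt_orbit hα⟩

theorem norm_smul_fst_add_smul_snd_le (a b : ℝ) :
    ‖a • ContinuousLinearMap.fst ℝ ℝ ℝ + b • ContinuousLinearMap.snd ℝ ℝ ℝ‖ ≤ |a| + |b| := by
  refine (norm_add_le _ _).trans (add_le_add ?_ ?_) <;> rw [norm_smul, Real.norm_eq_abs]
  · exact mul_le_of_le_one_right (abs_nonneg _) (ContinuousLinearMap.norm_fst_le ℝ ℝ ℝ)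
  · exact mul_le_of_le_one_right (abs_nonneg _) (ContinuousLinearMap.norm_snd_le ℝ ℝ ℝ)

theorem norm_fderiv_exp_snd_le (z : ℝ × ℝ) :
    ‖fderiv ℝ (fun z : ℝ × ℝ => Real.exp z.2) z‖ ≤ Real.exp z.2 := by
  rw [(hasFDerivAt_snd (𝕜 := ℝ) (E := ℝ) (F := ℝ) (p := z)).exp.fderiv, norm_smul,
    Real.norm_eq_abs, Real.abs_exp]
  exact mul_le_of_le_one_right (Real.exp_pos _).le (ContinuousLinearMap.norm_snd_le ℝ ℝ ℝ)

/-- On bounded time intervals, the derivatives of `orbit` up to order two are `O(e^ρ)`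
as `ρ → -∞`. -/
theorem exists_norm_fderiv_orbit_le (hα : 0 < α) (τ : ℝ) : ∃ C : ℝ, 0 < C ∧
    ∀ z : ℝ × ℝ, |z.1| ≤ τ → z.2 ≤ 0 → ‖fderiv ℝ (orbit α) z‖ ≤ C * Real.exp z.2 ∧
      ‖fderiv ℝ (fderiv ℝ (orbit α)) z‖ ≤ C * Real.exp z.2 := by
  obtain ⟨K, hK, hF⟩ := exists_abs_tslope_le hα
  have hF1 : ∀ u, 0 ≤ u → u ≤ 1 → |slopeFst α u| ≤ K := fun u h0 h1 =>
    (hF u h0 h1).1.trans (mul_le_of_le_one_right hK.le h1)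
  have hF2 : ∀ u, 0 ≤ u → u ≤ 1 → |slopeSnd α u| ≤ K := fun u h0 h1 =>
    (hF u h0 h1).2.trans (mul_le_of_le_one_right hK.le h1)
  -- Replaces τ, whose sign is not assumed, by a nonnegative bound on |t|.
  set σ := max τ 0 with hσ
  have hσ0 : 0 ≤ σ := le_max_right _ _
  -- bound for the derivative of the phase
  set D := 2 * (1 + K * (2 * σ)) with hD
  have hD0 : 0 ≤ D := by positivity
  set C1 := 1 + K * (2 * σ) with hC1
  have hC10 : 0 ≤ C1 := by positivity
  set C2 := (1 + D) + ((1 + K) * (1 + D) + ((1 + D) * (K * (2 * σ)) + (K * D + K * (2 * σ))))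
    with hC2
  have hC20 : 0 < C2 := by positivity
  refine ⟨1 + C1 + C2, by positivity, fun z hz hρ => ?_⟩
  have hzσ : |z.1| ≤ σ := hz.trans (le_max_left _ _)
  set P : ℝ × ℝ → ℝ := fun z => phase α z.1 z.2 with hP
  have hv0 : ∀ θ, 0 ≤ phaseVar α θ z.2 := fun θ => phaseVar_nonneg _ _
  have hv1 : ∀ θ, phaseVar α θ z.2 ≤ 1 := fun θ => phaseVar_le_one hα θ hρ
  -- For ρ ≤ 0 one has u ≤ 1 and `tslope` ≥ 1/2, so the angle advances at most twice as fast as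
  -- time.
  have hPabs : |P z| ≤ 2 * σ := by
    have := mul_abs_le_abs_phaseInt_tslope hα (c := 1 / 2)
      (fun θ => half_le_tslope hα (hv0 θ) (hv1 θ)) (P z)
    rw [hP, phaseInt_phase hα] at this
    change 1 / 2 * |P z| ≤ |z.1| at this
    linarith
  have hJ1 : |phaseInt α (slopeFst α) (P z) z.2| ≤ K * (2 * σ) :=
    (abs_phaseInt_le (P z) z.2 fun θ => hF1 _ (hv0 θ) (hv1 θ)).trans (by gcongr)
  have hJ2 : |phaseInt α (slopeSnd α) (P z) z.2| ≤ K * (2 * σ) :=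
    (abs_phaseInt_le (P z) z.2 fun θ => hF2 _ (hv0 θ) (hv1 θ)).trans (by gcongr)
  have hE := (Real.exp_pos z.2)
  have hPd : DifferentiableAt ℝ P z := (hasFDerivAt_phase hα z).differentiableAt
  have hEd : DifferentiableAt ℝ (fun z : ℝ × ℝ => Real.exp z.2) z :=
    contDiff_exp_snd.differentiable (by simp) z
  have hDP : ‖fderiv ℝ P z‖ ≤ D := by
    rw [hP, (hasFDerivAt_phase hα z).fderiv, norm_smul, norm_inv, hD]
    have hm := half_le_tslope hα (hv0 (P z)) (hv1 (P z))
    refine mul_le_mul ?_ ?_ (norm_nonneg _) (by norm_num)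
    · rw [Real.norm_of_nonneg (by linarith), inv_le_comm₀ (by linarith) (by norm_num)]
      linarith
    · have := norm_smul_fst_add_smul_snd_le 1 (-phaseInt α (slopeFst α) (P z) z.2)
      rw [one_smul, neg_smul, ← sub_eq_add_neg, abs_one, abs_neg] at this
      exact this.trans (by rw [hC1]; linarith [hJ1])
  have hVel : |orbitVelocity α z| ≤ Real.exp z.2 := by
    rw [orbitVelocity, abs_mul, Real.abs_exp]
    exact mul_le_of_le_one_right hE.le (Real.abs_cos_le_one _)
  have hmul : ∀ {f : ℝ × ℝ → ℝ}, DifferentiableAt ℝ f z → |f z| ≤ 1 → ‖fderiv ℝ f z‖ ≤ D →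
      ‖fderiv ℝ (fun z : ℝ × ℝ => Real.exp z.2 * f z) z‖ ≤ (1 + D) * Real.exp z.2 := by
    intro f hf h1 h2
    refine (norm_fderiv_smul_le hEd hf).trans ?_
    rw [Real.norm_eq_abs, Real.abs_exp, Real.norm_eq_abs]
    calc _ ≤ Real.exp z.2 * D + Real.exp z.2 * 1 := by
          gcongr
          exact norm_fderiv_exp_snd_le z
      _ = _ := by ring
  have hDS : ‖fderiv ℝ (fun z : ℝ × ℝ => Real.exp z.2 * Real.sin (P z)) z‖ ≤
      (1 + D) * Real.exp z.2 := by
    refine hmul hPd.sin (Real.abs_sin_le_one _) ?_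
    rw [hPd.hasFDerivAt.sin.fderiv, norm_smul]
    exact (mul_le_of_le_one_left (norm_nonneg _) (Real.abs_cos_le_one _)).trans hDP
  have hDVel : ‖fderiv ℝ (orbitVelocity α) z‖ ≤ (1 + D) * Real.exp z.2 := by
    refine hmul (f := fun z => Real.cos (P z)) hPd.cos (Real.abs_cos_le_one _) ?_
    rw [hPd.hasFDerivAt.cos.fderiv, norm_smul, norm_neg]
    exact (mul_le_of_le_one_left (norm_nonneg _) (Real.abs_sin_le_one _)).trans hDP
  have hN : |energyInvEuler α (Real.exp z.2 * Real.sin (P z))| ≤ Real.exp z.2 := by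
    rw [energyInvEuler, abs_mul]
    refine (mul_le_of_le_one_left (abs_nonneg _) ?_).trans (abs_exp_mul_sin_le _ _)
    rw [abs_of_pos (tslope_pos hα (energyPow_nonneg _))]
    exact tslope_le_one hα (energyPow_nonneg _)
  have hVar : |orbitVariation α z| ≤ C1 * Real.exp z.2 := by
    refine (abs_sub _ _).trans ?_
    rw [abs_mul]
    calc _ ≤ Real.exp z.2 + Real.exp z.2 * (K * (2 * σ)) := by
          gcongr
      _ = _ := by rw [hC1]; ring
  have hDN : ‖fderiv ℝ (fun z : ℝ × ℝ => energyInvEuler α (Real.exp z.2 * Real.sin (P z))) z‖ ≤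
      (1 + K) * (1 + D) * Real.exp z.2 := by
    refine (norm_fderiv_comp_le (hasDerivAt_energyInvEuler hα _).differentiableAt
      (hEd.mul hPd.sin)).trans ?_
    rw [mul_assoc]
    refine mul_le_mul ?_ hDS (norm_nonneg _) (by positivity)
    rw [← norm_deriv_eq_norm_fderiv, (hasDerivAt_energyInvEuler hα _).deriv]
    refine (norm_add_le _ _).trans (add_le_add ?_ ?_)
    · rw [Real.norm_of_nonneg (tslope_pos hα (energyPow_nonneg _)).le]
      exact tslope_le_one hα (energyPow_nonneg _)
    · exact hF1 _ (hv0 _) (hv1 _)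
  have hDJ : ‖fderiv ℝ (fun z : ℝ × ℝ => phaseInt α (slopeFst α) (P z) z.2) z‖ ≤
      K * D + K * (2 * σ) := by
    have h := HasFDerivAt.comp z (hasStrictFDerivAt_phaseInt hα (isEulerDeriv_slopeFst hα)
      (continuousOn_slopeSnd hα) (P z, z.2)).hasFDerivAt
      (hPd.hasFDerivAt.prodMk (hasFDerivAt_snd (𝕜 := ℝ) (E := ℝ) (F := ℝ) (p := z)))
    have h' : HasFDerivAt (fun z : ℝ × ℝ => phaseInt α (slopeFst α) (P z) z.2)
        (slopeFst α (phaseVar α (P z) z.2) • fderiv ℝ P z +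
          phaseInt α (slopeSnd α) (P z) z.2 • ContinuousLinearMap.snd ℝ ℝ ℝ) z := by
      refine h.congr_fderiv ?_
      ext <;> simp
    rw [h'.fderiv]
    refine (norm_add_le _ _).trans (add_le_add ?_ ?_) <;> rw [norm_smul, Real.norm_eq_abs]
    · exact mul_le_mul (hF1 _ (hv0 _) (hv1 _)) hDP (norm_nonneg _) hK.le
    · exact (mul_le_of_le_one_right (abs_nonneg _)
        (ContinuousLinearMap.norm_snd_le ℝ ℝ ℝ)).trans hJ2
  have hDVar : ‖fderiv ℝ (orbitVariation α) z‖ ≤ ((1 + K) * (1 + D) +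
      ((1 + D) * (K * (2 * σ)) + (K * D + K * (2 * σ)))) * Real.exp z.2 := by
    have hd1 : DifferentiableAt ℝ
        (fun z : ℝ × ℝ => energyInvEuler α (Real.exp z.2 * Real.sin (P z))) z :=
      DifferentiableAt.comp z (hasDerivAt_energyInvEuler hα _).differentiableAt (hEd.mul hPd.sin)
    have hd2 := (contDiff_orbitVelocity hα).differentiable (by simp) z
    have hd3 := (contDiff_phaseInt_phase hα).differentiable (by simp) z
    have : orbitVariation α = fun z => energyInvEuler α (Real.exp z.2 * Real.sin (P z)) -
      orbitVelocity α z * phaseInt α (slopeFst α) (P z) z.2 := rfl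
    rw [this]
    refine (congrArg norm (fderiv_fun_sub hd1 (hd2.fun_mul hd3))).le.trans ?_
    refine (norm_sub_le _ _).trans ?_
    have h4 := norm_fderiv_smul_le hd2 hd3
    rw [Real.norm_eq_abs, Real.norm_eq_abs] at h4
    calc _ ≤ (1 + K) * (1 + D) * Real.exp z.2 + (Real.exp z.2 * (K * D + K * (2 * σ)) +
        (1 + D) * Real.exp z.2 * (K * (2 * σ))) := by
          refine add_le_add hDN (h4.trans ?_)
          gcongr
      _ = _ := by ring
  constructor
  · rw [(hasFDerivAt_orbit hα z).fderiv]
    refine (norm_smul_fst_add_smul_snd_le _ _).trans ?_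
    calc _ ≤ Real.exp z.2 + C1 * Real.exp z.2 := add_le_add hVel hVar
      _ = (1 + C1) * Real.exp z.2 := by ring
      _ ≤ _ := mul_le_mul_of_nonneg_right (by linarith) hE.le
  · have e : fderiv ℝ (orbit α) = fun z => orbitVelocity α z • ContinuousLinearMap.fst ℝ ℝ ℝ +
        orbitVariation α z • ContinuousLinearMap.snd ℝ ℝ ℝ :=
      funext fun z => (hasFDerivAt_orbit hα z).fderiv
    have hd1 := ((contDiff_orbitVelocity hα).differentiable (by simp) z).hasFDerivAt
    have hd2 := ((contDiff_orbitVariation hα).differentiable (by simp) z).hasFDerivAt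
    rw [e, ((hd1.smul_const (ContinuousLinearMap.fst ℝ ℝ ℝ)).fun_add
      (hd2.smul_const (ContinuousLinearMap.snd ℝ ℝ ℝ))).fderiv]
    refine (norm_add_le _ _).trans ?_
    rw [ContinuousLinearMap.norm_smulRight_apply, ContinuousLinearMap.norm_smulRight_apply]
    calc _ ≤ ((1 + D) * Real.exp z.2) * 1 + (((1 + K) * (1 + D) +
      ((1 + D) * (K * (2 * σ)) + (K * D + K * (2 * σ)))) * Real.exp z.2) * 1 := by
          gcongr
          · exact ContinuousLinearMap.norm_fst_le ℝ ℝ ℝ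
          · exact ContinuousLinearMap.norm_snd_le ℝ ℝ ℝ
      _ = C2 * Real.exp z.2 := by rw [hC2]; ring
      _ ≤ _ := mul_le_mul_of_nonneg_right (by linarith) hE.le

theorem abs_orbit_le (hα : 0 < α) (z : ℝ × ℝ) : |orbit α z| ≤ Real.exp z.2 :=
  (abs_energyInv_le hα _).trans (abs_exp_mul_sin_le _ _)

theorem hasDerivAt_orbit (hα : 0 < α) (t ρ : ℝ) :
    HasDerivAt (fun t => orbit α (t, ρ)) (orbitVelocity α (t, ρ)) t := by
  have h := (hasFDerivAt_orbit hα (t, ρ)).comp_hasDerivAt t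
    ((hasDerivAt_id t).prodMk (hasDerivAt_const t ρ))
  exact h.congr_deriv (by simp)

/-- The derivative of e^ρ cos φ is -w/(dz/dw), and this equals -(z + |z|^α z). -/
theorem hasDerivAt_orbitVelocity (hα : 0 < α) (t ρ : ℝ) :
    HasDerivAt (fun t => orbitVelocity α (t, ρ))
      (-(orbit α (t, ρ) * (1 + |orbit α (t, ρ)| ^ α))) t := by
  have h := (hasFDerivAt_phase hα (t, ρ)).comp_hasDerivAt t
    ((hasDerivAt_id t).prodMk (hasDerivAt_const t ρ))
  have h2 := (h.cos).const_mul (Real.exp ρ)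
  refine h2.congr_deriv ?_
  have := div_tslope_energyPow hα (Real.exp ρ * Real.sin (phase α t ρ))
  change _ = -(energyInv α (Real.exp ρ * Real.sin (phase α t ρ)) *
    (1 + energyPow α (Real.exp ρ * Real.sin (phase α t ρ))))
  rw [← this]
  simp [phaseVar]
  ring

theorem orbit_periodic (hα : 0 < α) (t ρ : ℝ) :
    orbit α (t + 2 * phaseInt α (tslope α) Real.pi ρ, ρ) = orbit α (t, ρ) := by
  simp only [orbit, phase_add_period hα, Real.sin_add_two_pi]

theorem orbit_zero (hα : 0 < α) (ρ : ℝ) : orbit α (0, ρ) = 0 := by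
  simp only [orbit, phase_zero hα, Real.sin_zero, mul_zero, energyInv_zero hα]

theorem exists_orbit_ne_zero (hα : 0 < α) (ρ : ℝ) : ∃ t, orbit α (t, ρ) ≠ 0 := by
  refine ⟨phaseInt α (tslope α) (Real.pi / 2) ρ, ?_⟩
  simp only [orbit, phase_phaseInt hα, Real.sin_pi_div_two, mul_one]
  exact energyInv_ne_zero hα (Real.exp_ne_zero _)

end Orbit

/-! ### Monotonicity, range and small-amplitude asymptotics of the period -/

section PeriodDefect

variable {α : ℝ}

/-- The difference between the half period `π` of the linear oscillator and the half period of
the orbit of energy `e^(2ρ)/2`. -/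
noncomputable def periodDefect (α ρ : ℝ) : ℝ := Real.pi - phaseInt α (tslope α) Real.pi ρ

theorem hasDerivAt_periodDefect (hα : 0 < α) (ρ : ℝ) :
    HasDerivAt (periodDefect α) (-phaseInt α (slopeFst α) Real.pi ρ) ρ :=
  (hasDerivAt_phaseInt_right hα (isEulerDeriv_tslope hα) (continuousOn_slopeFst hα)
    Real.pi ρ).const_sub _

theorem hasDerivAt_neg_phaseInt_slopeFst (hα : 0 < α) (ρ : ℝ) :
    HasDerivAt (fun ρ => -phaseInt α (slopeFst α) Real.pi ρ)
      (-phaseInt α (slopeSnd α) Real.pi ρ) ρ :=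
  (hasDerivAt_phaseInt_right hα (isEulerDeriv_slopeFst hα) (continuousOn_slopeSnd hα)
    Real.pi ρ).fun_neg

theorem contDiff_periodDefect (hα : 0 < α) : ContDiff ℝ 2 (periodDefect α) := by
  rw [show (2 : WithTop ℕ∞) = 1 + 1 by norm_num, contDiff_succ_iff_deriv]
  refine ⟨fun ρ => (hasDerivAt_periodDefect hα ρ).differentiableAt, by simp, ?_⟩
  rw [show deriv (periodDefect α) = fun ρ => -phaseInt α (slopeFst α) Real.pi ρ from
    funext fun ρ => (hasDerivAt_periodDefect hα ρ).deriv]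
  exact ((contDiff_phaseInt hα (isEulerDeriv_slopeFst hα) (continuousOn_slopeSnd hα)).comp
    (contDiff_const.prodMk contDiff_id)).neg

theorem intervalIntegrable_comp_phaseVar (hα : 0 < α) {F : ℝ → ℝ}
    (hF : ContinuousOn F (Set.Ici 0)) (ρ a b : ℝ) :
    IntervalIntegrable (fun θ => F (phaseVar α θ ρ)) MeasureTheory.volume a b :=
  (continuous_comp_phaseVar_left hα hF ρ).intervalIntegrable a b

theorem phaseInt_mono (hα : 0 < α) {F G : ℝ → ℝ} (hF : ContinuousOn F (Set.Ici 0))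
    (hG : ContinuousOn G (Set.Ici 0)) {ρ : ℝ}
    (h : ∀ θ, F (phaseVar α θ ρ) ≤ G (phaseVar α θ ρ)) :
    phaseInt α F Real.pi ρ ≤ phaseInt α G Real.pi ρ :=
  intervalIntegral.integral_mono_on Real.pi_pos.le (intervalIntegrable_comp_phaseVar hα hF ρ _ _)
    (intervalIntegrable_comp_phaseVar hα hG ρ _ _) fun θ _ => h θ

theorem phaseInt_pos (hα : 0 < α) {F : ℝ → ℝ} (hF : ContinuousOn F (Set.Ici 0))
    (h : ∀ u, 0 < u → 0 < F u) (ρ : ℝ) : 0 < phaseInt α F Real.pi ρ :=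
  intervalIntegral.intervalIntegral_pos_of_pos_on (intervalIntegrable_comp_phaseVar hα hF ρ _ _)
    (fun _ hθ => h _ (phaseVar_pos hα hθ.1 hθ.2 ρ)) Real.pi_pos

theorem phaseInt_const_mul (F : ℝ → ℝ) (c φ ρ : ℝ) :
    phaseInt α (fun u => c * F u) φ ρ = c * phaseInt α F φ ρ :=
  intervalIntegral.integral_const_mul _ _

theorem phaseInt_neg (F : ℝ → ℝ) (φ ρ : ℝ) :
    phaseInt α (fun u => -F u) φ ρ = -phaseInt α F φ ρ :=
  intervalIntegral.integral_neg

theorem periodDefect_eq (hα : 0 < α) (ρ : ℝ) :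
    periodDefect α ρ = phaseInt α (fun u => 1 - tslope α u) Real.pi ρ := by
  rw [phaseInt, intervalIntegral.integral_sub intervalIntegrable_const
    (intervalIntegrable_comp_phaseVar hα (continuousOn_tslope hα) ρ _ _)]
  simp [periodDefect, phaseInt]

theorem continuousOn_one_sub_tslope (hα : 0 < α) :
    ContinuousOn (fun u => 1 - tslope α u) (Set.Ici 0) :=
  continuousOn_const.sub (continuousOn_tslope hα)

theorem periodDefect_pos (hα : 0 < α) (ρ : ℝ) : 0 < periodDefect α ρ := by
  rw [periodDefect_eq hα]
  exact phaseInt_pos hα (continuousOn_one_sub_tslope hα) (fun u hu => one_sub_tslope_pos hα hu) ρ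

/-- The hardening effect: `slopeFst` is negative for u > 0, so the half period shrinks as the
amplitude grows. -/
theorem strictMono_periodDefect (hα : 0 < α) : StrictMono (periodDefect α) :=
  strictMono_of_deriv_pos fun ρ => by
    rw [(hasDerivAt_periodDefect hα ρ).deriv, ← phaseInt_neg]
    exact phaseInt_pos hα (continuousOn_slopeFst hα).neg
      (fun u hu => neg_pos.2 (slopeFst_neg hα hu)) ρ

/-- The integrand 1 - `tslope` lies between 0 and u ≤ e^(αρ). -/
theorem tendsto_periodDefect_atBot (hα : 0 < α) :
    Filter.Tendsto (periodDefect α) Filter.atBot (𝓝 0) := by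
  have h : ∀ ρ, periodDefect α ρ ≤ Real.exp ρ ^ α * Real.pi := fun ρ => by
    rw [periodDefect_eq hα]
    have := abs_phaseInt_le (α := α) (F := fun u => 1 - tslope α u) Real.pi ρ
      (C := Real.exp ρ ^ α) fun θ => by
        have hv := phaseVar_nonneg (α := α) θ ρ
        rw [abs_of_nonneg (sub_nonneg.2 (tslope_le_one hα hv))]
        exact (one_sub_tslope_le hα hv).trans (phaseVar_le hα θ ρ)
    rw [abs_of_pos Real.pi_pos] at this
    exact (le_abs_self _).trans this
  refine squeeze_zero (fun ρ => (periodDefect_pos hα ρ).le) h ?_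
  have h1 := (Real.tendsto_exp_atBot.rpow_const (p := α) (Or.inr hα.le)).mul_const Real.pi
  rwa [Real.zero_rpow hα.ne', zero_mul] at h1

theorem tendsto_energyPow_atTop (hα : 0 < α) :
    Filter.Tendsto (energyPow α) Filter.atTop Filter.atTop := by
  have h : Filter.Tendsto (energyInv α) Filter.atTop Filter.atTop := by
    refine Filter.tendsto_atTop.2 fun b => ?_
    filter_upwards [Filter.eventually_ge_atTop (energyCoord α b)] with w hw
    rwa [← (strictMono_energyCoord hα).le_iff_le, energyCoord_energyInv hα]
  exact (tendsto_rpow_atTop hα).comp (Filter.tendsto_abs_atTop_atTop.comp h)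

theorem tendsto_tslope_atTop (hα : 0 < α) :
    Filter.Tendsto (tslope α) Filter.atTop (𝓝 0) := by
  have h1 : Filter.Tendsto (fun u : ℝ => √(1 / (1 + u))) Filter.atTop (𝓝 0) := by
    have := (tendsto_inv_atTop_zero.comp (Filter.tendsto_atTop_add_const_left Filter.atTop (1 : ℝ)
      Filter.tendsto_id)).sqrt
    rw [Real.sqrt_zero] at this
    simpa [Function.comp_def, one_div] using this
  refine squeeze_zero' ?_ ?_ h1
  · filter_upwards [Filter.eventually_ge_atTop 0] with u hu using (tslope_pos hα hu).le
  · filter_upwards [Filter.eventually_ge_atTop 0] with u hu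
    exact Real.le_sqrt_of_sq_le (tslope_sq_le hα hu)

/-- For every θ in (0, π) the variable u tends to infinity and `tslope` to 0, dominated by 1; so the
half period vanishes in the limit. With the limit 0 at -∞, every value in (0, π) is a defect. -/
theorem tendsto_periodDefect_atTop (hα : 0 < α) :
    Filter.Tendsto (periodDefect α) Filter.atTop (𝓝 Real.pi) := by
  have h : Filter.Tendsto (fun ρ => phaseInt α (tslope α) Real.pi ρ) Filter.atTop
      (𝓝 (∫ _ in (0 : ℝ)..Real.pi, (0 : ℝ))) := by
    refine intervalIntegral.tendsto_integral_filter_of_dominated_convergence (fun _ => 1)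
      (Filter.Eventually.of_forall fun ρ =>
        (continuous_comp_phaseVar_left hα (continuousOn_tslope hα) ρ).aestronglyMeasurable)
      (Filter.Eventually.of_forall fun ρ => Filter.Eventually.of_forall fun θ _ => ?_)
      intervalIntegrable_const ?_
    · rw [Real.norm_of_nonneg (tslope_pos hα (phaseVar_nonneg _ _)).le]
      exact tslope_le_one hα (phaseVar_nonneg _ _)
    · have hne : ∀ᵐ θ : ℝ, θ ≠ Real.pi := MeasureTheory.Measure.ae_ne _ _
      filter_upwards [hne] with θ hθ hmem
      rw [Set.uIoc_of_le Real.pi_pos.le] at hmem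
      have hs := Real.sin_pos_of_pos_of_lt_pi hmem.1 (lt_of_le_of_ne hmem.2 hθ)
      exact (tendsto_tslope_atTop hα).comp ((tendsto_energyPow_atTop hα).comp
        (Real.tendsto_exp_atTop.atTop_mul_const hs))
  simp only [intervalIntegral.integral_zero] at h
  have h2 := h.const_sub Real.pi
  rwa [sub_zero] at h2

theorem exists_periodDefect_eq (hα : 0 < α) {y : ℝ} (h0 : 0 < y) (hπ : y < Real.pi) :
    ∃ ρ, periodDefect α ρ = y := by
  obtain ⟨a, ha⟩ := ((tendsto_periodDefect_atBot hα).eventually (gt_mem_nhds h0)).exists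
  obtain ⟨b, hb⟩ := ((tendsto_periodDefect_atTop hα).eventually (lt_mem_nhds hπ)).exists
  exact mem_range_of_exists_le_of_exists_ge (contDiff_periodDefect hα).continuous
    ⟨a, ha.le⟩ ⟨b, hb.le⟩

/-- The logarithmic amplitude of the orbit with half period `π - y`. -/
noncomputable def logAmplitude (α : ℝ) : ℝ → ℝ := Function.invFun (periodDefect α)

theorem periodDefect_logAmplitude (hα : 0 < α) {y : ℝ} (h0 : 0 < y) (hπ : y < Real.pi) :
    periodDefect α (logAmplitude α y) = y :=
  Function.invFun_eq (exists_periodDefect_eq hα h0 hπ)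

theorem logAmplitude_periodDefect (hα : 0 < α) (ρ : ℝ) :
    logAmplitude α (periodDefect α ρ) = ρ :=
  Function.leftInverse_invFun (strictMono_periodDefect hα).injective ρ

theorem neg_phaseInt_slopeFst_pos (hα : 0 < α) (ρ : ℝ) :
    0 < -phaseInt α (slopeFst α) Real.pi ρ := by
  rw [← phaseInt_neg]
  exact phaseInt_pos hα (continuousOn_slopeFst hα).neg
    (fun u hu => neg_pos.2 (slopeFst_neg hα hu)) ρ

theorem contDiffAt_logAmplitude (hα : 0 < α) {y : ℝ} (h0 : 0 < y) (hπ : y < Real.pi) :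
    ContDiffAt ℝ 2 (logAmplitude α) y := by
  have h := ContDiffAt.of_leftInverse (n := 2) (by simp)
    (contDiff_periodDefect hα).contDiffAt ((hasDerivAt_periodDefect hα
      (logAmplitude α y)).hasFDerivAt_equiv (neg_phaseInt_slopeFst_pos hα _).ne')
    (g := logAmplitude α) (Filter.Eventually.of_forall (logAmplitude_periodDefect hα))
  rwa [periodDefect_logAmplitude hα h0 hπ] at h

/-- For ρ ≤ 0 one has u ≤ 1, where 1 - `tslope` and -`slopeFst` are comparable to u and |`slopeSnd`|
≲ u. So everything is measured against N = ∫u, and N itself dominates e^(αρ) ∫|sin|^α up to a factor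
2^α. -/
theorem exists_periodDefect_bounds (hα : 0 < α) : ∃ c C : ℝ, 0 < c ∧ 0 < C ∧ ∀ ρ ≤ 0,
    c * periodDefect α ρ ≤ -phaseInt α (slopeFst α) Real.pi ρ ∧
    -phaseInt α (slopeFst α) Real.pi ρ ≤ C * periodDefect α ρ ∧
    |phaseInt α (slopeSnd α) Real.pi ρ| ≤ C * periodDefect α ρ ∧
    Real.exp ρ ^ α ≤ C * periodDefect α ρ := by
  obtain ⟨K, hK, hF⟩ := exists_abs_tslope_le hα
  set c1 := α / (8 * (α + 2)) with hc1
  have hc1p : 0 < c1 := by positivity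
  have hsin : 0 < ∫ θ in (0 : ℝ)..Real.pi, |Real.sin θ| ^ α := by
    refine intervalIntegral.intervalIntegral_pos_of_pos_on ?_ (fun θ hθ => ?_) Real.pi_pos
    · exact ((continuous_abs_rpow hα).comp Real.continuous_sin).intervalIntegrable _ _
    · exact Real.rpow_pos_of_pos (abs_pos.2 (Real.sin_pos_of_pos_of_lt_pi hθ.1 hθ.2).ne') _
  set S := ∫ θ in (0 : ℝ)..Real.pi, |Real.sin θ| ^ α with hS
  refine ⟨α / 16, K / c1 + 2 ^ α / (c1 * S), by positivity, by positivity, fun ρ hρ => ?_⟩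
  have hid : ContinuousOn (fun u : ℝ => u) (Set.Ici 0) := continuousOn_id
  have hv0 : ∀ θ, 0 ≤ phaseVar α θ ρ := fun θ => phaseVar_nonneg _ _
  have hv1 : ∀ θ, phaseVar α θ ρ ≤ 1 := fun θ => phaseVar_le_one hα θ hρ
  set N := phaseInt α (fun u => u) Real.pi ρ with hN
  have hH := periodDefect_pos hα ρ
  have b1 : c1 * N ≤ periodDefect α ρ := by
    rw [periodDefect_eq hα, hN, ← phaseInt_const_mul]
    exact phaseInt_mono hα (by fun_prop) (continuousOn_one_sub_tslope hα) fun θ =>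
      mul_le_one_sub_tslope hα (hv0 θ) (hv1 θ)
  have b2 : periodDefect α ρ ≤ N := by
    rw [periodDefect_eq hα]
    exact phaseInt_mono hα (continuousOn_one_sub_tslope hα) hid fun θ =>
      one_sub_tslope_le hα (hv0 θ)
  have b1' : N ≤ periodDefect α ρ / c1 := by rwa [le_div_iff₀' hc1p]
  have b3 : α / 16 * N ≤ -phaseInt α (slopeFst α) Real.pi ρ := by
    rw [hN, ← phaseInt_const_mul, ← phaseInt_neg]
    exact phaseInt_mono hα (by fun_prop) (continuousOn_slopeFst hα).neg fun θ =>
      mul_le_neg_slopeFst hα (hv0 θ) (hv1 θ)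
  have habs : ∀ {F : ℝ → ℝ}, ContinuousOn F (Set.Ici 0) →
      (∀ u, 0 ≤ u → u ≤ 1 → |F u| ≤ K * u) → |phaseInt α F Real.pi ρ| ≤ K * N := by
    intro F hFc hFb
    rw [hN, ← phaseInt_const_mul, abs_le, ← phaseInt_neg]
    exact ⟨phaseInt_mono hα (by fun_prop) hFc fun θ =>
        (abs_le.1 (hFb _ (hv0 θ) (hv1 θ))).1,
      phaseInt_mono hα hFc (by fun_prop) fun θ => (abs_le.1 (hFb _ (hv0 θ) (hv1 θ))).2⟩
  have b4 := habs (continuousOn_slopeFst hα) fun u h0 h1 => (hF u h0 h1).1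
  have b5 := habs (continuousOn_slopeSnd hα) fun u h0 h1 => (hF u h0 h1).2
  have b6 : Real.exp ρ ^ α * S ≤ 2 ^ α * N := by
    rw [hN, ← phaseInt_const_mul, hS, ← intervalIntegral.integral_const_mul]
    refine intervalIntegral.integral_mono_on Real.pi_pos.le ?_
      (intervalIntegrable_comp_phaseVar hα (F := fun u => 2 ^ α * u) (by fun_prop) ρ _ _)
      fun θ _ => ?_
    · exact (((continuous_abs_rpow hα).comp Real.continuous_sin).const_mul _).intervalIntegrable _ _
    · have h1 : |Real.exp ρ * Real.sin θ| ≤ 1 :=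
        (abs_exp_mul_sin_le ρ θ).trans (Real.exp_le_one_iff.2 hρ)
      have := rpow_abs_le_energyPow hα h1
      rwa [abs_mul, Real.abs_exp, Real.mul_rpow (Real.exp_pos _).le (abs_nonneg _)] at this
  have hKN : K * N ≤ K / c1 * periodDefect α ρ := by
    calc K * N ≤ K * (periodDefect α ρ / c1) := by gcongr
      _ = _ := by ring
  have hKC : K / c1 * periodDefect α ρ ≤ (K / c1 + 2 ^ α / (c1 * S)) * periodDefect α ρ := by
    gcongr
    simp only [le_add_iff_nonneg_right]
    positivity
  refine ⟨?_, ?_, ?_, ?_⟩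
  · refine le_trans ?_ b3
    gcongr
  · exact (neg_le_abs _).trans (b4.trans (hKN.trans hKC))
  · exact b5.trans (hKN.trans hKC)
  · have h1 : Real.exp ρ ^ α ≤ 2 ^ α / (c1 * S) * periodDefect α ρ := by
      have : Real.exp ρ ^ α ≤ 2 ^ α * N / S := by rwa [le_div_iff₀ hsin]
      refine this.trans ?_
      calc 2 ^ α * N / S ≤ 2 ^ α * (periodDefect α ρ / c1) / S := by gcongr
        _ = _ := by field_simp
    refine h1.trans ?_
    gcongr
    simp only [le_add_iff_nonneg_left]
    positivity

end PeriodDefect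

/-! ### From flatness of f to bounds on the log-amplitude r -/

section Amplitude

variable {α : ℝ}

/-- The power of the period defect that is comparable to the amplitude `e^ρ` as `ρ → -∞`. -/
noncomputable def defectRoot (α ρ : ℝ) : ℝ := (2 * periodDefect α ρ) ^ (1 / α)

/-- The derivative of `defectRoot`. -/
noncomputable def defectRootDeriv (α ρ : ℝ) : ℝ :=
  defectRoot α ρ * (1 / α * (-phaseInt α (slopeFst α) Real.pi ρ / periodDefect α ρ))

/-- The second derivative of `defectRoot`. -/
noncomputable def defectRootSnd (α ρ : ℝ) : ℝ :=
  defectRootDeriv α ρ * (1 / α * (-phaseInt α (slopeFst α) Real.pi ρ / periodDefect α ρ)) +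
    defectRoot α ρ * (1 / α * (-phaseInt α (slopeSnd α) Real.pi ρ / periodDefect α ρ -
      (-phaseInt α (slopeFst α) Real.pi ρ / periodDefect α ρ) ^ 2))

theorem defectRoot_pos (hα : 0 < α) (ρ : ℝ) : 0 < defectRoot α ρ :=
  Real.rpow_pos_of_pos (mul_pos two_pos (periodDefect_pos hα ρ)) _

theorem strictMono_defectRoot (hα : 0 < α) : StrictMono (defectRoot α) := fun _ _ h =>
  Real.rpow_lt_rpow (mul_pos two_pos (periodDefect_pos hα _)).le
    (mul_lt_mul_of_pos_left (strictMono_periodDefect hα h) two_pos) (by positivity)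

theorem contDiff_defectRoot (hα : 0 < α) : ContDiff ℝ 2 (defectRoot α) :=
  (contDiff_const.mul (contDiff_periodDefect hα)).rpow_const_of_ne
    fun ρ => (mul_pos two_pos (periodDefect_pos hα ρ)).ne'

theorem hasDerivAt_defectRoot (hα : 0 < α) (ρ : ℝ) :
    HasDerivAt (defectRoot α) (defectRootDeriv α ρ) ρ := by
  have hp := mul_pos two_pos (periodDefect_pos hα ρ)
  have h := ((hasDerivAt_periodDefect hα ρ).const_mul 2).rpow_const (p := 1 / α) (Or.inl hp.ne')
  refine h.congr_deriv ?_
  rw [Real.rpow_sub_one hp.ne', defectRootDeriv, defectRoot]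
  field_simp

theorem hasDerivAt_defectRootDeriv (hα : 0 < α) (ρ : ℝ) :
    HasDerivAt (defectRootDeriv α) (defectRootSnd α ρ) ρ := by
  have hp := periodDefect_pos hα ρ
  have h := (hasDerivAt_defectRoot hα ρ).mul (((hasDerivAt_neg_phaseInt_slopeFst hα ρ).div
    (hasDerivAt_periodDefect hα ρ) hp.ne').const_mul (1 / α))
  refine h.congr_deriv ?_
  rw [defectRootSnd]
  simp only [Pi.div_apply]
  field_simp

/-- The logarithmic derivative of the defect lies between two positive constants for ρ ≤ 0, and
taking the power 1/α preserves this. In this sense `defectRoot` behaves like an exponential, as e^ρ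
does. -/
theorem exists_defectRoot_bounds (hα : 0 < α) : ∃ c C : ℝ, 0 < c ∧ 0 < C ∧ ∀ ρ ≤ 0,
    c * defectRoot α ρ ≤ defectRootDeriv α ρ ∧ |defectRootSnd α ρ| ≤ C * defectRoot α ρ ∧
    Real.exp ρ ≤ C * defectRoot α ρ := by
  obtain ⟨c, C, hc, hC, hb⟩ := exists_periodDefect_bounds hα
  set B := 1 / α * C with hB
  have hB0 : 0 < B := by positivity
  refine ⟨1 / α * c, (B * B + 1 / α * (C + C ^ 2)) + C ^ (1 / α), by positivity, by positivity,
    fun ρ hρ => ?_⟩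
  obtain ⟨h1, h2, h3, h4⟩ := hb ρ hρ
  have hp := periodDefect_pos hα ρ
  have hk := defectRoot_pos hα ρ
  have hj := neg_phaseInt_slopeFst_pos hα ρ
  set H := periodDefect α ρ with hH
  set J := -phaseInt α (slopeFst α) Real.pi ρ with hJ
  have e1 : c ≤ J / H := by rwa [le_div_iff₀ hp]
  have e2 : J / H ≤ C := by rwa [div_le_iff₀ hp]
  have e3 : |-phaseInt α (slopeSnd α) Real.pi ρ / H| ≤ C := by
    rw [abs_div, abs_neg, abs_of_pos hp, div_le_iff₀ hp]
    exact h3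
  have hJH : 0 < J / H := by positivity
  have d1 : defectRootDeriv α ρ = defectRoot α ρ * (1 / α * (J / H)) := rfl
  have d1le : defectRootDeriv α ρ ≤ defectRoot α ρ * B := by
    rw [d1, hB]; gcongr
  have d1nn : 0 ≤ defectRootDeriv α ρ := by rw [d1]; positivity
  refine ⟨?_, ?_, ?_⟩
  · rw [d1, mul_comm]
    gcongr
  · have : |defectRootSnd α ρ| ≤ (B * B + 1 / α * (C + C ^ 2)) * defectRoot α ρ := by
      change |defectRootDeriv α ρ * (1 / α * (J / H)) + defectRoot α ρ *
        (1 / α * (-phaseInt α (slopeSnd α) Real.pi ρ / H - (J / H) ^ 2))| ≤ _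
      refine (abs_add_le _ _).trans ?_
      rw [abs_mul (defectRootDeriv α ρ), abs_mul (defectRoot α ρ),
        abs_of_pos (by positivity : 0 < 1 / α * (J / H)), abs_mul (1 / α), abs_of_nonneg d1nn,
        abs_of_pos hk, abs_of_pos (by positivity : 0 < 1 / α)]
      have e4 : |-phaseInt α (slopeSnd α) Real.pi ρ / H - (J / H) ^ 2| ≤ C + C ^ 2 := by
        refine (abs_sub _ _).trans (add_le_add e3 ?_)
        rw [abs_of_pos (by positivity)]
        gcongr
      calc _ ≤ defectRoot α ρ * B * (1 / α * C) + defectRoot α ρ * (1 / α * (C + C ^ 2)) := by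
            gcongr
        _ = _ := by rw [← hB]; ring
    exact this.trans (mul_le_mul_of_nonneg_right (le_add_of_nonneg_right (by positivity)) hk.le)
  · have h5 : Real.exp ρ ≤ C ^ (1 / α) * defectRoot α ρ := by
      rw [defectRoot, ← Real.mul_rpow hC.le (by positivity)]
      calc Real.exp ρ = (Real.exp ρ ^ α) ^ (1 / α) := by
            rw [← Real.rpow_mul (Real.exp_pos _).le, mul_one_div_cancel hα.ne', Real.rpow_one]
        _ ≤ _ := by
            refine Real.rpow_le_rpow (by positivity) (h4.trans ?_) (by positivity)
            rw [← hH]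
            nlinarith
    refine h5.trans ?_
    gcongr
    simp only [le_add_iff_nonneg_left]
    positivity

theorem fderiv_apply_of_hasDerivAt {k k' : ℝ → ℝ} (h : ∀ ρ, HasDerivAt k (k' ρ) ρ) (ρ a : ℝ) :
    fderiv ℝ k ρ a = a * k' ρ := by
  rw [(h ρ).hasFDerivAt.fderiv]
  simp

theorem fderiv_fderiv_apply_of_hasDerivAt {k k' k'' : ℝ → ℝ} (h : ∀ ρ, HasDerivAt k (k' ρ) ρ)
    (h' : ∀ ρ, HasDerivAt k' (k'' ρ) ρ) (ρ a b : ℝ) :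
    fderiv ℝ (fderiv ℝ k) ρ a b = a * b * k'' ρ := by
  have e : fderiv ℝ k = fun ρ => k' ρ • ContinuousLinearMap.id ℝ ℝ := by
    funext ρ
    ext
    rw [fderiv_apply_of_hasDerivAt h]
    simp
  rw [e, ((h' ρ).hasFDerivAt.smul_const _).fderiv]
  simp
  ring

variable {E : Type*} [NormedAddCommGroup E] [NormedSpace ℝ E]

/-- With k = `defectRoot α`, the chain rules D(k∘r) = k' Dr and D²(k∘r) = k'' Dr⊗Dr + k' D²r are
solved for Dr and D²r, using k' ≥ ck and |k''| ≤ Ck. -/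
theorem exists_norm_fderiv_le_of_defectRoot (hα : 0 < α) : ∃ C : ℝ, 0 < C ∧ ∀ (r : E → ℝ) (x : E),
    ContDiffAt ℝ 2 r x → r x ≤ 0 →
      defectRoot α (r x) * ‖fderiv ℝ r x‖ ≤ C * ‖fderiv ℝ (fun y => defectRoot α (r y)) x‖ ∧
      defectRoot α (r x) * ‖fderiv ℝ (fderiv ℝ r) x‖ ≤
        C * (‖fderiv ℝ (fderiv ℝ fun y => defectRoot α (r y)) x‖ +
          defectRoot α (r x) * ‖fderiv ℝ r x‖ ^ 2) ∧
      Real.exp (r x) ≤ C * defectRoot α (r x) := by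
  obtain ⟨c, C, hc, hC, hb⟩ := exists_defectRoot_bounds hα
  refine ⟨1 / c + C / c + C, by positivity, fun r x hr hrx => ?_⟩
  obtain ⟨h1, h2, h3⟩ := hb _ hrx
  have hk := defectRoot_pos hα (r x)
  have hcr := (contDiff_defectRoot hα).contDiffAt (x := r x)
  have hrd := hr.differentiableAt (by simp)
  have hk' : 0 < defectRootDeriv α (r x) := lt_of_lt_of_le (by positivity) h1
  set k := defectRoot α (r x) with hkdef
  have hCc : 1 / c ≤ 1 / c + C / c + C := by rw [add_assoc]; simp; positivity
  refine ⟨?_, ?_, ?_⟩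
  · have : ‖fderiv ℝ r x‖ ≤ ‖fderiv ℝ (fun y => defectRoot α (r y)) x‖ / (c * k) := by
      refine ContinuousLinearMap.opNorm_le_bound _ (by positivity) fun v => ?_
      rw [div_mul_eq_mul_div, le_div_iff₀ (by positivity)]
      refine le_trans ?_ ((fderiv ℝ (fun y => defectRoot α (r y)) x).le_opNorm v)
      have e : fderiv ℝ (fun y => defectRoot α (r y)) x v =
          fderiv ℝ r x v * defectRootDeriv α (r x) := by
        rw [show (fun y => defectRoot α (r y)) = defectRoot α ∘ r from rfl,
          fderiv_comp x (hcr.differentiableAt (by simp)) hrd, ContinuousLinearMap.comp_apply,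
          fderiv_apply_of_hasDerivAt (hasDerivAt_defectRoot hα)]
      rw [e, norm_mul, Real.norm_of_nonneg hk'.le]
      gcongr
    calc k * ‖fderiv ℝ r x‖ ≤ k * (‖fderiv ℝ (fun y => defectRoot α (r y)) x‖ / (c * k)) := by
          gcongr
      _ = 1 / c * ‖fderiv ℝ (fun y => defectRoot α (r y)) x‖ := by field_simp
      _ ≤ _ := by gcongr
  · set A := ‖fderiv ℝ (fderiv ℝ fun y => defectRoot α (r y)) x‖ with hA
    set D := ‖fderiv ℝ r x‖ with hD
    have : ‖fderiv ℝ (fderiv ℝ r) x‖ ≤ (A + C * k * D ^ 2) / (c * k) := by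
      refine ContinuousLinearMap.opNorm_le_bound₂ _ (by positivity) fun v w => ?_
      rw [div_mul_eq_mul_div, div_mul_eq_mul_div, le_div_iff₀ (by positivity)]
      have e := fderiv_fderiv_comp_apply hcr hr v w
      rw [fderiv_apply_of_hasDerivAt (hasDerivAt_defectRoot hα),
        fderiv_fderiv_apply_of_hasDerivAt (hasDerivAt_defectRoot hα)
          (hasDerivAt_defectRootDeriv hα)] at e
      have f1 := (fderiv ℝ (fderiv ℝ fun y => defectRoot α (r y)) x).le_opNorm₂ v w
      have f2 := (fderiv ℝ r x).le_opNorm v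
      have f3 := (fderiv ℝ r x).le_opNorm w
      have f4 : ‖fderiv ℝ r x v * fderiv ℝ r x w * defectRootSnd α (r x)‖ ≤
          (D * ‖v‖) * (D * ‖w‖) * (C * k) := by
        rw [norm_mul, norm_mul]
        exact mul_le_mul (mul_le_mul f2 f3 (norm_nonneg _) (by positivity)) h2 (norm_nonneg _)
          (by positivity)
      have f5 : fderiv ℝ (fderiv ℝ r) x v w * defectRootDeriv α (r x) =
          fderiv ℝ (fderiv ℝ fun y => defectRoot α (r y)) x v w -
            fderiv ℝ r x v * fderiv ℝ r x w * defectRootSnd α (r x) := by rw [e]; ring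
      calc ‖fderiv ℝ (fderiv ℝ r) x v w‖ * (c * k) ≤
          ‖fderiv ℝ (fderiv ℝ r) x v w‖ * defectRootDeriv α (r x) := by gcongr
        _ = ‖fderiv ℝ (fderiv ℝ r) x v w * defectRootDeriv α (r x)‖ := by
            rw [norm_mul, Real.norm_of_nonneg hk'.le]
        _ ≤ A * ‖v‖ * ‖w‖ + (D * ‖v‖) * (D * ‖w‖) * (C * k) := by
            rw [f5]
            exact (norm_sub_le _ _).trans (add_le_add f1 f4)
        _ = _ := by ring
    calc k * ‖fderiv ℝ (fderiv ℝ r) x‖ ≤ k * ((A + C * k * D ^ 2) / (c * k)) := by gcongr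
      _ = 1 / c * A + C / c * (k * D ^ 2) := by field_simp
      _ ≤ (1 / c + C / c + C) * A + (1 / c + C / c + C) * (k * D ^ 2) := by
          gcongr
          have : 0 < 1 / c := by positivity
          linarith
      _ = _ := by ring
  · refine h3.trans ?_
    gcongr
    simp only [le_add_iff_nonneg_left]
    positivity

/-- If a flat function is a `defectRoot` of `r`, then `r` diverges at the origin so slowly that
`e^r Dr`, `e^r |Dr|²` and `e^r D²r` tend to zero. -/
theorem tendsto_exp_mul_norm_fderiv (hα : 0 < α) {r f : E → ℝ}
    (hr : ∀ x, x ≠ 0 → ContDiffAt ℝ 2 r x) (hf : ∀ x, x ≠ 0 → f x = defectRoot α (r x))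
    (hf0 : 0 ≤ f 0) (h0 : Filter.Tendsto f (𝓝[≠] 0) (𝓝 0))
    (h1 : Filter.Tendsto (fderiv ℝ f) (𝓝[≠] 0) (𝓝 0))
    (h2 : Filter.Tendsto (fun x => ‖fderiv ℝ (fderiv ℝ f) x‖) (𝓝[≠] 0) (𝓝 0)) :
    (∀ᶠ x in 𝓝[≠] (0 : E), r x ≤ 0) ∧
    Filter.Tendsto (fun x => Real.exp (r x)) (𝓝[≠] 0) (𝓝 0) ∧
    Filter.Tendsto (fun x => Real.exp (r x) * ‖fderiv ℝ r x‖ ^ 2) (𝓝[≠] 0) (𝓝 0) ∧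
    Filter.Tendsto (fun x => Real.exp (r x) * ‖fderiv ℝ (fderiv ℝ r) x‖) (𝓝[≠] 0) (𝓝 0) := by
  obtain ⟨C, hC, hb⟩ := exists_norm_fderiv_le_of_defectRoot (α := α) (E := E) hα
  have hne : ∀ᶠ x in 𝓝[≠] (0 : E), x ≠ 0 := self_mem_nhdsWithin
  have hfeq : ∀ x, x ≠ 0 → f =ᶠ[𝓝 x] fun y => defectRoot α (r y) := fun x hx => by
    filter_upwards [isOpen_ne.mem_nhds hx] with y hy using hf y hy
  have hneg : ∀ᶠ x in 𝓝[≠] (0 : E), r x ≤ 0 := by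
    filter_upwards [h0.eventually (gt_mem_nhds (defectRoot_pos hα 0)), hne] with x hx hx0
    rw [hf x hx0] at hx
    exact ((strictMono_defectRoot hα).lt_iff_lt.1 hx).le
  have hnn : ∀ x, 0 ≤ f x := fun x => by
    rcases eq_or_ne x 0 with rfl | hx
    · exact hf0
    · rw [hf x hx]; exact (defectRoot_pos hα _).le
  have hfc : ∀ᶠ x in 𝓝[≠] (0 : E), ContDiffAt ℝ 2 f x := by
    filter_upwards [hne] with x hx
    exact ((contDiff_defectRoot hα).contDiffAt.comp x (hr x hx)).congr_of_eventuallyEq (hfeq x hx)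
  -- The decisive term: f|Dr|² ≲ |Df|²/f, which is small by Landau's inequality. The factor 8C² is
  -- chosen so that the bound becomes ε/2.
  have hsq : Filter.Tendsto (fun x => defectRoot α (r x) * ‖fderiv ℝ r x‖ ^ 2) (𝓝[≠] 0)
      (𝓝 0) := by
    rw [Metric.tendsto_nhds]
    intro ε hε
    have hL := eventually_norm_fderiv_sq_le_punctured hnn hfc h1 h2
      (ε := ε / (8 * C ^ 2)) (by positivity)
    filter_upwards [hL, hne, hneg] with x hx hx0 hrx
    have hk := defectRoot_pos hα (r x)
    obtain ⟨b1, -, -⟩ := hb r x (hr x hx0) hrx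
    rw [← (hfeq x hx0).fderiv_eq] at b1
    rw [Real.dist_0_eq_abs, abs_of_nonneg (by positivity)]
    rw [hf x hx0] at hx
    have b2 : (defectRoot α (r x) * ‖fderiv ℝ r x‖) ^ 2 ≤
        C ^ 2 * (4 * (ε / (8 * C ^ 2)) * defectRoot α (r x)) := by
      calc _ ≤ (C * ‖fderiv ℝ f x‖) ^ 2 := by gcongr
        _ = C ^ 2 * ‖fderiv ℝ f x‖ ^ 2 := by ring
        _ ≤ _ := by gcongr
    have b3 : C ^ 2 * (4 * (ε / (8 * C ^ 2)) * defectRoot α (r x)) =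
        ε / 2 * defectRoot α (r x) := by field_simp; ring
    rw [b3] at b2
    have b4 : defectRoot α (r x) * ‖fderiv ℝ r x‖ ^ 2 ≤ ε / 2 := by
      refine le_of_mul_le_mul_right ?_ hk
      calc _ = (defectRoot α (r x) * ‖fderiv ℝ r x‖) ^ 2 := by ring
        _ ≤ _ := b2
    linarith
  have hE : ∀ᶠ x in 𝓝[≠] (0 : E), Real.exp (r x) ≤ C * defectRoot α (r x) := by
    filter_upwards [hne, hneg] with x hx0 hrx using (hb r x (hr x hx0) hrx).2.2
  refine ⟨hneg, ?_, ?_, ?_⟩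
  · have h := h0.const_mul C
    rw [mul_zero] at h
    refine squeeze_zero' (Filter.Eventually.of_forall fun x => (Real.exp_pos _).le) ?_ h
    filter_upwards [hE, hne] with x hx hx0
    rwa [hf x hx0]
  · have h := hsq.const_mul C
    rw [mul_zero] at h
    refine squeeze_zero' (Filter.Eventually.of_forall fun x => by positivity) ?_ h
    filter_upwards [hE] with x hx
    rw [← mul_assoc]
    gcongr
  · have h := ((h2.add hsq).const_mul C).const_mul C
    rw [add_zero, mul_zero, mul_zero] at h
    refine squeeze_zero' (Filter.Eventually.of_forall fun x => by positivity) ?_ h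
    filter_upwards [hE, hne, hneg] with x hx hx0 hrx
    have b := (hb r x (hr x hx0) hrx).2.1
    rw [← (hfeq x hx0).fderiv.fderiv_eq] at b
    calc _ ≤ C * defectRoot α (r x) * ‖fderiv ℝ (fderiv ℝ r) x‖ := by gcongr
      _ = C * (defectRoot α (r x) * ‖fderiv ℝ (fderiv ℝ r) x‖) := by ring
      _ ≤ _ := by gcongr

end Amplitude

/-! ### Radial gradient fields, vanishing curl and phase shifts -/

section RadialFields

theorem hasFDerivAt_norm_of_ne_zero {E : Type*} [NormedAddCommGroup E] [InnerProductSpace ℝ E]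
    {x : E} (hx : x ≠ 0) : HasFDerivAt (fun y : E => ‖y‖) (innerSL ℝ (unitRadial x)) x := by
  have hpos : 0 < ‖x‖ := norm_pos_iff.2 hx
  have h := (hasStrictFDerivAt_norm_sq x).hasFDerivAt.sqrt (by positivity)
  simp only [Real.sqrt_sq (norm_nonneg _)] at h
  refine h.congr_fderiv ?_
  ext v
  simp [unitRadial]
  field_simp

/-- A continuous radial profile vanishing at the origin times the radial unit vector field is the
gradient of a radial function. -/
theorem IsRadial.exists_hasGradientAt {h : E3 → ℝ} (hr : IsRadial h) (hc : Continuous h)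
    (h0 : h 0 = 0) :
    ∃ Φ : E3 → ℝ, IsRadial Φ ∧ ∀ x : E3, HasGradientAt Φ (h x • unitRadial x) x := by
  set e : E3 := EuclideanSpace.single 0 1 with he
  have hen : ‖e‖ = 1 := by simp [he]
  set g : ℝ → ℝ := fun r => h (r • e) with hg
  have hgc : Continuous g := hc.comp (continuous_id.smul continuous_const)
  have hgn : ∀ x, g ‖x‖ = h x := fun x => hr _ _ (by rw [norm_smul, hen, norm_norm, mul_one])
  have hG : ∀ r, HasDerivAt (fun r => ∫ s in (0 : ℝ)..r, g s) (g r) r := fun r =>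
    intervalIntegral.integral_hasDerivAt_right (hgc.intervalIntegrable _ _)
      hgc.aestronglyMeasurable.stronglyMeasurableAtFilter hgc.continuousAt
  refine ⟨fun x => ∫ s in (0 : ℝ)..‖x‖, g s, fun x y hxy => by simp only [hxy], fun x => ?_⟩
  rw [hasGradientAt_iff_hasFDerivAt]
  rcases eq_or_ne x 0 with rfl | hx
  -- At the origin |x| is not differentiable, but the primitive has derivative g 0 = 0 there, so it
  -- is o(|x|) and the gradient is zero.
  · have hG0 := hG 0
    rw [show g 0 = 0 by simp [hg, h0]] at hG0
    have h1 := hG0.hasFDerivAt.isLittleO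
    refine .of_isLittleO ?_
    have ht : Filter.Tendsto (fun x : E3 => ‖x‖) (𝓝 0) (𝓝 0) := by
      simpa using (continuous_norm (E := E3)).tendsto 0
    have h2 := h1.comp_tendsto ht
    refine Asymptotics.isLittleO_norm_right.1 ?_
    simpa [Function.comp_def, h0] using h2
  · have h1 := (hG ‖x‖).hasFDerivAt.comp x (hasFDerivAt_norm_of_ne_zero hx)
    refine h1.congr_fderiv ?_
    ext v
    simp [hgn]
    ring

/-- Symmetry of the second derivative of the potential; differentiability of `F` at the single point
suffices. -/
theorem curl_eq_zero_of_hasGradientAt {Φ : E3 → ℝ} {F : E3 → E3}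
    (h : ∀ x, HasGradientAt Φ (F x) x) {x : E3} (hF : DifferentiableAt ℝ F x) : curl F x = 0 := by
  have hsymm : ∀ i j, partialD F i j x = partialD F j i x := by
    intro i j
    have h1 : ∀ y, HasFDerivAt Φ (InnerProductSpace.toDual ℝ E3 (F y)) y := fun y =>
      hasGradientAt_iff_hasFDerivAt.1 (h y)
    have h2 := (innerSL ℝ (E := E3)).hasFDerivAt.comp x hF.hasFDerivAt
    have h3 := second_derivative_symmetric (f' := fun y => innerSL ℝ (F y)) (fun y => h1 y) h2
      (EuclideanSpace.single i 1) (EuclideanSpace.single j 1)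
    have h4 : ∀ (v : E3) k, inner ℝ v (EuclideanSpace.single k (1 : ℝ)) = v k := fun v k => by
      simp [EuclideanSpace.inner_single_right]
    rw [partialD, partialD, ← h4, ← h4]
    exact h3.symm
  ext k
  fin_cases k <;> simp [curl, hsymm 2 1, hsymm 0 2, hsymm 1 0]

/-- The time-dependent radial field with profile `h`. -/
noncomputable def radialField (h : E3 → ℝ → ℝ) (x : E3) (t : ℝ) : E3 := h x t • unitRadial x

theorem norm_radialField {h : E3 → ℝ → ℝ} (h0 : ∀ t, h 0 t = 0) (x : E3) (t : ℝ) :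
    ‖radialField h x t‖ = |h x t| := by
  rcases eq_or_ne x 0 with rfl | hx
  · simp [radialField, h0]
  · rw [radialField, norm_smul, norm_unitRadial hx, mul_one, Real.norm_eq_abs]

theorem isRadialGradientField_phaseShift_radialField {h : E3 → ℝ → ℝ}
    (hc : Continuous fun z : E3 × ℝ => h z.1 z.2) (hr : IsRadial h) (h0 : ∀ t, h 0 t = 0)
    {a : E3 → ℝ} (ha : IsRadial a) (hac : Continuous a) :
    IsRadialGradientField (phaseShift (radialField h) a) := by
  intro t
  refine IsRadial.exists_hasGradientAt (h := fun x => h x (t + a x)) (fun x y hxy => ?_) ?_ (h0 _)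
  · simp only [hr x y hxy, ha x y hxy]
  · exact hc.comp (continuous_id.prodMk (continuous_const.add hac))

/-- A radial field whose profile solves the pointwise oscillator equation is a breather, together
with all its radial phase shifts. -/
theorem isBreather_phaseShift_radialField {s q V : E3 → ℝ} {p T δ : ℝ} {h h₁ h₂ : E3 → ℝ → ℝ}
    (hc : Continuous fun z : E3 × ℝ => h z.1 z.2) (hr : IsRadial h) (h0 : ∀ t, h 0 t = 0)
    (hU : ContDiff ℝ 2 fun z : E3 × ℝ => radialField h z.1 z.2)
    (hper : ∀ x, Function.Periodic (h x) T)
    (hloc : BddAbove (Set.range fun z : E3 × ℝ => |h z.1 z.2| * Real.exp (δ * ‖z.1‖)))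
    (hd₁ : ∀ x t, HasDerivAt (h x) (h₁ x t) t) (hd₂ : ∀ x t, HasDerivAt (h₁ x) (h₂ x t) t)
    (hode : ∀ x t, s x * h₂ x t + q x * h x t + V x * |h x t| ^ (p - 1) * h x t = 0)
    (hns : ∃ x t t', radialField h x t ≠ radialField h x t')
    {a : E3 → ℝ} (ha : IsRadial a) (hac : ContDiff ℝ 2 a) :
    IsBreather s q V p T δ (phaseShift (radialField h) a) := by
  have hcd : ContDiff ℝ 2 fun z : E3 × ℝ => phaseShift (radialField h) a z.1 z.2 :=
    hU.comp (contDiff_fst.prodMk (contDiff_snd.add (hac.comp contDiff_fst)))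
  refine ⟨⟨hcd, fun x t => ?_⟩, fun x t => ?_, ?_, ?_⟩
  · obtain ⟨Φ, -, hΦ⟩ := isRadialGradientField_phaseShift_radialField hc hr h0 ha
      hac.continuous t
    -- The shifted field at fixed t is still a radial gradient, whatever the shift, so the phase
    -- gradient leaves no term in the equation.
    have hcurl : curl (fun x' => phaseShift (radialField h) a x' t) = fun _ => 0 := by
      funext y
      refine curl_eq_zero_of_hasGradientAt hΦ ?_
      exact (hcd.comp (contDiff_id.prodMk contDiff_const)).differentiable (by simp) y
    have hcurl0 : curl (fun _ : E3 => (0 : E3)) x = 0 := by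
      ext k
      fin_cases k <;> simp [curl, partialD]
    rw [hcurl, hcurl0, add_zero]
    have e1 : deriv (fun t' => phaseShift (radialField h) a x t') =
        fun t' => h₁ x (t' + a x) • unitRadial x := by
      funext t'
      exact (((hd₁ x (t' + a x)).comp_add_const t' (a x)).smul_const _).deriv
    rw [e1, (((hd₂ x (t + a x)).comp_add_const t (a x)).smul_const _).deriv]
    have e2 : phaseShift (radialField h) a x t = h x (t + a x) • unitRadial x := rfl
    have e3 : ‖phaseShift (radialField h) a x t‖ = |h x (t + a x)| := norm_radialField h0 x _
    rw [e3, e2, smul_smul, smul_smul, smul_smul, ← add_smul, ← add_smul, hode, zero_smul]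
  · change h x (t + T + a x) • unitRadial x = h x (t + a x) • unitRadial x
    rw [add_right_comm, hper x]
  · refine hloc.mono ?_
    rintro _ ⟨z, rfl⟩
    refine ⟨(z.1, z.2 + a z.1), ?_⟩
    change _ = ‖radialField h z.1 (z.2 + a z.1)‖ * _
    rw [norm_radialField h0]
  · obtain ⟨x, t, t', hne⟩ := hns
    refine ⟨x, t - a x, t' - a x, ?_⟩
    simpa [phaseShift] using hne

/-- Constant shifts suffice: at a point where some component of U varies in time, the values at time
0 of the shifted fields fill a nondegenerate interval, by the intermediate value theorem. -/
theorem continuum_le_mk_phaseShift {U : E3 → ℝ → E3}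
    (hU : Continuous fun z : E3 × ℝ => U z.1 z.2) (hns : ∃ x t t', U x t ≠ U x t') :
    𝔠 ≤ #{W : E3 → ℝ → E3 | ∃ a : E3 → ℝ, IsRadial a ∧ ContDiff ℝ 2 a ∧ W = phaseShift U a} := by
  obtain ⟨x, t, t', hne⟩ := hns
  obtain ⟨i, hi⟩ : ∃ i, U x t i ≠ U x t' i := by
    by_contra! hcon
    exact hne (PiLp.ext hcon)
  set S := {W : E3 → ℝ → E3 | ∃ a : E3 → ℝ, IsRadial a ∧ ContDiff ℝ 2 a ∧ W = phaseShift U a}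
  set g : ℝ → ℝ := fun c => U x c i with hg
  have hgc : Continuous g :=
    (EuclideanSpace.proj (𝕜 := ℝ) i).continuous.comp (hU.comp (Continuous.prodMk_right x))
  have hsub : Set.Icc (min (g t) (g t')) (max (g t) (g t')) ⊆
      (fun W : E3 → ℝ → E3 => W x 0 i) '' S := by
    intro y hy
    obtain ⟨c, -, hc⟩ := intermediate_value_uIcc (a := t) (b := t') hgc.continuousOn hy
    refine ⟨phaseShift U fun _ => c, ⟨fun _ => c, fun _ _ _ => rfl, contDiff_const, rfl⟩, ?_⟩
    simp only [phaseShift, zero_add]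
    exact hc
  calc 𝔠 = #(Set.Icc (min (g t) (g t')) (max (g t) (g t'))) :=
        (Cardinal.mk_Icc_real (min_lt_max.2 hi)).symm
    _ ≤ #((fun W : E3 → ℝ → E3 => W x 0 i) '' S) := Cardinal.mk_le_mk_of_subset hsub
    _ ≤ #S := Cardinal.mk_image_le

end RadialFields

/-! ### Flatness of the space-dependent oscillation at the axis -/

section OrbitField

theorem fderiv_fderiv_fst_eq_zero {E F : Type*} [NormedAddCommGroup E] [NormedSpace ℝ E]
    [NormedAddCommGroup F] [NormedSpace ℝ F] (z : E × F) :
    fderiv ℝ (fderiv ℝ (Prod.fst : E × F → E)) z = 0 := by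
  rw [show fderiv ℝ (Prod.fst : E × F → E) = fun _ => ContinuousLinearMap.fst ℝ E F from
    funext fun _ => fderiv_fst]
  exact fderiv_const_apply _

theorem fderiv_fderiv_snd_eq_zero {E F : Type*} [NormedAddCommGroup E] [NormedSpace ℝ E]
    [NormedAddCommGroup F] [NormedSpace ℝ F] (z : E × F) :
    fderiv ℝ (fderiv ℝ (Prod.snd : E × F → F)) z = 0 := by
  rw [show fderiv ℝ (Prod.snd : E × F → F) = fun _ => ContinuousLinearMap.snd ℝ E F from
    funext fun _ => fderiv_snd]
  exact fderiv_const_apply _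

theorem tendsto_fst_nhdsOffAxis {E : Type*} [NormedAddCommGroup E] (t : ℝ) :
    Filter.Tendsto (Prod.fst : E × ℝ → E) (nhdsOffAxis E t) (𝓝[≠] 0) :=
  tendsto_nhdsWithin_iff.2 ⟨(continuous_fst.tendsto ((0 : E), t)).mono_left nhdsWithin_le_nhds,
    self_mem_nhdsWithin⟩

variable {E G : Type*} [NormedAddCommGroup E] [NormedSpace ℝ E] [NormedAddCommGroup G]
  [NormedSpace ℝ G]

theorem norm_fderiv_comp_fst_le {n : E → G} {z : E × ℝ} (hn : DifferentiableAt ℝ n z.1) :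
    ‖fderiv ℝ (fun z : E × ℝ => n z.1) z‖ ≤ ‖fderiv ℝ n z.1‖ := by
  refine (norm_fderiv_comp_le hn differentiableAt_fst).trans ?_
  rw [fderiv_fst]
  exact mul_le_of_le_one_right (norm_nonneg _) (ContinuousLinearMap.norm_fst_le ℝ E ℝ)

theorem norm_fderiv_fderiv_comp_fst_le {n : E → G} {z : E × ℝ} (hn : ContDiffAt ℝ 2 n z.1) :
    ‖fderiv ℝ (fderiv ℝ fun z : E × ℝ => n z.1) z‖ ≤ ‖fderiv ℝ (fderiv ℝ n) z.1‖ := by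
  refine (norm_fderiv_fderiv_comp_le hn contDiffAt_fst).trans ?_
  rw [fderiv_fderiv_fst_eq_zero, norm_zero, mul_zero, add_zero, fderiv_fst]
  exact mul_le_of_le_one_right (norm_nonneg _)
    (pow_le_one₀ (norm_nonneg _) (ContinuousLinearMap.norm_fst_le ℝ E ℝ))

theorem norm_fderiv_prodMk_le {a b : G → ℝ} {z : G} (ha : DifferentiableAt ℝ a z)
    (hb : DifferentiableAt ℝ b z) :
    ‖fderiv ℝ (fun z => (a z, b z)) z‖ ≤ ‖fderiv ℝ a z‖ + ‖fderiv ℝ b z‖ := by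
  rw [(ha.hasFDerivAt.prodMk hb.hasFDerivAt).fderiv, ContinuousLinearMap.opNorm_prod]
  exact max_le (le_add_of_nonneg_right (norm_nonneg _)) (le_add_of_nonneg_left (norm_nonneg _))

theorem norm_fderiv_fderiv_prodMk_le {a b : G → ℝ} {z : G} (ha : ContDiffAt ℝ 2 a z)
    (hb : ContDiffAt ℝ 2 b z) :
    ‖fderiv ℝ (fderiv ℝ fun z => (a z, b z)) z‖ ≤
      ‖fderiv ℝ (fderiv ℝ a) z‖ + ‖fderiv ℝ (fderiv ℝ b) z‖ := by
  refine ContinuousLinearMap.opNorm_le_bound₂ _ (by positivity) fun v w => ?_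
  have h1 := fderiv_fderiv_comp_apply (g := (Prod.fst : ℝ × ℝ → ℝ)) contDiffAt_fst
    (ha.prodMk hb) v w
  have h2 := fderiv_fderiv_comp_apply (g := (Prod.snd : ℝ × ℝ → ℝ)) contDiffAt_snd
    (ha.prodMk hb) v w
  rw [fderiv_fderiv_fst_eq_zero, fderiv_fst] at h1
  rw [fderiv_fderiv_snd_eq_zero, fderiv_snd] at h2
  simp only [zero_apply, zero_add, ContinuousLinearMap.coe_fst', ContinuousLinearMap.coe_snd']
    at h1 h2
  have h3 := (fderiv ℝ (fderiv ℝ a) z).le_opNorm₂ v w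
  have h4 := (fderiv ℝ (fderiv ℝ b) z).le_opNorm₂ v w
  rw [h1] at h3
  rw [h2] at h4
  rw [Prod.norm_def]
  refine max_le (h3.trans ?_) (h4.trans ?_) <;> gcongr
  · exact le_add_of_nonneg_right (norm_nonneg _)
  · exact le_add_of_nonneg_left (norm_nonneg _)

open Classical in
/-- The oscillation `z(ω(x) t; r(x))` at each point `x ≠ 0`, and zero at the origin. -/
noncomputable def orbitField (α : ℝ) (ω r : E → ℝ) (z : E × ℝ) : ℝ :=
  if z.1 = 0 then 0 else orbit α (ω z.1 * z.2, r z.1)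

/-- The field is the orbit composed with Ψ = (ωt, r). The outer derivatives are O(e^r) and the ωt
part of Ψ is locally bounded, so only e^r|Dr|² and e^r|D²r| must be controlled. -/
theorem orbitField_flat {α : ℝ} (hα : 0 < α) {ω r : E → ℝ} (hω : ContDiff ℝ 2 ω)
    (hr : ∀ x, x ≠ 0 → ContDiffAt ℝ 2 r x) (hr0 : ∀ᶠ x in 𝓝[≠] (0 : E), r x ≤ 0)
    (h0 : Filter.Tendsto (fun x => Real.exp (r x)) (𝓝[≠] 0) (𝓝 0))
    (h1 : Filter.Tendsto (fun x => Real.exp (r x) * ‖fderiv ℝ r x‖ ^ 2) (𝓝[≠] 0) (𝓝 0))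
    (h2 : Filter.Tendsto (fun x => Real.exp (r x) * ‖fderiv ℝ (fderiv ℝ r) x‖) (𝓝[≠] 0) (𝓝 0)) :
    (∀ z, z.1 ≠ 0 → ContDiffAt ℝ 2 (orbitField α ω r) z) ∧
    (∀ t, Filter.Tendsto (fun z => ‖orbitField α ω r z‖) (nhdsOffAxis E t) (𝓝 0)) ∧
    (∀ t, Filter.Tendsto (fun z => ‖fderiv ℝ (orbitField α ω r) z‖) (nhdsOffAxis E t) (𝓝 0)) ∧
    (∀ t, Filter.Tendsto (fun z => ‖fderiv ℝ (fderiv ℝ (orbitField α ω r)) z‖)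
      (nhdsOffAxis E t) (𝓝 0)) := by
  set a : E × ℝ → ℝ := fun z => ω z.1 * z.2 with ha
  set b : E × ℝ → ℝ := fun z => r z.1 with hb
  have hac : ContDiff ℝ 2 a := (hω.comp contDiff_fst).mul contDiff_snd
  have hbc : ∀ z : E × ℝ, z.1 ≠ 0 → ContDiffAt ℝ 2 b z := fun z hz =>
    (hr _ hz).comp z contDiffAt_fst
  set Ψ : E × ℝ → ℝ × ℝ := fun z => (a z, b z) with hΨ
  have hΨc : ∀ z : E × ℝ, z.1 ≠ 0 → ContDiffAt ℝ 2 Ψ z := fun z hz =>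
    hac.contDiffAt.prodMk (hbc z hz)
  have heq : ∀ z : E × ℝ, z.1 ≠ 0 → orbitField α ω r =ᶠ[𝓝 z] fun z => orbit α (Ψ z) := by
    intro z hz
    have : {z : E × ℝ | z.1 ≠ 0} ∈ 𝓝 z :=
      (isOpen_ne_fun continuous_fst continuous_const).mem_nhds hz
    filter_upwards [this] with y hy
    exact if_neg hy
  have hO := contDiff_orbit hα
  have hoff : ∀ t, ∀ᶠ z in nhdsOffAxis E t, z.1 ≠ 0 := fun t => self_mem_nhdsWithin
  have k0 := fun t => h0.comp (tendsto_fst_nhdsOffAxis (E := E) t)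
  have k1 := fun t => h1.comp (tendsto_fst_nhdsOffAxis (E := E) t)
  have k2 := fun t => h2.comp (tendsto_fst_nhdsOffAxis (E := E) t)
  have kr := fun t => (tendsto_fst_nhdsOffAxis (E := E) t).eventually hr0
  have hle : ∀ t, nhdsOffAxis E t ≤ 𝓝 ((0 : E), t) := fun t => nhdsWithin_le_nhds
  -- local bounds
  have hbound : ∀ t, ∃ C K : ℝ, 0 ≤ C ∧ 0 ≤ K ∧ ∀ᶠ z in nhdsOffAxis E t,
      ‖fderiv ℝ (orbitField α ω r) z‖ ≤ C * Real.exp (r z.1) * ‖fderiv ℝ Ψ z‖ ∧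
      ‖fderiv ℝ (fderiv ℝ (orbitField α ω r)) z‖ ≤
        C * Real.exp (r z.1) * (‖fderiv ℝ Ψ z‖ ^ 2 + ‖fderiv ℝ (fderiv ℝ Ψ) z‖) ∧
      ‖fderiv ℝ Ψ z‖ ≤ K + ‖fderiv ℝ r z.1‖ ∧
      ‖fderiv ℝ (fderiv ℝ Ψ) z‖ ≤ K + ‖fderiv ℝ (fderiv ℝ r) z.1‖ := by
    intro t
    obtain ⟨C, hC, hCb⟩ := exists_norm_fderiv_orbit_le hα (|a (0, t)| + 1)
    set K := max (‖fderiv ℝ a (0, t)‖ + 1) (‖fderiv ℝ (fderiv ℝ a) (0, t)‖ + 1) with hK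
    have ca : ∀ᶠ z in nhdsOffAxis E t, |a z| < |a (0, t)| + 1 := by
      refine hle t ?_
      exact (hac.continuous.abs.tendsto (0, t)).eventually (gt_mem_nhds (by linarith))
    have c1 : ∀ᶠ z in nhdsOffAxis E t, ‖fderiv ℝ a z‖ < ‖fderiv ℝ a (0, t)‖ + 1 := by
      refine hle t ?_
      have := (hac.fderiv_right (m := 1) (by norm_num)).continuous.norm.tendsto (0, t)
      exact this.eventually (gt_mem_nhds (by linarith))
    have c2 : ∀ᶠ z in nhdsOffAxis E t,
        ‖fderiv ℝ (fderiv ℝ a) z‖ < ‖fderiv ℝ (fderiv ℝ a) (0, t)‖ + 1 := by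
      refine hle t ?_
      have := ((hac.fderiv_right (m := 1) (by norm_num)).fderiv_right (m := 0)
        (by norm_num)).continuous.norm.tendsto (0, t)
      exact this.eventually (gt_mem_nhds (by linarith))
    refine ⟨C, K, hC.le, le_trans (by positivity) (le_max_left _ _), ?_⟩
    filter_upwards [ca, c1, c2, hoff t, kr t] with z ca c1 c2 hz hrz
    obtain ⟨e1, e2⟩ := hCb (Ψ z) ca.le hrz
    refine ⟨?_, ?_, ?_, ?_⟩
    · rw [(heq z hz).fderiv_eq]
      refine (norm_fderiv_comp_le (hO.differentiable (by simp) _)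
        ((hΨc z hz).differentiableAt (by simp))).trans ?_
      gcongr
    · rw [(heq z hz).fderiv.fderiv_eq]
      refine (norm_fderiv_fderiv_comp_le hO.contDiffAt (hΨc z hz)).trans ?_
      rw [mul_add]
      gcongr
    · refine (norm_fderiv_prodMk_le (hac.differentiable (by simp) z)
        ((hbc z hz).differentiableAt (by simp))).trans (add_le_add ?_ ?_)
      · exact c1.le.trans (le_max_left _ _)
      · exact norm_fderiv_comp_fst_le ((hr _ hz).differentiableAt (by simp))
    · refine (norm_fderiv_fderiv_prodMk_le hac.contDiffAt (hbc z hz)).trans (add_le_add ?_ ?_)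
      · exact c2.le.trans (le_max_right _ _)
      · exact norm_fderiv_fderiv_comp_fst_le (hr _ hz)
  refine ⟨fun z hz => (hO.contDiffAt.comp z (hΨc z hz)).congr_of_eventuallyEq (heq z hz),
    fun t => ?_, fun t => ?_, fun t => ?_⟩
  · refine squeeze_zero' (Filter.Eventually.of_forall fun z => norm_nonneg _) ?_ (k0 t)
    filter_upwards [hoff t] with z hz
    rw [(heq z hz).eq_of_nhds]
    exact abs_orbit_le hα _
  · obtain ⟨C, K, hC, hK, hb⟩ := hbound t
    have hlim := (((k0 t).const_mul (K + 1)).add (k1 t)).const_mul C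
    rw [mul_zero, add_zero, mul_zero] at hlim
    refine squeeze_zero' (Filter.Eventually.of_forall fun z => norm_nonneg _) ?_ hlim
    filter_upwards [hb] with z hb
    refine hb.1.trans ?_
    simp only [Function.comp]
    calc C * Real.exp (r z.1) * ‖fderiv ℝ Ψ z‖ ≤
          C * Real.exp (r z.1) * (K + 1 + ‖fderiv ℝ r z.1‖ ^ 2) := by
          gcongr
          -- Uses |Dr| ≤ 1 + |Dr|², so no separate hypothesis on e^r|Dr| is needed.
          nlinarith [hb.2.2.1, sq_nonneg (‖fderiv ℝ r z.1‖ - 1), norm_nonneg (fderiv ℝ r z.1)]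
      _ = _ := by ring
  · obtain ⟨C, K, hC, hK, hb⟩ := hbound t
    have hlim := ((((k0 t).const_mul (2 * K ^ 2 + K)).add ((k1 t).const_mul 2)).add
      (k2 t)).const_mul C
    simp only [mul_zero, add_zero] at hlim
    refine squeeze_zero' (Filter.Eventually.of_forall fun z => by positivity) ?_ hlim
    filter_upwards [hb] with z hb
    refine hb.2.1.trans ?_
    simp only [Function.comp]
    calc _ ≤ C * Real.exp (r z.1) * ((K + ‖fderiv ℝ r z.1‖) ^ 2 +
          (K + ‖fderiv ℝ (fderiv ℝ r) z.1‖)) := by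
          gcongr
          · exact hb.2.2.1
          · exact hb.2.2.2
      _ ≤ C * Real.exp (r z.1) * ((2 * K ^ 2 + 2 * ‖fderiv ℝ r z.1‖ ^ 2) +
          (K + ‖fderiv ℝ (fderiv ℝ r) z.1‖)) := by
          gcongr
          nlinarith [sq_nonneg (K - ‖fderiv ℝ r z.1‖)]
      _ = _ := by ring

end OrbitField

/-! ### Exponential localization of the amplitude -/

section Breather

theorem TendstoZeroC2.tendsto_norm_fderiv_fderiv {f : E3 → ℝ} (h : TendstoZeroC2 f) :
    Filter.Tendsto (fun x => ‖fderiv ℝ (fderiv ℝ f) x‖) (𝓝[≠] 0) (𝓝 0) :=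
  (tendsto_zero_iff_norm_tendsto_zero (E := E3 →L[ℝ] E3 →L[ℝ] ℝ)).1 h.tendsto_fderiv_fderiv

/-- A function with superlevel sets compact away from the origin controls the amplitude. -/
theorem bddAbove_exp_mul_exp {E : Type*} [NormedAddCommGroup E] [NormedSpace ℝ E]
    [FiniteDimensional ℝ E] {α δ : ℝ} (hα : 0 < α) (hδ : 0 < δ) {r f : E → ℝ}
    (hr : ∀ x, x ≠ 0 → ContinuousAt r x) (hf : ∀ x, x ≠ 0 → f x = defectRoot α (r x))
    (hf0 : f 0 = 0) (hfc : Continuous f) {M : ℝ} (hM : ∀ x, f x * Real.exp (δ * ‖x‖) ≤ M) :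
    ∃ B : ℝ, ∀ x, x ≠ 0 → Real.exp (r x) * Real.exp (δ * ‖x‖) ≤ B := by
  obtain ⟨c, C, hc, hC, hb⟩ := exists_defectRoot_bounds hα
  -- The threshold k corresponds to r = 0. Where r ≤ 0 the comparison e^r ≲ f applies; the rest lies
  -- in {f ≥ k}, which is bounded by the decay of f and avoids the origin, so r is bounded on it.
  set k := defectRoot α 0 with hk
  have hk0 : 0 < k := defectRoot_pos hα 0
  have hexp : ∀ x, k ≤ f x → Real.exp (δ * ‖x‖) ≤ M / k := fun x hx => by
    rw [le_div_iff₀' hk0]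
    refine le_trans ?_ (hM x)
    gcongr
  have hA : IsCompact {x | k ≤ f x} := by
    refine Metric.isCompact_of_isClosed_isBounded (isClosed_le continuous_const hfc) ?_
    refine (Metric.isBounded_closedBall (x := (0 : E)) (r := M / k / δ)).subset fun x hx => ?_
    rw [mem_closedBall_zero_iff, le_div_iff₀' hδ]
    have := Real.add_one_le_exp (δ * ‖x‖)
    linarith [hexp x hx]
  have hAne : ∀ x ∈ {x | k ≤ f x}, x ≠ 0 := by
    rintro x hx rfl
    have hx : k ≤ f 0 := hx
    linarith
  obtain ⟨R, hR⟩ := hA.exists_bound_of_continuousOn (f := r)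
    fun x hx => (hr x (hAne x hx)).continuousWithinAt
  refine ⟨max (C * M) (Real.exp R * (M / k)), fun x hx => ?_⟩
  rcases le_total (r x) 0 with hrx | hrx
  · refine le_trans ?_ (le_max_left _ _)
    calc _ ≤ C * defectRoot α (r x) * Real.exp (δ * ‖x‖) := by
          gcongr
          exact (hb _ hrx).2.2
      _ = C * (f x * Real.exp (δ * ‖x‖)) := by rw [hf x hx]; ring
      _ ≤ _ := by gcongr; exact hM x
  · refine le_trans ?_ (le_max_right _ _)
    have hkx : k ≤ f x := by
      rw [hf x hx]
      exact (strictMono_defectRoot hα).monotone hrx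
    gcongr
    · exact (le_abs_self _).trans (hR x hkx)
    · exact hexp x hkx

end Breather

/-! ### Assembly of the breather -/

theorem theorem1 (p : ℝ) (hp : 1 < p) (s q V : E3 → ℝ)
    (hs_pos : ∀ x, 0 < s x) (hq_pos : ∀ x, 0 < q x) (hV_pos : ∀ x, 0 < V x)
    (hs_rad : IsRadial s) (hq_rad : IsRadial q) (hV_rad : IsRadial V)
    (hs : ContDiff ℝ 2 s) (hq : ContDiff ℝ 2 q) (hV : ContDiff ℝ 2 V)
    (T : ℝ) (hT : T = 2 * Real.pi * √(s 0 / q 0))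
    (H1 : ∀ x : E3, x ≠ 0 → T * √(q x / s x) < 2 * Real.pi)
    (H2 : TendstoZeroC2 fun x => |2 * Real.pi - T * √(q x / s x)| ^ (1 / (p - 1)))
    (δ : ℝ) (hδ : 0 < δ)
    (H3 : BddAbove (Set.range fun x : E3 =>
      |2 * Real.pi - T * √(q x / s x)| * Real.exp (δ * (p - 1) * ‖x‖)))
    (H4 : BddAbove (Set.range fun x : E3 => q x / V x)) :
    ∃ U : E3 → ℝ → E3,
      IsBreather s q V p T δ U ∧ IsRadialGradientField U ∧
      (∀ a : E3 → ℝ, IsRadial a → ContDiff ℝ 2 a →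
        IsBreather s q V p T δ (phaseShift U a) ∧ IsRadialGradientField (phaseShift U a)) ∧
      𝔠 ≤ #{W : E3 → ℝ → E3 | ∃ a : E3 → ℝ, IsRadial a ∧ ContDiff ℝ 2 a ∧ W = phaseShift U a} := by
  obtain ⟨α, hα, rfl⟩ : ∃ α, 0 < α ∧ p = α + 1 := ⟨p - 1, by linarith, by ring⟩
  simp only [add_sub_cancel_right] at H2 H3
  set ω : E3 → ℝ := fun x => √(q x / s x) with hω
  set κ : E3 → ℝ := fun x => (q x / V x) ^ (1 / α) with hκ
  set f : E3 → ℝ := fun x => |2 * Real.pi - T * ω x| ^ (1 / α) with hf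
  -- The half period of the orbit at x must be Tω(x)/2, so its defect is π - Tω(x)/2. At x = 0 this
  -- is 0, which is not a defect; `r 0` is a default value and is never used.
  set r : E3 → ℝ := fun x => logAmplitude α (Real.pi - T * ω x / 2) with hr
  have hqs : ∀ x, 0 < q x / s x := fun x => div_pos (hq_pos x) (hs_pos x)
  have hqV : ∀ x, 0 < q x / V x := fun x => div_pos (hq_pos x) (hV_pos x)
  have hωpos : ∀ x, 0 < ω x := fun x => Real.sqrt_pos.2 (hqs x)
  have hTpos : 0 < T := by
    have := hs_pos 0
    have := hq_pos 0
    rw [hT]; positivity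
  have hωc : ContDiff ℝ 2 ω := (hq.div hs fun x => (hs_pos x).ne').sqrt fun x => (hqs x).ne'
  have hκc : ContDiff ℝ 2 κ :=
    (hq.div hV fun x => (hV_pos x).ne').rpow_const_of_ne fun x => (hqV x).ne'
  have hTω0 : T * ω 0 = 2 * Real.pi := by
    have h0 := (hs_pos 0).ne'
    have h1 := (hq_pos 0).ne'
    rw [hT, mul_assoc, hω, ← Real.sqrt_mul (div_pos (hs_pos 0) (hq_pos 0)).le,
      div_mul_div_cancel₀ h1, div_self h0, Real.sqrt_one, mul_one]
  have hy0 : ∀ x, x ≠ 0 → 0 < Real.pi - T * ω x / 2 := fun x hx => by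
    have : T * ω x < 2 * Real.pi := H1 x hx
    linarith
  have hyπ : ∀ x, Real.pi - T * ω x / 2 < Real.pi := fun x => by
    have := mul_pos hTpos (hωpos x)
    linarith
  have hrd : ∀ x, x ≠ 0 → periodDefect α (r x) = Real.pi - T * ω x / 2 := fun x hx =>
    periodDefect_logAmplitude hα (hy0 x hx) (hyπ x)
  have hrc : ∀ x, x ≠ 0 → ContDiffAt ℝ 2 r x := fun x hx =>
    (contDiffAt_logAmplitude hα (hy0 x hx) (hyπ x)).comp x
      (contDiff_const.sub ((contDiff_const.mul hωc).div_const 2)).contDiffAt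
  -- The factor 2 in `defectRoot` is what makes the function of (H2) exactly `defectRoot α (r x)`.
  have hfr : ∀ x, x ≠ 0 → f x = defectRoot α (r x) := fun x hx => by
    have h1 := hy0 x hx
    have h2 : 2 * (Real.pi - T * ω x / 2) = 2 * Real.pi - T * ω x := by ring
    simp only [hf]
    rw [defectRoot, hrd x hx, h2, abs_of_pos (by linarith)]
  have hf0 : f 0 = 0 := by
    simp only [hf]
    rw [hTω0, sub_self, abs_zero, Real.zero_rpow (by positivity)]
  have hfc : Continuous f := by
    refine Continuous.rpow_const ?_ fun _ => Or.inr (by positivity)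
    exact (continuous_const.sub (continuous_const.mul hωc.continuous)).abs
  -- the profile
  obtain ⟨hneg, e0, e1, e2⟩ := tendsto_exp_mul_norm_fderiv hα hrc hfr hf0.ge H2.tendsto
    H2.tendsto_fderiv H2.tendsto_norm_fderiv_fderiv
  obtain ⟨y0, y1, y2, y3⟩ := orbitField_flat hα hωc hrc hneg e0 e1 e2
  set y := orbitField α ω r with hy
  have hyz : ∀ t, y (0, t) = 0 := fun t => if_pos rfl
  have hyne : ∀ x t, x ≠ 0 → y (x, t) = orbit α (ω x * t, r x) := fun x t hx => if_neg hx
  have hyc : ContDiff ℝ 2 y := contDiff_two_of_tendsto_nhdsOffAxis y0 hyz y1 y2 y3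
  obtain ⟨Cn, hCn, hn⟩ := exists_norm_fderiv_unitRadial_le (E := E3)
  have hyn : ContDiff ℝ 2 fun z : E3 × ℝ => y z • unitRadial z.1 :=
    contDiff_two_smul_of_tendsto_nhdsOffAxis hCn (fun x hx => contDiffAt_unitRadial hx)
      (by simp [unitRadial]) norm_unitRadial_le (fun x hx => (hn x hx).1) (fun x hx => (hn x hx).2)
      y0 y1 y2 y3
  set h : E3 → ℝ → ℝ := fun x t => κ x * y (x, t) with hh
  have hc : Continuous fun z : E3 × ℝ => h z.1 z.2 :=
    (hκc.continuous.comp continuous_fst).mul hyc.continuous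
  have h0 : ∀ t, h 0 t = 0 := fun t => by simp only [hh, hyz, mul_zero]
  have hrad : IsRadial h := fun x x' hxx => by
    funext t
    have hω' : ω x = ω x' := by simp only [hω, hq_rad x x' hxx, hs_rad x x' hxx]
    have hκ' : κ x = κ x' := by simp only [hκ, hq_rad x x' hxx, hV_rad x x' hxx]
    have hr' : r x = r x' := by simp only [hr, hω']
    rcases eq_or_ne x 0 with rfl | hx
    · have : x' = 0 := by
        rw [norm_zero] at hxx
        exact norm_eq_zero.1 hxx.symm
      rw [this]
    · have hx' : x' ≠ 0 := by
        rw [← norm_ne_zero_iff, ← hxx]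
        exact norm_ne_zero_iff.2 hx
      simp only [hh, hyne x t hx, hyne x' t hx', hω', hκ', hr']
  have hU : ContDiff ℝ 2 fun z : E3 × ℝ => radialField h z.1 z.2 := by
    have : (fun z : E3 × ℝ => radialField h z.1 z.2) =
        fun z => κ z.1 • (y z • unitRadial z.1) := by
      funext z
      rw [smul_smul]
      rfl
    rw [this]
    exact (hκc.comp contDiff_fst).smul hyn
  have hper : ∀ x, Function.Periodic (h x) T := fun x t => by
    rcases eq_or_ne x 0 with rfl | hx
    · rw [h0, h0]
    · have hP : ω x * (t + T) = ω x * t + 2 * phaseInt α (tslope α) Real.pi (r x) := by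
        have := hrd x hx
        rw [periodDefect] at this
        linear_combination 2 * this
      simp only [hh, hyne x _ hx, hP, orbit_periodic hα]
  have hκpos : ∀ x, 0 < κ x := fun x => Real.rpow_pos_of_pos (hqV x) _
  have hloc : BddAbove (Set.range fun z : E3 × ℝ => |h z.1 z.2| * Real.exp (δ * ‖z.1‖)) := by
    obtain ⟨M, hM⟩ := H3
    obtain ⟨Q, hQ⟩ := H4
    have hM' : ∀ x, f x * Real.exp (δ * ‖x‖) ≤ M ^ (1 / α) := fun x => by
      have h1 : |2 * Real.pi - T * ω x| * Real.exp (δ * α * ‖x‖) ≤ M := hM ⟨x, rfl⟩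
      -- The rate δα of (H3) becomes δ after the power 1/α.
      have h2 : Real.exp (δ * ‖x‖) = Real.exp (δ * α * ‖x‖) ^ (1 / α) := by
        rw [← Real.exp_mul]
        congr 1
        field_simp
      rw [h2, hf, ← Real.mul_rpow (abs_nonneg _) (Real.exp_pos _).le]
      exact Real.rpow_le_rpow (by positivity) h1 (by positivity)
    obtain ⟨B, hB⟩ := bddAbove_exp_mul_exp hα hδ (fun x hx => (hrc x hx).continuousAt) hfr hf0
      hfc hM'
    refine ⟨Q ^ (1 / α) * max B 0, ?_⟩
    rintro _ ⟨⟨x, t⟩, rfl⟩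
    have hQ0 : 0 ≤ Q := (hqV x).le.trans (hQ ⟨x, rfl⟩)
    rcases eq_or_ne x 0 with rfl | hx
    · simp only [h0, abs_zero, zero_mul]
      positivity
    · have hκQ : κ x ≤ Q ^ (1 / α) :=
        Real.rpow_le_rpow (hqV x).le (hQ ⟨x, rfl⟩) (by positivity)
      simp only [hh, abs_mul, abs_of_pos (hκpos x), hyne x t hx, mul_assoc]
      refine mul_le_mul hκQ ?_ (by positivity) (by positivity)
      refine le_trans ?_ ((hB x hx).trans (le_max_left _ _))
      gcongr
      exact abs_orbit_le hα _
  classical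
  -- The time derivatives are set to zero at the origin by cases, since the orbit formula there
  -- would use the default value of r.
  set h₁ : E3 → ℝ → ℝ := fun x t =>
    if x = 0 then 0 else κ x * (orbitVelocity α (ω x * t, r x) * ω x) with hh₁
  set h₂ : E3 → ℝ → ℝ := fun x t => if x = 0 then 0 else
    κ x * (-(orbit α (ω x * t, r x) * (1 + |orbit α (ω x * t, r x)| ^ α)) * ω x * ω x) with hh₂
  have hlin : ∀ x t, HasDerivAt (fun t => ω x * t) (ω x) t := fun x t => by
    simpa using (hasDerivAt_id t).const_mul (ω x)
  have hd₁ : ∀ x t, HasDerivAt (h x) (h₁ x t) t := fun x t => by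
    rcases eq_or_ne x 0 with rfl | hx
    · rw [show h 0 = fun _ => 0 from funext h0]
      simpa [hh₁] using hasDerivAt_const t (0 : ℝ)
    · rw [show h x = fun t => κ x * orbit α (ω x * t, r x) from
        funext fun t => by simp only [hh, hyne x t hx]]
      simp only [hh₁, if_neg hx]
      exact ((hasDerivAt_orbit hα (ω x * t) (r x)).comp t (hlin x t)).const_mul (κ x)
  have hd₂ : ∀ x t, HasDerivAt (h₁ x) (h₂ x t) t := fun x t => by
    rcases eq_or_ne x 0 with rfl | hx
    · simpa [hh₁, hh₂] using hasDerivAt_const t (0 : ℝ)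
    · simp only [hh₁, hh₂, if_neg hx]
      exact (((hasDerivAt_orbitVelocity hα (ω x * t) (r x)).comp t
        (hlin x t)).mul_const (ω x)).const_mul (κ x)
  have hode : ∀ x t, s x * h₂ x t + q x * h x t + V x * |h x t| ^ (α + 1 - 1) * h x t = 0 := by
    intro x t
    rcases eq_or_ne x 0 with rfl | hx
    · simp [hh₂, h0]
    · simp only [hh₂, if_neg hx, hh, hyne x t hx, add_sub_cancel_right, abs_mul,
        abs_of_pos (hκpos x)]
      -- These two identities are what ω and κ were chosen for: both the inertial and the nonlinear
      -- coefficient become q, and the oscillator equation remains.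
      have g1 : s x * (ω x * ω x) = q x := by
        rw [Real.mul_self_sqrt (hqs x).le, mul_div_cancel₀ _ (hs_pos x).ne']
      have g2 : V x * κ x ^ α = q x := by
        rw [hκ, ← Real.rpow_mul (hqV x).le, one_div_mul_cancel hα.ne', Real.rpow_one,
          mul_div_cancel₀ _ (hV_pos x).ne']
      rw [Real.mul_rpow (hκpos x).le (abs_nonneg _)]
      generalize orbit α (ω x * t, r x) = Z
      linear_combination (-κ x * Z * (1 + |Z| ^ α)) * g1 + (|Z| ^ α * κ x * Z) * g2
  have hns : ∃ x t t', radialField h x t ≠ radialField h x t' := by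
    -- Away from the origin the orbit vanishes at time 0 but not at all times, so any nonzero point
    -- witnesses time dependence.
    set e : E3 := EuclideanSpace.single 0 1 with he
    have hen : e ≠ 0 := by
      rw [← norm_ne_zero_iff]
      simp [he]
    obtain ⟨τ, hτ⟩ := exists_orbit_ne_zero hα (r e)
    refine ⟨e, τ / ω e, 0, fun hcon => ?_⟩
    have h1 := congrArg norm hcon
    rw [norm_radialField h0, norm_radialField h0] at h1
    simp only [hh, hyne e _ hen, mul_zero, orbit_zero hα, abs_zero, abs_eq_zero, mul_eq_zero,
      (hκpos e).ne', false_or, mul_div_cancel₀ _ (hωpos e).ne'] at h1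
    exact hτ h1
  have main : ∀ a : E3 → ℝ, IsRadial a → ContDiff ℝ 2 a →
      IsBreather s q V (α + 1) T δ (phaseShift (radialField h) a) ∧
        IsRadialGradientField (phaseShift (radialField h) a) := fun a ha hac =>
    ⟨isBreather_phaseShift_radialField hc hrad h0 hU hper hloc hd₁ hd₂ hode hns ha hac,
      isRadialGradientField_phaseShift_radialField hc hrad h0 ha hac.continuous⟩
  have hzero : phaseShift (radialField h) (fun _ => 0) = radialField h := by
    funext x t
    simp only [phaseShift, add_zero]
  have main0 := main (fun _ => 0) (fun _ _ _ => rfl) contDiff_const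
  rw [hzero] at main0
  exact ⟨radialField h, main0.1, main0.2, main, continuum_le_mk_phaseShift hU.continuous hns⟩
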